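/- **Definitions.** An operator space is a complex Banach space $F$ with complete norms on all $M_n(F)$ satisfying Ruan's axioms; $F$ is $\kappa$-homogeneous if every bounded linear $u:F\to F$ satisfies $\|u\|_{cb}\le\kappa\|u\|$, and homogeneous if it is $\kappa$-homogeneous for some $\kappa$. $C$ and $R$ are the column and row operator spaces on $\ell_2$, and $C\oplus R$ is their $\ell_\infty$-direct sum. $F\in QS_M(C\oplus R)$ means that there are closed subspaces $S\subset V\subset C\oplus R$ and a linear isomorphism $T:F\to V/S$ with $\|T\|_{cb},\|T^{-1}\|_{cb}\le M$; $F\in HQS(C\oplus R)$ means that $F$ is homogeneous and $F\in QS_M(C\oplus R)$ for some $M$. If $u_c,u_r\ge 0$ are measurable functions (weights) on $\mathbb R$ with $\int_{\mathbb R}\min(u_c,u_r)\,ds<\infty$, then $K_{u_c,u_r}$ is the subspace of constant functions $\{1\otimes x:x\in\ell_2\}$ of $L_2^c(u_c;\ell_2)+L_2^r(u_r;\ell_2)$ (column and row operator spaces on the weighted spaces $L_2(u\,ds;\ell_2)$; the sum is the quotient of the $\ell_\infty$-direct sum), and it is identified with $\ell_2$. The intersection $\lambda C\cap\gamma R\cap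 K_{u_c,u_r}$ ($\lambda,\gamma\ge0$) is $\ell_2$ with the matrix norms $\max(\lambda\|x\|_{M_n(C)},\gamma\|x\|_{M_n(R)},\|x\|_{M_n(K_{u_c,u_r})})$, so that a term with coefficient $0$ is omitted. A basis $(e_k)_{k\ge1}$ of $F$ is called an orthonormal basis if it is the image of the canonical basis of $\ell_2$ under a Banach space isomorphism $\ell_2\to F$. The fundamental functions of $F$ with respect to it are $$\Phi_c(n)=\Big\|\sum_{k=1}^n e_{k1}\otimes e_k\Big\|_{C\otimes_{\min}F}^2,\qquad \Phi_r(n)=\Big\|\sum_{k=1}^n e_{1k}\otimes e_k\Big\|_{R\otimes_{\min}F}^2\qquad(n\ge1).$$ A positive function $g$ on $\{1,2,\dots\}$ or on $[1,\infty)$ is regular if there are $c,d>0$ and $0<\alpha\le\beta<1$ with $c(t/s)^\alpha\le g(t)/g(s)\le d(t/s)^\beta$ for all $t\ge s\ge1$ in its domain. Functions on $\{1,2,\dots\}$ are extended piecewise linearly to $[1,\infty)$, and $g^{-1}(t)=\inf\{s\ge1:g(s)\ge t\}$ (for continuous increasing unbounded $g$ this is $\max(1,\cdot)$ of the usual inverse).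 $A\sim B$ means $a^{-1}B\le A\le aB$ for some constant $a>0$. A pair $(w_c,w_r)$ of nonnegative functions on $\mathbb R$ is normalized if $w_c=1$ on $(0,\infty)$ and $w_c$ is nondecreasing and left continuous, $w_r=1$ on $(-\infty,0)$ and $w_r$ is nonincreasing and right continuous, and $\int_{-\infty}^0w_c=1=\int_0^\infty w_r$. **Theorem.** (1) There is a function $c(\kappa,M)$ such that for every infinite-dimensional $\kappa$-homogeneous operator space $F\in QS_M(C\oplus R)$ there are $\lambda,\gamma\in[0,1]$ and strictly positive weights $u_c,u_r$ on $\mathbb R$ with $\int\min(u_c,u_r)\,ds<\infty$ and a linear isomorphism $T$ from $F$ onto $\lambda C\cap\gamma R\cap K_{u_c,u_r}$ with $\|T\|_{cb},\|T^{-1}\|_{cb}\le c(\kappa,M)$. (2) Let $F\in HQS(C\oplus R)$ have an orthonormal basis for which $\Phi_c$ and $\Phi_r$ are regular. Then (a) whenever $F$ is completely isomorphic to $\lambda C\cap\gamma R\cap K_{u_c,u_r}$ with $\lambda,\gamma\ge0$ and weights $u_c,u_r$ with $\int\min(u_c,u_r)\,ds<\infty$, then $\lambda=\gamma=0$; (b)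 $F$ is completely isomorphic to $K_{w_c,w_r}$ for some normalized pair $(w_c,w_r)$; (c) every normalized pair $(w_c,w_r)$ such that $F$ is completely isomorphic to $K_{w_c,w_r}$ satisfies $$w_c(-t)\sim\frac1{\Phi_c^{-1}(t)},\qquad w_r(t)\sim\frac1{\Phi_r^{-1}(t)}\qquad(t\ge1);$$ so the normalized pair is unique up to equivalence. (3) Conversely, let $g_c,g_r:[1,\infty)\to(0,\infty)$ be regular. Then, up to complete isomorphism, there is exactly one $F\in HQS(C\oplus R)$ having an orthonormal basis with $\Phi_c(n)\sim g_c(n)$ and $\Phi_r(n)\sim g_r(n)$ for $n\ge1$. It is $K_{w_c,w_r}$ for a normalized pair with $w_c(-t)\sim1/g_c^{-1}(t)$ and $w_r(t)\sim1/g_r^{-1}(t)$ for $t\ge1$, and this $K_{w_c,w_r}$ is a homogeneous operator space in $QS_1(C\oplus R)$. -/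

import Mathlib

open MeasureTheory
open scoped Matrix.Norms.L2Operator

noncomputable section

namespace OpSpace

/-- The Hilbert space of square summable complex sequences (indices start at `0`). -/
abbrev Ell2 : Type := lp (fun _ : ℕ => ℂ) 2

/-- A candidate operator space structure on `E`: for every `n` a real function on the
`n × n` matrices over `E`. The laws are collected in `IsOperatorSpace`. -/
abbrev MatrixNorms (E : Type*) : Type _ := (n : ℕ) → Matrix (Fin n) (Fin n) E → ℝ

section General

variable {E E' : Type*} [AddCommGroup E] [Module ℂ E] [AddCommGroup E'] [Module ℂ E']

/-- The Banach space norm underlying matrix norms: the norm of a `1 × 1` matrix. -/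
def norm1 (N : MatrixNorms E) (x : E) : ℝ := N 1 (fun _ _ => x)

/-- The product `a x b` of a matrix `x` over `E` with scalar matrices `a`, `b`. -/
def bimul {m n : ℕ} (a : Matrix (Fin m) (Fin n) ℂ) (x : Matrix (Fin n) (Fin n) E)
    (b : Matrix (Fin n) (Fin m) ℂ) : Matrix (Fin m) (Fin m) E :=
  fun i j => ∑ k, ∑ l, (a i k * b l j) • x k l

/-- The block diagonal sum of two square matrices over `E`. -/
def blockDiag {m n : ℕ} (x : Matrix (Fin m) (Fin m) E) (y : Matrix (Fin n) (Fin n) E) :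
    Matrix (Fin (m + n)) (Fin (m + n)) E :=
  (Matrix.fromBlocks x 0 0 y).submatrix finSumFinEquiv.symm finSumFinEquiv.symm

/-- A (complete, abstract) operator space: norms on all matrix levels satisfying Ruan's axioms.
Norms of scalar matrices are operator norms for the Euclidean norms. -/
structure IsOperatorSpace (N : MatrixNorms E) : Prop where
  nonneg : ∀ n x, 0 ≤ N n x
  eq_zero_iff : ∀ n x, N n x = 0 ↔ x = 0
  add_le : ∀ n x y, N n (x + y) ≤ N n x + N n y
  bimul_le : ∀ (m n : ℕ) (a : Matrix (Fin m) (Fin n) ℂ) (x : Matrix (Fin n) (Fin n) E)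
    (b : Matrix (Fin n) (Fin m) ℂ), N m (bimul a x b) ≤ ‖a‖ * N n x * ‖b‖
  blockDiag_eq : ∀ (m n : ℕ) (x : Matrix (Fin m) (Fin m) E) (y : Matrix (Fin n) (Fin n) E),
    N (m + n) (blockDiag x y) = max (N m x) (N n y)
  complete : ∀ f : ℕ → E,
    (∀ ε > 0, ∃ k, ∀ i ≥ k, ∀ j ≥ k, norm1 N (f i - f j) < ε) →
    ∃ x, ∀ ε > 0, ∃ k, ∀ i ≥ k, norm1 N (f i - x) < ε

/-- `E` and `E'` are completely isomorphic, by an isomorphism `T` with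
`‖T‖_cb ≤ K` and `‖T⁻¹‖_cb ≤ K`. -/
def CompletelyIsoWith (K : ℝ) (N : MatrixNorms E) (N' : MatrixNorms E') : Prop :=
  ∃ T : E ≃ₗ[ℂ] E', ∀ (n : ℕ) (x : Matrix (Fin n) (Fin n) E),
    N' n (x.map T) ≤ K * N n x ∧ N n x ≤ K * N' n (x.map T)

/-- Complete isomorphism. -/
def CompletelyIso (N : MatrixNorms E) (N' : MatrixNorms E') : Prop :=
  ∃ K : ℝ, CompletelyIsoWith K N N'

/-- `κ`-homogeneity: every bounded linear map `u` on `E` satisfies `‖u‖_cb ≤ κ ‖u‖`. -/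
def IsHomogeneousWith (κ : ℝ) (N : MatrixNorms E) : Prop :=
  ∀ (u : E →ₗ[ℂ] E) (B : ℝ), 0 ≤ B → (∀ x, norm1 N (u x) ≤ B * norm1 N x) →
    ∀ (n : ℕ) (x : Matrix (Fin n) (Fin n) E), N n (x.map u) ≤ κ * B * N n x

/-- The quotient `V / S` (for `S ≤ V`) with the quotient operator space structure of the
subspace `V` of `E`. -/
def subquotientNorms (N : MatrixNorms E) (V S : Submodule ℂ E) :
    MatrixNorms (V ⧸ S.submoduleOf V) :=
  fun n x => sInf {t : ℝ | ∃ y : Matrix (Fin n) (Fin n) V,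
    y.map (Submodule.Quotient.mk (p := S.submoduleOf V)) = x ∧
      t = N n (y.map (fun v : V => (v : E)))}

end General

section Hilbert

variable {H : Type*} [NormedAddCommGroup H] [InnerProductSpace ℂ H]

/-- The column operator space `H^c = B(ℂ, H)`: the norm of `x` is `‖x* x‖ ^ (1/2)`. -/
def columnNorms (H : Type*) [NormedAddCommGroup H] [InnerProductSpace ℂ H] : MatrixNorms H :=
  fun n x => Real.sqrt
    ‖(Matrix.of fun i j => ∑ l, inner ℂ (x l i) (x l j) : Matrix (Fin n) (Fin n) ℂ)‖

/-- The row operator space `H^r`: the norm of `x` is `‖x x*‖ ^ (1/2)`. -/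
def rowNorms (H : Type*) [NormedAddCommGroup H] [InnerProductSpace ℂ H] : MatrixNorms H :=
  fun n x => Real.sqrt
    ‖(Matrix.of fun i j => ∑ l, inner ℂ (x j l) (x i l) : Matrix (Fin n) (Fin n) ℂ)‖

end Hilbert

/-- The column space `C`. -/
def C : MatrixNorms Ell2 := columnNorms Ell2

/-- The row space `R`. -/
def R : MatrixNorms Ell2 := rowNorms Ell2

/-- The direct sum `C ⊕ R`, in the `ℓ_∞` sense. -/
def CsumR : MatrixNorms (Ell2 × Ell2) :=
  fun n x => max (C n (x.map Prod.fst)) (R n (x.map Prod.snd))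

section HQS

variable {E : Type*} [AddCommGroup E] [Module ℂ E]

/-- `E` is `M`-completely isomorphic to a quotient of a (closed) subspace of `C ⊕ R`
by a closed subspace. For `M = 1` the isomorphism is completely isometric. -/
def IsQSWith (M : ℝ) (N : MatrixNorms E) : Prop :=
  ∃ V S : Submodule ℂ (Ell2 × Ell2),
    IsClosed (V : Set (Ell2 × Ell2)) ∧ IsClosed (S : Set (Ell2 × Ell2)) ∧ S ≤ V ∧
      CompletelyIsoWith M N (subquotientNorms CsumR V S)

/-- `E` is a `κ`-homogeneous operator space which belongs to `QS(C ⊕ R)` up to an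
`M`-complete isomorphism. -/
structure IsHQSWith (κ M : ℝ) (N : MatrixNorms E) : Prop where
  isOperatorSpace : IsOperatorSpace N
  homogeneous : IsHomogeneousWith κ N
  subquotient : IsQSWith M N

/-- The class `HQS(C ⊕ R)`. -/
def IsHQS (N : MatrixNorms E) : Prop := ∃ κ M : ℝ, IsHQSWith κ M N

/-- `J` is an isomorphism (at the Banach space level) from `ℓ₂` onto `E`; the vectors `J e_k` are
then an orthonormal basis of the Hilbertian space `E`. -/
def IsHilbertIso (N : MatrixNorms E) (J : Ell2 ≃ₗ[ℂ] E) : Prop :=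
  ∃ A : ℝ, ∀ x, norm1 N (J x) ≤ A * ‖x‖ ∧ ‖x‖ ≤ A * norm1 N (J x)

/-- The canonical basis of `ℓ₂`. -/
def stdVec (k : ℕ) : Ell2 := lp.single 2 k (1 : ℂ)

/-- The column fundamental function
`Φ_c(n) = ‖∑_{k ≤ n} e_{k1} ⊗ J e_k‖²` in `C ⊗_min E`, i.e. the square of the norm of the matrix
whose first column consists of the first `n` basis vectors, all other entries being zero. -/
def fundC (N : MatrixNorms E) (J : Ell2 ≃ₗ[ℂ] E) (n : ℕ) : ℝ :=
  (N n (fun i j => if (j : ℕ) = 0 then J (stdVec i) else 0)) ^ 2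

/-- The row fundamental function `Φ_r(n) = ‖∑_{k ≤ n} e_{1k} ⊗ J e_k‖²` in `R ⊗_min E`. -/
def fundR (N : MatrixNorms E) (J : Ell2 ≃ₗ[ℂ] E) (n : ℕ) : ℝ :=
  (N n (fun i j => if (i : ℕ) = 0 then J (stdVec j) else 0)) ^ 2

end HQS

section Weights

variable {Ω : Type*} [MeasurableSpace Ω]

/-- The measure `u dν`. -/
def weighted (ν : Measure Ω) (u : Ω → ℝ) : Measure Ω :=
  ν.withDensity (fun ω => ENNReal.ofReal (u ω))

/-- A pair of weights (nonnegative measurable functions) satisfying the weight condition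
`∫ min(u_c, u_r) dν < ∞`. -/
structure IsWeightPair (ν : Measure Ω) (uc ur : Ω → ℝ) : Prop where
  measurable_c : Measurable uc
  measurable_r : Measurable ur
  nonneg_c : ∀ ω, 0 ≤ uc ω
  nonneg_r : ∀ ω, 0 ≤ ur ω
  integrable_min : Integrable (fun ω => min (uc ω) (ur ω)) ν

/-- The space `K_{u_c,u_r}` of constant functions in
`L_2^c(u_c; ℓ₂) + L_2^r(u_r; ℓ₂)`, realised on `ℓ₂` by identifying `1 ⊗ x` with `x`. The norm of
a matrix is the quotient norm: the infimum of `max(‖a‖, ‖b‖)` over all decompositions of the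
constant function `x` as `a + b` almost everywhere. -/
def K (ν : Measure Ω) (uc ur : Ω → ℝ) : MatrixNorms Ell2 :=
  fun n x => sInf {t : ℝ | ∃ (a b : Fin n → Fin n → Ω → Ell2)
    (ha : ∀ i j, MemLp (a i j) 2 (weighted ν uc)) (hb : ∀ i j, MemLp (b i j) 2 (weighted ν ur)),
    (∀ i j, ∀ᵐ ω ∂ν, a i j ω + b i j ω = x i j) ∧
    t = max
      (columnNorms (Lp Ell2 2 (weighted ν uc)) n (fun i j => (ha i j).toLp (a i j)))
      (rowNorms (Lp Ell2 2 (weighted ν ur)) n (fun i j => (hb i j).toLp (b i j)))}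

/-- The intersection `lam C ∩ gam R ∩ K_{u_c,u_r}`; a component whose coefficient is `0` does not
contribute. -/
def interCRK (lam gam : ℝ) (ν : Measure Ω) (uc ur : Ω → ℝ) : MatrixNorms Ell2 :=
  fun n x => max (max (lam * C n x) (gam * R n x)) (K ν uc ur n x)

/-- The normalisation of a pair of weights on the line. -/
structure IsNormalized (wc wr : ℝ → ℝ) : Prop where
  nonneg_c : ∀ s, 0 ≤ wc s
  nonneg_r : ∀ s, 0 ≤ wr s
  one_c : ∀ s, 0 < s → wc s = 1
  one_r : ∀ s, s < 0 → wr s = 1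
  monotone_c : Monotone wc
  antitone_r : Antitone wr
  left_cont_c : ∀ s, ContinuousWithinAt wc (Set.Iic s) s
  right_cont_r : ∀ s, ContinuousWithinAt wr (Set.Ici s) s
  integrable_c : IntegrableOn wc (Set.Iic 0)
  integrable_r : IntegrableOn wr (Set.Ici 0)
  integral_c : ∫ s in Set.Iic (0 : ℝ), wc s = 1
  integral_r : ∫ s in Set.Ici (0 : ℝ), wr s = 1

end Weights

/-- Regularity of a sequence `Φ(1), Φ(2), …`. -/
def IsRegularSeq (Φ : ℕ → ℝ) : Prop :=
  ∃ c d α β : ℝ, 0 < c ∧ 0 < d ∧ 0 < α ∧ α ≤ β ∧ β < 1 ∧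
    ∀ k n : ℕ, 1 ≤ k → k ≤ n →
      c * ((n : ℝ) / k) ^ α ≤ Φ n / Φ k ∧ Φ n / Φ k ≤ d * ((n : ℝ) / k) ^ β

/-- Regularity of a positive function on `[1, ∞)`. -/
def IsRegularFun (g : ℝ → ℝ) : Prop :=
  (∀ s, 1 ≤ s → 0 < g s) ∧
  ∃ c d α β : ℝ, 0 < c ∧ 0 < d ∧ 0 < α ∧ α ≤ β ∧ β < 1 ∧
    ∀ s t : ℝ, 1 ≤ s → s ≤ t →
      c * (t / s) ^ α ≤ g t / g s ∧ g t / g s ≤ d * (t / s) ^ β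

/-- The piecewise linear extension of a sequence to `[0, ∞)`. -/
def plExt (Φ : ℕ → ℝ) (s : ℝ) : ℝ :=
  (1 - (s - ⌊s⌋₊)) * Φ ⌊s⌋₊ + (s - ⌊s⌋₊) * Φ (⌊s⌋₊ + 1)

/-- The generalised inverse `g⁻¹(t) = inf {s ≥ 1 : g(s) ≥ t}`; it equals `max 1 (g⁻¹ t)` when `g`
is continuous, increasing and unbounded. -/
def genInv (g : ℝ → ℝ) (t : ℝ) : ℝ := sInf {s : ℝ | 1 ≤ s ∧ t ≤ g s}

/-- `f(x) ∼ g(x)` uniformly in those `x` that satisfy `p`. -/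
def EquivOn {X : Type*} (p : X → Prop) (f g : X → ℝ) : Prop :=
  ∃ A : ℝ, 0 < A ∧ ∀ x, p x → A⁻¹ * g x ≤ f x ∧ f x ≤ A * g x

end OpSpace

end

noncomputable section

namespace OpSpace

/-! A subquotient of C ⊕ R is a linear relation between pairs (a, b) and vectors x: the norm of a
matrix is the infimum of max(‖a‖_c, ‖b‖_r) over entrywise lifts. Squared column and row norms are
norms of Gram matrices, which are convex in the lift, so Hahn-Banach separation turns the infimum
into a supremum. Up to a factor 2, the squared norm of x is the supremum of ∑ q(φ_j, ψ_i)((W x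
U)_ij), where q(s, t)(x) = inf (s‖a‖² + t‖b‖²), W and U are unitary, and φ, ψ are positive weights
of total mass at most 1 (`sum_relForm_le`, `relNorm_sq_le`).

Homogeneity makes q scalar. Contractions of ℓ₂ act on a homogeneous space with a uniform cb bound,
so a finite dimensional subspace can be moved onto the span of well chosen basis vectors of ℓ₂,
where the forms q(s, t) agree up to a factor 4 with k(s, t)‖·‖²; here k is the limit along a free
ultrafilter (`IsFormFamily.exists_scalarizing`). Thus the operator space is encoded, up to
constants, by one function k that is homogeneous, monotone and concave along dyadic points
(`Represents`, `IsHQSWith.exists_represents`). For K this function is ∫ min(s u_c, t u_r), by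
pointwise minimisation; for C and R it is s and t. A summation by parts at powers of 2 writes every
such k, up to constants, as λ² s + γ² t + ∫ min(s u_c, t u_r) (`exists_weights`), which gives (1).

The fundamental functions are Φ_c(n) ∼ k(n, 1) and Φ_r(n) ∼ k(1, n), whatever the orthonormal basis
(`Represents.fundC_equiv`). Since k is homogeneous, they determine k up to constants and hence the
space up to complete isomorphism (`Represents.completelyIso_of_equivOn`). Growth exponents below 1
exclude the linear terms, so λ = γ = 0.

For a normalized pair, k(1, n) = 1 + ∫_0^∞ min(n w_r, 1), and k(n, 1) is the same expression for the
reflected w_c. For regular g this is equivalent to g exactly when the weight is equivalent to 1 /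
g⁻¹: one direction integrates a power tail of exponent 1/β > 1 (`IsProfile.truncMean_equiv`), the
other bounds the tail integral from the growth of g (`IsProfile.equiv_of_truncMean`). Existence
follows by building a normalized, strictly positive weight from g⁻¹ (`IsRegularFun.exists_profile`).
-/

lemma l2_norm_mulVec_sq_le {m n : ℕ} (A : Matrix (Fin m) (Fin n) ℂ) (x : Fin n → ℂ) :
    ∑ i, ‖∑ k, A i k * x k‖ ^ 2 ≤ ‖A‖ ^ 2 * ∑ k, ‖x k‖ ^ 2 := by
  have h := Matrix.l2_opNorm_mulVec A (WithLp.toLp 2 x)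
  have h2 := pow_le_pow_left₀ (norm_nonneg _) h 2
  rw [mul_pow, EuclideanSpace.norm_sq_eq, EuclideanSpace.norm_sq_eq] at h2
  simpa [Matrix.mulVec, dotProduct] using h2

lemma l2_norm_le_of_forall {m n : ℕ} (A : Matrix (Fin m) (Fin n) ℂ) {c : ℝ} (hc : 0 ≤ c)
    (h : ∀ x : Fin n → ℂ, ∑ i, ‖∑ k, A i k * x k‖ ^ 2 ≤ c ^ 2 * ∑ k, ‖x k‖ ^ 2) : ‖A‖ ≤ c := by
  rw [Matrix.l2_opNorm_def]
  refine ContinuousLinearMap.opNorm_le_bound _ hc fun x => ?_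
  refine le_of_sq_le_sq ?_ (by positivity)
  rw [mul_pow, EuclideanSpace.norm_sq_eq, EuclideanSpace.norm_sq_eq]
  simpa [Matrix.mulVec, dotProduct] using h x.ofLp

lemma l2_norm_transpose_le {m n : ℕ} (A : Matrix (Fin m) (Fin n) ℂ) : ‖A.transpose‖ ≤ ‖A‖ := by
  refine l2_norm_le_of_forall _ (norm_nonneg _) fun x => ?_
  have h := l2_norm_mulVec_sq_le A.conjTranspose (fun k => star (x k))
  rw [Matrix.l2_opNorm_conjTranspose] at h
  calc ∑ i, ‖∑ k, A.transpose i k * x k‖ ^ 2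
      = ∑ i, ‖∑ k, A.conjTranspose i k * star (x k)‖ ^ 2 := by
        refine Finset.sum_congr rfl fun i _ => ?_
        rw [← norm_star]
        simp [star_sum, Matrix.conjTranspose_apply]
    _ ≤ ‖A‖ ^ 2 * ∑ k, ‖star (x k)‖ ^ 2 := h
    _ = ‖A‖ ^ 2 * ∑ k, ‖x k‖ ^ 2 := by simp only [norm_star]

lemma norm_le_one_of_mem_unitary {n : ℕ} {W : Matrix (Fin n) (Fin n) ℂ}
    (hW : W ∈ Matrix.unitaryGroup (Fin n) ℂ) : ‖W‖ ≤ 1 := by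
  refine l2_norm_le_of_forall _ zero_le_one fun x => ?_
  have h1 : ‖W‖ * ‖W‖ = ‖(1 : Matrix (Fin n) (Fin n) ℂ)‖ := by
    rw [← Matrix.l2_opNorm_conjTranspose_mul_self, ← Matrix.star_eq_conjTranspose,
      Matrix.mem_unitaryGroup_iff'.1 hW]
  have h2 : ‖(1 : Matrix (Fin n) (Fin n) ℂ)‖ ≤ 1 :=
    l2_norm_le_of_forall _ zero_le_one fun x => by simp [Matrix.one_apply]
  refine (l2_norm_mulVec_sq_le W x).trans ?_
  gcongr
  nlinarith [norm_nonneg W]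

/-! ### Column and row norms through the quadratic form of the Gram matrix -/

section

variable {H : Type*} [NormedAddCommGroup H] [InnerProductSpace ℂ H]

/-- Parseval in an orthonormal basis of the span of the `y k` reduces this to the scalar estimate,
one coordinate at a time. -/
lemma sum_norm_smul_sq_le {m n : ℕ} (A : Matrix (Fin m) (Fin n) ℂ) (y : Fin n → H) :
    ∑ i, ‖∑ k, A i k • y k‖ ^ 2 ≤ ‖A‖ ^ 2 * ∑ k, ‖y k‖ ^ 2 := by
  classical
  let P : Submodule ℂ H := Submodule.span ℂ (Set.range y)
  have : FiniteDimensional ℂ P := FiniteDimensional.span_of_finite ℂ (Set.finite_range y)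
  let b := stdOrthonormalBasis ℂ P
  let y' : Fin n → P := fun k => ⟨y k, Submodule.subset_span ⟨k, rfl⟩⟩
  have e1 : ∀ i, ‖∑ k, A i k • y k‖ ^ 2 = ∑ p, ‖∑ k, A i k * inner ℂ (b p) (y' k)‖ ^ 2 := by
    intro i
    have : ‖∑ k, A i k • y k‖ = ‖∑ k, A i k • y' k‖ := by
      change _ = ‖((∑ k, A i k • y' k : P) : H)‖
      simp [y']
    rw [this, ← b.sum_sq_norm_inner_right]
    simp [inner_sum, inner_smul_right]
  have e2 : ∀ k, ‖y k‖ ^ 2 = ∑ p, ‖inner ℂ (b p) (y' k)‖ ^ 2 := by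
    intro k
    rw [b.sum_sq_norm_inner_right]; rfl
  simp_rw [e1, e2]
  rw [Finset.sum_comm, Finset.sum_comm (s := Finset.univ (α := Fin n)), Finset.mul_sum]
  exact Finset.sum_le_sum fun p _ => l2_norm_mulVec_sq_le A _

/-- The Gram matrix `a* a` of a matrix of vectors. -/
def gram {n : ℕ} (a : Matrix (Fin n) (Fin n) H) : Matrix (Fin n) (Fin n) ℂ :=
  Matrix.of fun i j => ∑ l, inner ℂ (a l i) (a l j)

/-- The quadratic form of the Gram matrix. -/
def colSq {n : ℕ} (a : Matrix (Fin n) (Fin n) H) (α : Fin n → ℂ) : ℝ :=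
  ∑ l, ‖∑ j, α j • a l j‖ ^ 2

lemma colSq_nonneg {n : ℕ} (a : Matrix (Fin n) (Fin n) H) (α : Fin n → ℂ) : 0 ≤ colSq a α :=
  Finset.sum_nonneg fun _ _ => by positivity

lemma gram_form {n : ℕ} (a : Matrix (Fin n) (Fin n) H) (α β : Fin n → ℂ) :
    ∑ i, star (α i) * ∑ j, gram a i j * β j
      = ∑ l, inner ℂ (∑ i, α i • a l i) (∑ j, β j • a l j) := by
  simp only [gram, Matrix.of_apply, sum_inner, inner_sum, inner_smul_left, inner_smul_right,
    Finset.mul_sum, Finset.sum_mul]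
  rw [Finset.sum_comm]
  refine (Finset.sum_congr rfl fun j _ => Finset.sum_comm).trans ?_
  rw [Finset.sum_comm]
  refine Finset.sum_congr rfl fun l _ => ?_
  refine Finset.sum_congr rfl fun i _ => Finset.sum_congr rfl fun j _ => ?_
  simp only [RCLike.star_def]
  ring

lemma gram_form_self {n : ℕ} (a : Matrix (Fin n) (Fin n) H) (α : Fin n → ℂ) :
    ∑ i, star (α i) * ∑ j, gram a i j * α j = (colSq a α : ℂ) := by
  rw [gram_form, colSq]
  push_cast
  refine Finset.sum_congr rfl fun l _ => ?_
  rw [inner_self_eq_norm_sq_to_K]; rfl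

lemma norm_form_le {n : ℕ} (p : Matrix (Fin n) (Fin n) ℂ) (α : Fin n → ℂ) :
    ‖∑ i, star (α i) * ∑ j, p i j * α j‖ ≤ ‖p‖ * ∑ j, ‖α j‖ ^ 2 := by
  have h := l2_norm_mulVec_sq_le p α
  have hS : 0 ≤ ∑ j, ‖α j‖ ^ 2 := Finset.sum_nonneg fun _ _ => by positivity
  calc ‖∑ i, star (α i) * ∑ j, p i j * α j‖ ≤ ∑ i, ‖α i‖ * ‖∑ j, p i j * α j‖ := by
        refine (norm_sum_le _ _).trans (Finset.sum_le_sum fun i _ => ?_)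
        rw [norm_mul, norm_star]
    _ ≤ √(∑ i, ‖α i‖ ^ 2) * √(∑ i, ‖∑ j, p i j * α j‖ ^ 2) := Real.sum_mul_le_sqrt_mul_sqrt _ _ _
    _ ≤ √(∑ i, ‖α i‖ ^ 2) * √(‖p‖ ^ 2 * ∑ j, ‖α j‖ ^ 2) := by gcongr
    _ = ‖p‖ * ∑ j, ‖α j‖ ^ 2 := by
        rw [Real.sqrt_mul (by positivity), Real.sqrt_sq (norm_nonneg _), mul_left_comm,
          Real.mul_self_sqrt hS]

lemma colSq_le {n : ℕ} (a : Matrix (Fin n) (Fin n) H) (α : Fin n → ℂ) :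
    colSq a α ≤ ‖gram a‖ * ∑ j, ‖α j‖ ^ 2 := by
  have h := norm_form_le (gram a) α
  rwa [gram_form_self, Complex.norm_real, Real.norm_of_nonneg (colSq_nonneg a α)] at h

/-- Cauchy-Schwarz passes from the diagonal values of the Gram form to the operator norm: with γ =
(gram a) β, the number ‖γ‖² is the value of the form at (γ, β). -/
lemma norm_gram_le {n : ℕ} (a : Matrix (Fin n) (Fin n) H) {c : ℝ} (hc : 0 ≤ c)
    (h : ∀ α, colSq a α ≤ c * ∑ j, ‖α j‖ ^ 2) : ‖gram a‖ ≤ c := by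
  refine l2_norm_le_of_forall _ hc fun β => ?_
  set γ : Fin n → ℂ := fun i => ∑ j, gram a i j * β j with hγ
  have e : ((∑ i, ‖γ i‖ ^ 2 : ℝ) : ℂ) = ∑ i, star (γ i) * γ i := by
    push_cast
    refine Finset.sum_congr rfl fun i _ => ?_
    rw [RCLike.star_def, ← Complex.normSq_eq_conj_mul_self, Complex.normSq_eq_norm_sq]
    push_cast; rfl
  have hS : 0 ≤ ∑ i, ‖γ i‖ ^ 2 := Finset.sum_nonneg fun _ _ => by positivity
  have h1 : ∑ i, ‖γ i‖ ^ 2 ≤ √(colSq a γ) * √(colSq a β) := by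
    have : ∑ i, ‖γ i‖ ^ 2 = ‖((∑ i, ‖γ i‖ ^ 2 : ℝ) : ℂ)‖ := by
      rw [Complex.norm_real, Real.norm_of_nonneg hS]
    rw [this, e, gram_form]
    refine (norm_sum_le _ _).trans ((Finset.sum_le_sum fun l _ => norm_inner_le_norm _ _).trans ?_)
    exact Real.sum_mul_le_sqrt_mul_sqrt _ _ _
  have h2 : (∑ i, ‖γ i‖ ^ 2) ^ 2 ≤ colSq a γ * colSq a β := by
    calc _ ≤ (√(colSq a γ) * √(colSq a β)) ^ 2 := by gcongr
      _ = _ := by rw [mul_pow, Real.sq_sqrt (colSq_nonneg _ _), Real.sq_sqrt (colSq_nonneg _ _)]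
  have h3 : colSq a γ * colSq a β ≤ (c * ∑ i, ‖γ i‖ ^ 2) * (c * ∑ j, ‖β j‖ ^ 2) :=
    mul_le_mul (h γ) (h β) (colSq_nonneg _ _) (by positivity)
  rcases hS.eq_or_lt with h0 | h0
  · rw [← h0]; positivity
  · nlinarith

lemma columnNorms_nonneg (n : ℕ) (a : Matrix (Fin n) (Fin n) H) : 0 ≤ columnNorms H n a :=
  Real.sqrt_nonneg _

lemma columnNorms_sq (n : ℕ) (a : Matrix (Fin n) (Fin n) H) :
    columnNorms H n a ^ 2 = ‖gram a‖ := Real.sq_sqrt (norm_nonneg _)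

lemma colSq_le_columnNorms {n : ℕ} (a : Matrix (Fin n) (Fin n) H) (α : Fin n → ℂ) :
    colSq a α ≤ columnNorms H n a ^ 2 * ∑ j, ‖α j‖ ^ 2 := by
  rw [columnNorms_sq]; exact colSq_le a α

lemma columnNorms_le {n : ℕ} (a : Matrix (Fin n) (Fin n) H) {r : ℝ} (hr : 0 ≤ r)
    (h : ∀ α, colSq a α ≤ r ^ 2 * ∑ j, ‖α j‖ ^ 2) : columnNorms H n a ≤ r :=
  Real.sqrt_le_iff.2 ⟨hr, norm_gram_le a (by positivity) h⟩

/-- The two Gram matrices are transposes of each other, and transposition preserves the operator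
norm. Row statements are deduced from column statements in this way. -/
lemma rowNorms_eq (n : ℕ) (a : Matrix (Fin n) (Fin n) H) :
    rowNorms H n a = columnNorms H n a.transpose := by
  have : (Matrix.of fun i j => ∑ l, inner ℂ (a j l) (a i l) : Matrix (Fin n) (Fin n) ℂ)
      = (gram a.transpose).transpose := by
    ext i j; simp [gram, Matrix.transpose_apply]
  unfold rowNorms columnNorms
  rw [this]
  congr 1
  refine le_antisymm (l2_norm_transpose_le _) ?_
  have := l2_norm_transpose_le (gram a.transpose).transpose
  rwa [Matrix.transpose_transpose] at this

lemma rowNorms_nonneg (n : ℕ) (a : Matrix (Fin n) (Fin n) H) : 0 ≤ rowNorms H n a :=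
  Real.sqrt_nonneg _

lemma bimul_transpose {E : Type*} [AddCommGroup E] [Module ℂ E] {m n : ℕ}
    (a : Matrix (Fin m) (Fin n) ℂ) (x : Matrix (Fin n) (Fin n) E)
    (b : Matrix (Fin n) (Fin m) ℂ) :
    (bimul a x b).transpose = bimul b.transpose x.transpose a.transpose := by
  ext i j
  simp only [bimul, Matrix.transpose_apply]
  rw [Finset.sum_comm]
  simp_rw [mul_comm]

/-- For fixed α this is the triangle inequality in an ℓ₂-sum of copies of `H`. -/
lemma columnNorms_add_le (n : ℕ) (a b : Matrix (Fin n) (Fin n) H) :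
    columnNorms H n (a + b) ≤ columnNorms H n a + columnNorms H n b := by
  refine columnNorms_le _ (add_nonneg (columnNorms_nonneg _ _) (columnNorms_nonneg _ _)) fun α => ?_
  have hS : 0 ≤ ∑ j, ‖α j‖ ^ 2 := Finset.sum_nonneg fun _ _ => by positivity
  have key : colSq (a + b) α ≤ (√(colSq a α) + √(colSq b α)) ^ 2 := by
    have h1 : ∀ l, ‖∑ j, α j • (a + b) l j‖ ^ 2 ≤ ‖∑ j, α j • a l j‖ ^ 2 + ‖∑ j, α j • b l j‖ ^ 2
        + 2 * (‖∑ j, α j • a l j‖ * ‖∑ j, α j • b l j‖) := by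
      intro l
      have : ‖∑ j, α j • (a + b) l j‖ ≤ ‖∑ j, α j • a l j‖ + ‖∑ j, α j • b l j‖ := by
        simp only [Matrix.add_apply, smul_add, Finset.sum_add_distrib]
        exact norm_add_le _ _
      calc _ ≤ (‖∑ j, α j • a l j‖ + ‖∑ j, α j • b l j‖) ^ 2 := by gcongr
        _ = _ := by ring
    have h2 := Finset.sum_le_sum fun l (_ : l ∈ Finset.univ) => h1 l
    rw [Finset.sum_add_distrib, Finset.sum_add_distrib, ← Finset.mul_sum] at h2
    have h3 := Real.sum_mul_le_sqrt_mul_sqrt Finset.univ (fun l => ‖∑ j, α j • a l j‖)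
      (fun l => ‖∑ j, α j • b l j‖)
    calc colSq (a + b) α ≤ _ := h2
      _ ≤ colSq a α + colSq b α + 2 * (√(colSq a α) * √(colSq b α)) := by
          have := h3
          simp only [colSq]
          linarith
      _ = _ := by
          rw [add_sq, Real.sq_sqrt (colSq_nonneg _ _), Real.sq_sqrt (colSq_nonneg _ _)]; ring
  refine key.trans ?_
  have hb : ∀ c : Matrix (Fin n) (Fin n) H,
      √(colSq c α) ≤ columnNorms H n c * √(∑ j, ‖α j‖ ^ 2) := by
    intro c
    rw [← Real.sqrt_sq (columnNorms_nonneg n c), ← Real.sqrt_mul (by positivity)]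
    exact Real.sqrt_le_sqrt (colSq_le_columnNorms c α)
  calc _ ≤ (columnNorms H n a * √(∑ j, ‖α j‖ ^ 2) + columnNorms H n b * √(∑ j, ‖α j‖ ^ 2)) ^ 2 := by
        gcongr <;> exact hb _
    _ = _ := by rw [← add_mul, mul_pow, Real.sq_sqrt hS]

lemma columnNorms_bimul_le {m n : ℕ} (a : Matrix (Fin m) (Fin n) ℂ) (x : Matrix (Fin n) (Fin n) H)
    (b : Matrix (Fin n) (Fin m) ℂ) :
    columnNorms H m (bimul a x b) ≤ ‖a‖ * columnNorms H n x * ‖b‖ := by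
  have h0 := columnNorms_nonneg n x
  refine columnNorms_le _ (by positivity) fun α => ?_
  have e : ∀ i, ∑ j, α j • bimul a x b i j = ∑ k, a i k • ∑ l, (∑ j, b l j * α j) • x k l := by
    intro i
    simp only [bimul, Finset.smul_sum, Finset.sum_smul, smul_smul]
    rw [Finset.sum_comm]
    refine Finset.sum_congr rfl fun k _ => ?_
    rw [Finset.sum_comm]
    refine Finset.sum_congr rfl fun l _ => Finset.sum_congr rfl fun j _ => ?_
    congr 1; ring
  calc colSq (bimul a x b) α = ∑ i, ‖∑ k, a i k • ∑ l, (∑ j, b l j * α j) • x k l‖ ^ 2 := by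
        simp only [colSq, e]
    _ ≤ ‖a‖ ^ 2 * colSq x (fun l => ∑ j, b l j * α j) := sum_norm_smul_sq_le a _
    _ ≤ ‖a‖ ^ 2 * (columnNorms H n x ^ 2 * (‖b‖ ^ 2 * ∑ j, ‖α j‖ ^ 2)) := by
        gcongr
        refine (colSq_le_columnNorms x _).trans ?_
        gcongr
        exact l2_norm_mulVec_sq_le b α
    _ = _ := by ring

lemma rowNorms_add_le (n : ℕ) (a b : Matrix (Fin n) (Fin n) H) :
    rowNorms H n (a + b) ≤ rowNorms H n a + rowNorms H n b := by
  simp only [rowNorms_eq, Matrix.transpose_add]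
  exact columnNorms_add_le _ _ _

lemma rowNorms_bimul_le {m n : ℕ} (a : Matrix (Fin m) (Fin n) ℂ) (x : Matrix (Fin n) (Fin n) H)
    (b : Matrix (Fin n) (Fin m) ℂ) :
    rowNorms H m (bimul a x b) ≤ ‖a‖ * rowNorms H n x * ‖b‖ := by
  have h0 := columnNorms_nonneg n x.transpose
  simp only [rowNorms_eq, bimul_transpose]
  refine (columnNorms_bimul_le _ _ _).trans ?_
  rw [mul_right_comm, mul_comm ‖b.transpose‖, mul_right_comm ‖a‖]
  gcongr <;> exact l2_norm_transpose_le _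

lemma columnNorms_blockDiag_le {m n : ℕ} (x : Matrix (Fin m) (Fin m) H)
    (y : Matrix (Fin n) (Fin n) H) :
    columnNorms H (m + n) (blockDiag x y) ≤ max (columnNorms H m x) (columnNorms H n y) := by
  refine columnNorms_le _ (le_max_of_le_left (columnNorms_nonneg _ _)) fun α => ?_
  have e : colSq (blockDiag x y) α
      = colSq x (fun j => α (Fin.castAdd n j)) + colSq y (fun j => α (Fin.natAdd m j)) := by
    simp [colSq, Fin.sum_univ_add, blockDiag]
  rw [e, Fin.sum_univ_add, mul_add]
  have h0 := columnNorms_nonneg m x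
  have h1 := columnNorms_nonneg n y
  refine add_le_add ((colSq_le_columnNorms _ _).trans ?_) ((colSq_le_columnNorms _ _).trans ?_)
  · gcongr; exact le_max_left _ _
  · gcongr; exact le_max_right _ _

lemma blockDiag_transpose {E : Type*} [AddCommGroup E] {m n : ℕ} (x : Matrix (Fin m) (Fin m) E)
    (y : Matrix (Fin n) (Fin n) E) :
    (blockDiag x y).transpose = blockDiag x.transpose y.transpose := by
  simp [blockDiag, Matrix.transpose_submatrix, Matrix.fromBlocks_transpose]

lemma rowNorms_blockDiag_le {m n : ℕ} (x : Matrix (Fin m) (Fin m) H)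
    (y : Matrix (Fin n) (Fin n) H) :
    rowNorms H (m + n) (blockDiag x y) ≤ max (rowNorms H m x) (rowNorms H n y) := by
  simp only [rowNorms_eq, blockDiag_transpose]
  exact columnNorms_blockDiag_le _ _

lemma columnNorms_map_le {H' : Type*} [NormedAddCommGroup H'] [InnerProductSpace ℂ H']
    (u : H →ₗ[ℂ] H') {B : ℝ} (hB : 0 ≤ B) (hu : ∀ x, ‖u x‖ ≤ B * ‖x‖) {n : ℕ}
    (x : Matrix (Fin n) (Fin n) H) :
    columnNorms H' n (x.map u) ≤ B * columnNorms H n x := by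
  have h0 := columnNorms_nonneg n x
  refine columnNorms_le _ (by positivity) fun α => ?_
  calc colSq (x.map u) α ≤ B ^ 2 * colSq x α := by
        rw [colSq, colSq, Finset.mul_sum]
        refine Finset.sum_le_sum fun l _ => ?_
        have : ∑ j, α j • (x.map u) l j = u (∑ j, α j • x l j) := by simp
        rw [this, ← mul_pow]
        gcongr
        exact hu _
    _ ≤ B ^ 2 * (columnNorms H n x ^ 2 * ∑ j, ‖α j‖ ^ 2) := by
        gcongr; exact colSq_le_columnNorms _ _
    _ = _ := by ring

lemma rowNorms_map_le {H' : Type*} [NormedAddCommGroup H'] [InnerProductSpace ℂ H']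
    (u : H →ₗ[ℂ] H') {B : ℝ} (hB : 0 ≤ B) (hu : ∀ x, ‖u x‖ ≤ B * ‖x‖) {n : ℕ}
    (x : Matrix (Fin n) (Fin n) H) :
    rowNorms H' n (x.map u) ≤ B * rowNorms H n x := by
  simp only [rowNorms_eq]
  exact columnNorms_map_le u hB hu x.transpose

lemma norm_entry_le_columnNorms {n : ℕ} (a : Matrix (Fin n) (Fin n) H) (i j : Fin n) :
    ‖a i j‖ ≤ columnNorms H n a := by
  classical
  have h := colSq_le_columnNorms a (fun k => if k = j then 1 else 0)
  simp only [colSq, ite_smul, one_smul, zero_smul, Finset.sum_ite_eq', Finset.mem_univ, if_true,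
    apply_ite norm, norm_one, norm_zero, ite_pow, one_pow, ne_eq, OfNat.ofNat_ne_zero,
    not_false_eq_true, zero_pow, mul_one] at h
  refine le_of_sq_le_sq ((Finset.single_le_sum (f := fun l => ‖a l j‖ ^ 2)
    (fun _ _ => by positivity) (Finset.mem_univ i)).trans h) (columnNorms_nonneg _ _)

lemma norm_entry_le_rowNorms {n : ℕ} (a : Matrix (Fin n) (Fin n) H) (i j : Fin n) :
    ‖a i j‖ ≤ rowNorms H n a := by
  rw [rowNorms_eq]; exact norm_entry_le_columnNorms a.transpose j i

lemma columnNorms_one (a : Matrix (Fin 1) (Fin 1) H) : columnNorms H 1 a = ‖a 0 0‖ := by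
  refine le_antisymm (columnNorms_le _ (norm_nonneg _) fun α => ?_)
    (norm_entry_le_columnNorms _ _ _)
  simp [colSq, norm_smul, mul_pow, mul_comm]

lemma rowNorms_one (a : Matrix (Fin 1) (Fin 1) H) : rowNorms H 1 a = ‖a 0 0‖ := by
  rw [rowNorms_eq, columnNorms_one]; rfl

end

/-! ### Multiplication of vector-valued matrices by scalar matrices -/

section Bimul

variable {E : Type*} [AddCommGroup E] [Module ℂ E]

lemma bimul_bimul {l m n : ℕ} (a : Matrix (Fin l) (Fin m) ℂ) (b : Matrix (Fin m) (Fin n) ℂ)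
    (x : Matrix (Fin n) (Fin n) E) (c : Matrix (Fin n) (Fin m) ℂ) (d : Matrix (Fin m) (Fin l) ℂ) :
    bimul a (bimul b x c) d = bimul (a * b) x (c * d) := by
  ext i j
  simp only [bimul, Matrix.mul_apply, Finset.smul_sum, Finset.sum_mul, Finset.mul_sum,
    Finset.sum_smul, smul_smul]
  calc ∑ p, ∑ q, ∑ k, ∑ r, (a i p * d q j * (b p k * c r q)) • x k r
      = ∑ p, ∑ k, ∑ r, ∑ q, (a i p * d q j * (b p k * c r q)) • x k r := by
        refine Finset.sum_congr rfl fun p _ => ?_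
        rw [Finset.sum_comm]
        exact Finset.sum_congr rfl fun k _ => Finset.sum_comm
    _ = ∑ k, ∑ r, ∑ p, ∑ q, (a i p * d q j * (b p k * c r q)) • x k r := by
        rw [Finset.sum_comm]
        exact Finset.sum_congr rfl fun k _ => Finset.sum_comm
    _ = _ := by
        refine Finset.sum_congr rfl fun k _ => Finset.sum_congr rfl fun r _ => ?_
        rw [Finset.sum_comm]
        refine Finset.sum_congr rfl fun p _ => Finset.sum_congr rfl fun q _ => ?_
        congr 1; ring

lemma bimul_one {n : ℕ} (x : Matrix (Fin n) (Fin n) E) : bimul 1 x 1 = x := by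
  ext i j
  simp [bimul, Matrix.one_apply]

lemma bimul_one_left {n : ℕ} (x : Matrix (Fin n) (Fin n) E) (b : Matrix (Fin n) (Fin n) ℂ)
    (i j : Fin n) : bimul 1 x b i j = ∑ l, b l j • x i l := by
  simp [bimul, Matrix.one_apply]

lemma bimul_one_right {n : ℕ} (a : Matrix (Fin n) (Fin n) ℂ) (x : Matrix (Fin n) (Fin n) E)
    (i j : Fin n) : bimul a x 1 i j = ∑ k, a i k • x k j := by
  simp [bimul, Matrix.one_apply]

lemma bimul_map {E' : Type*} [AddCommGroup E'] [Module ℂ E'] (u : E →ₗ[ℂ] E') {m n : ℕ}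
    (a : Matrix (Fin m) (Fin n) ℂ) (x : Matrix (Fin n) (Fin n) E) (b : Matrix (Fin n) (Fin m) ℂ) :
    bimul a (x.map u) b = (bimul a x b).map u := by
  ext i j
  simp [bimul, map_sum]

end Bimul

/-! ### Positive functionals and the weights dual to the matrix norm -/

/-- A positive functional on matrices is diagonal in some orthonormal basis. -/
lemma exists_diagonalization {n : ℕ} (g : Matrix (Fin n) (Fin n) ℂ →ₗ[ℝ] ℝ)
    (hg : ∀ p : Matrix (Fin n) (Fin n) ℂ,
      (∀ α : Fin n → ℂ, 0 ≤ (∑ i, star (α i) * ∑ j, p i j * α j).re) → 0 ≤ g p) :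
    ∃ U ∈ Matrix.unitaryGroup (Fin n) ℂ, ∃ d : Fin n → ℝ, (∀ j, 0 ≤ d j) ∧
      ∀ p : Matrix (Fin n) (Fin n) ℂ, p.IsHermitian →
        g p = ∑ j, d j * (∑ i, star (U i j) * ∑ k, p i k * U k j).re := by
  classical
  -- Represents the real linear functional as p ↦ Re tr(φ p); each entry z is split into real and
  -- imaginary part.
  let φ : Matrix (Fin n) (Fin n) ℂ := Matrix.of fun i j =>
    (g (Matrix.single j i 1) : ℂ) - Complex.I * g (Matrix.single j i Complex.I)
  have h1 : ∀ p, g p = (φ * p).trace.re := by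
    intro p
    have hz : ∀ (i j : Fin n) (z : ℂ), g (Matrix.single j i z) = (φ i j * z).re := by
      intro i j z
      have : Matrix.single j i z = z.re • Matrix.single j i (1 : ℂ)
          + z.im • Matrix.single j i Complex.I := by
        rw [Matrix.smul_single, Matrix.smul_single, ← Matrix.single_add]
        congr 1
        apply Complex.ext <;> simp
      rw [this, map_add, map_smul, map_smul]
      simp [φ]
      ring
    conv_lhs => rw [Matrix.matrix_eq_sum_single p]
    simp only [map_sum, hz, Matrix.trace, Matrix.diag, Matrix.mul_apply, Complex.re_sum]
    rw [Finset.sum_comm]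
  -- Hermitian matrices only see the Hermitian part of φ, to which the spectral theorem applies.
  let h : Matrix (Fin n) (Fin n) ℂ := (1 / 2 : ℂ) • (φ + φ.conjTranspose)
  have hH : h.IsHermitian := by
    ext i j
    simp [h, Matrix.conjTranspose_apply, add_comm]
  have h2 : ∀ p : Matrix (Fin n) (Fin n) ℂ, p.IsHermitian → g p = (h * p).trace.re := by
    intro p hp
    have e : (φ.conjTranspose * p).trace.re = (φ * p).trace.re := by
      have : φ.conjTranspose * p = (p * φ).conjTranspose := by
        rw [Matrix.conjTranspose_mul, hp.eq]
      rw [this, Matrix.trace_conjTranspose, Matrix.trace_mul_comm]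
      simp
    simp only [h, Matrix.smul_mul, Matrix.add_mul, Matrix.trace_smul, Matrix.trace_add, smul_eq_mul]
    rw [h1 p]
    have : ((1 / 2 : ℂ) * ((φ * p).trace + (φ.conjTranspose * p).trace)).re
        = (1 / 2) * ((φ * p).trace.re + (φ.conjTranspose * p).trace.re) := by
      simp [Complex.mul_re]
    rw [this, e]; ring
  let U : Matrix (Fin n) (Fin n) ℂ := hH.eigenvectorUnitary
  have hU : U ∈ Matrix.unitaryGroup (Fin n) ℂ := hH.eigenvectorUnitary.2
  have hs : h = U * Matrix.diagonal (fun j => (hH.eigenvalues j : ℂ)) * star U := by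
    have := hH.spectral_theorem
    rw [Unitary.conjStarAlgAut_apply] at this
    exact this
  have key : ∀ p : Matrix (Fin n) (Fin n) ℂ, p.IsHermitian →
        g p = ∑ j, hH.eigenvalues j * (∑ i, star (U i j) * ∑ k, p i k * U k j).re := by
    intro p hp
    rw [h2 p hp]
    conv_lhs => rw [hs]
    rw [Matrix.mul_assoc, Matrix.mul_assoc, Matrix.trace_mul_comm, Matrix.mul_assoc]
    simp only [Matrix.trace, Matrix.diag, Matrix.diagonal_mul, Complex.re_sum, Complex.re_ofReal_mul]
    refine Finset.sum_congr rfl fun j _ => ?_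
    rw [Matrix.mul_assoc, Matrix.mul_apply]
    simp [Matrix.mul_apply, Matrix.star_apply]
  refine ⟨U, hU, hH.eigenvalues, fun j => ?_, key⟩
  -- The value of g at the rank one projection onto the j-th eigenvector is the j-th eigenvalue,
  -- which is therefore nonnegative.
  have hp : (Matrix.of fun i k => U i j * star (U k j) : Matrix (Fin n) (Fin n) ℂ).IsHermitian := by
    ext i k; simp [Matrix.conjTranspose_apply, mul_comm]
  have form : ∀ α : Fin n → ℂ, ∑ i, star (α i) * ∑ k,
      (Matrix.of fun i k => U i j * star (U k j) : Matrix (Fin n) (Fin n) ℂ) i k * α k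
      = (Complex.normSq (∑ i, star (U i j) * α i) : ℂ) := by
    intro α
    rw [Complex.normSq_eq_conj_mul_self, map_sum, Finset.sum_mul]
    refine Finset.sum_congr rfl fun i _ => ?_
    simp only [Matrix.of_apply, Finset.mul_sum, map_mul, RCLike.star_def, RCLike.conj_conj]
    refine Finset.sum_congr rfl fun k _ => ?_
    ring
  have h3 := hg _ fun α => by
    rw [form α, Complex.ofReal_re]; exact Complex.normSq_nonneg _
  rw [key _ hp] at h3
  simp only [form, Complex.ofReal_re] at h3
  have hort : ∀ m, ∑ i, star (U i j) * U i m = if j = m then 1 else 0 := by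
    intro m
    have := congrFun (congrFun (Matrix.mem_unitaryGroup_iff'.1 hU) j) m
    simpa [Matrix.mul_apply, Matrix.star_apply, Matrix.one_apply] using this
  simp only [hort, apply_ite Complex.normSq] at h3
  simpa using h3

/-- Unitary matrices and strictly positive diagonal subprobabilities. -/
structure Adm {n : ℕ} (W U : Matrix (Fin n) (Fin n) ℂ) (φ ψ : Fin n → ℝ) : Prop where
  left_mem : W ∈ Matrix.unitaryGroup (Fin n) ℂ
  right_mem : U ∈ Matrix.unitaryGroup (Fin n) ℂ
  pos_c : ∀ j, 0 < φ j
  pos_r : ∀ i, 0 < ψ i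
  sum_le : ∑ j, φ j + ∑ i, ψ i ≤ 1

lemma Adm.le_one_c {n : ℕ} {W U : Matrix (Fin n) (Fin n) ℂ} {φ ψ : Fin n → ℝ}
    (h : Adm W U φ ψ) (j : Fin n) : φ j ≤ 1 := by
  have h1 := Finset.single_le_sum (f := φ) (fun i _ => (h.pos_c i).le) (Finset.mem_univ j)
  have h2 := Finset.sum_nonneg fun i (_ : i ∈ Finset.univ) => (h.pos_r i).le
  linarith [h.sum_le]

lemma Adm.le_one_r {n : ℕ} {W U : Matrix (Fin n) (Fin n) ℂ} {φ ψ : Fin n → ℝ}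
    (h : Adm W U φ ψ) (j : Fin n) : ψ j ≤ 1 := by
  have h1 := Finset.single_le_sum (f := ψ) (fun i _ => (h.pos_r i).le) (Finset.mem_univ j)
  have h2 := Finset.sum_nonneg fun i (_ : i ∈ Finset.univ) => (h.pos_c i).le
  linarith [h.sum_le]

/-! ### Quotient norms defined by a relation, and their minimax description -/

section Rel

variable {H₁ H₂ X : Type*} [NormedAddCommGroup H₁] [InnerProductSpace ℂ H₁]
  [NormedAddCommGroup H₂] [InnerProductSpace ℂ H₂] [AddCommGroup X] [Module ℂ X]

/-- The matrix norms on `X` for which the norm of `x` is the infimum of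
`max (‖a‖_c) (‖b‖_r)` over all `a`, `b` which are entrywise related to `x` by `L`. -/
def relNorm (L : Submodule ℂ ((H₁ × H₂) × X)) : MatrixNorms X := fun n x =>
  sInf {t : ℝ | ∃ (a : Matrix (Fin n) (Fin n) H₁) (b : Matrix (Fin n) (Fin n) H₂),
    (∀ i j, ((a i j, b i j), x i j) ∈ L) ∧ t = max (columnNorms H₁ n a) (rowNorms H₂ n b)}

/-- The quadratic form `inf (s ‖a‖² + t ‖b‖²)` over all `(a, b)` related to `x`. -/
def relForm (L : Submodule ℂ ((H₁ × H₂) × X)) (s t : ℝ) (x : X) : ℝ :=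
  sInf {r : ℝ | ∃ a b, ((a, b), x) ∈ L ∧ r = s * ‖a‖ ^ 2 + t * ‖b‖ ^ 2}

variable {L : Submodule ℂ ((H₁ × H₂) × X)}

lemma relNorm_nonneg (n : ℕ) (x : Matrix (Fin n) (Fin n) X) : 0 ≤ relNorm L n x := by
  refine Real.sInf_nonneg ?_
  rintro t ⟨a, b, -, rfl⟩
  exact le_max_of_le_left (columnNorms_nonneg _ _)

lemma relNorm_le {n : ℕ} {x : Matrix (Fin n) (Fin n) X} {a : Matrix (Fin n) (Fin n) H₁}
    {b : Matrix (Fin n) (Fin n) H₂} (h : ∀ i j, ((a i j, b i j), x i j) ∈ L) :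
    relNorm L n x ≤ max (columnNorms H₁ n a) (rowNorms H₂ n b) := by
  refine csInf_le ⟨0, ?_⟩ ⟨a, b, h, rfl⟩
  rintro t ⟨a, b, -, rfl⟩
  exact le_max_of_le_left (columnNorms_nonneg _ _)

lemma exists_lift (hL : ∀ x, ∃ p, (p, x) ∈ L) {n : ℕ} (x : Matrix (Fin n) (Fin n) X) :
    ∃ (a : Matrix (Fin n) (Fin n) H₁) (b : Matrix (Fin n) (Fin n) H₂),
      ∀ i j, ((a i j, b i j), x i j) ∈ L := by
  choose p hp using hL
  exact ⟨fun i j => (p (x i j)).1, fun i j => (p (x i j)).2, fun i j => hp _⟩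

lemma exists_lift_of_relNorm_lt (hL : ∀ x, ∃ p, (p, x) ∈ L) {n : ℕ}
    {x : Matrix (Fin n) (Fin n) X} {r : ℝ} (hr : relNorm L n x < r) :
    ∃ (a : Matrix (Fin n) (Fin n) H₁) (b : Matrix (Fin n) (Fin n) H₂),
      (∀ i j, ((a i j, b i j), x i j) ∈ L) ∧ columnNorms H₁ n a < r ∧ rowNorms H₂ n b < r := by
  obtain ⟨a₀, b₀, h₀⟩ := exists_lift hL x
  obtain ⟨t, ⟨a, b, h, rfl⟩, ht⟩ := exists_lt_of_csInf_lt (by exact ⟨_, a₀, b₀, h₀, rfl⟩) hr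
  exact ⟨a, b, h, max_lt_iff.1 ht⟩

lemma relForm_nonneg {s t : ℝ} (hs : 0 ≤ s) (ht : 0 ≤ t) (x : X) : 0 ≤ relForm L s t x := by
  refine Real.sInf_nonneg ?_
  rintro r ⟨a, b, -, rfl⟩
  positivity

lemma relForm_le {s t : ℝ} (hs : 0 ≤ s) (ht : 0 ≤ t) {x : X} {a : H₁} {b : H₂}
    (h : ((a, b), x) ∈ L) : relForm L s t x ≤ s * ‖a‖ ^ 2 + t * ‖b‖ ^ 2 := by
  refine csInf_le ⟨0, ?_⟩ ⟨a, b, h, rfl⟩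
  rintro r ⟨a, b, -, rfl⟩
  positivity

lemma exists_relForm_lt (hL : ∀ x, ∃ p, (p, x) ∈ L) {s t : ℝ} {x : X} {r : ℝ}
    (hr : relForm L s t x < r) :
    ∃ a b, ((a, b), x) ∈ L ∧ s * ‖a‖ ^ 2 + t * ‖b‖ ^ 2 < r := by
  obtain ⟨⟨a₀, b₀⟩, h₀⟩ := hL x
  obtain ⟨_, ⟨a, b, h, rfl⟩, ht⟩ := exists_lt_of_csInf_lt (by exact ⟨_, a₀, b₀, h₀, rfl⟩) hr
  exact ⟨a, b, h, ht⟩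

lemma le_relForm (hL : ∀ x, ∃ p, (p, x) ∈ L) {s t : ℝ} {x : X} {r : ℝ}
    (h : ∀ a b, ((a, b), x) ∈ L → r ≤ s * ‖a‖ ^ 2 + t * ‖b‖ ^ 2) : r ≤ relForm L s t x := by
  obtain ⟨⟨a₀, b₀⟩, h₀⟩ := hL x
  refine le_csInf ⟨_, a₀, b₀, h₀, rfl⟩ ?_
  rintro _ ⟨a, b, hab, rfl⟩
  exact h a b hab

lemma bimul_lift {m n : ℕ} {x : Matrix (Fin n) (Fin n) X} {a : Matrix (Fin n) (Fin n) H₁}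
    {b : Matrix (Fin n) (Fin n) H₂} (h : ∀ i j, ((a i j, b i j), x i j) ∈ L)
    (A : Matrix (Fin m) (Fin n) ℂ) (B : Matrix (Fin n) (Fin m) ℂ) (i j : Fin m) :
    ((bimul A a B i j, bimul A b B i j), bimul A x B i j) ∈ L := by
  have : ((bimul A a B i j, bimul A b B i j), bimul A x B i j)
      = ∑ k, ∑ l, (A i k * B l j) • ((a k l, b k l), x k l) := by
    refine Prod.ext (Prod.ext ?_ ?_) ?_ <;> simp [bimul, Prod.fst_sum, Prod.snd_sum]
  rw [this]
  exact Submodule.sum_mem _ fun k _ => Submodule.sum_mem _ fun l _ => L.smul_mem _ (h k l)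

/-- Unitaries do not increase the column norm, and the j-th column is tested by evaluating the Gram
form at the j-th basis vector. -/
lemma sum_col_sq_le {n : ℕ} (a : Matrix (Fin n) (Fin n) H₁) {W U : Matrix (Fin n) (Fin n) ℂ}
    (hW : W ∈ Matrix.unitaryGroup (Fin n) ℂ) (hU : U ∈ Matrix.unitaryGroup (Fin n) ℂ) (j : Fin n) :
    ∑ i, ‖bimul W a U i j‖ ^ 2 ≤ columnNorms H₁ n a ^ 2 := by
  classical
  have h := colSq_le_columnNorms (bimul W a U) (fun k => if k = j then 1 else 0)
  simp only [colSq, ite_smul, one_smul, zero_smul, Finset.sum_ite_eq', Finset.mem_univ, if_true,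
    apply_ite norm, norm_one, norm_zero, ite_pow, one_pow, ne_eq, OfNat.ofNat_ne_zero,
    not_false_eq_true, zero_pow, mul_one] at h
  refine h.trans ?_
  have h0 := columnNorms_nonneg n a
  have h2 : columnNorms H₁ n (bimul W a U) ≤ columnNorms H₁ n a := by
    refine (columnNorms_bimul_le _ _ _).trans ?_
    have hW' := norm_le_one_of_mem_unitary hW
    have hU' := norm_le_one_of_mem_unitary hU
    calc ‖W‖ * columnNorms H₁ n a * ‖U‖ ≤ 1 * columnNorms H₁ n a * 1 := by gcongr
      _ = _ := by ring
  exact pow_le_pow_left₀ (columnNorms_nonneg _ _) h2 2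

lemma transpose_mem_unitary {n : ℕ} {W : Matrix (Fin n) (Fin n) ℂ}
    (hW : W ∈ Matrix.unitaryGroup (Fin n) ℂ) : W.transpose ∈ Matrix.unitaryGroup (Fin n) ℂ := by
  rw [Matrix.mem_unitaryGroup_iff']
  have h := congrArg Matrix.transpose (Matrix.mem_unitaryGroup_iff.1 hW)
  rw [Matrix.transpose_mul, Matrix.transpose_one] at h
  rw [← h]
  rfl

lemma sum_row_sq_le {n : ℕ} (a : Matrix (Fin n) (Fin n) H₁) {W U : Matrix (Fin n) (Fin n) ℂ}
    (hW : W ∈ Matrix.unitaryGroup (Fin n) ℂ) (hU : U ∈ Matrix.unitaryGroup (Fin n) ℂ) (i : Fin n) :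
    ∑ j, ‖bimul W a U i j‖ ^ 2 ≤ rowNorms H₁ n a ^ 2 := by
  rw [rowNorms_eq]
  refine le_trans (le_of_eq ?_)
    (sum_col_sq_le a.transpose (transpose_mem_unitary hU) (transpose_mem_unitary hW) i)
  rw [← bimul_transpose]; rfl

/-- The matrix norm dominates all the diagonal quadratic forms. -/
lemma sum_relForm_le (hL : ∀ x, ∃ p, (p, x) ∈ L) {n : ℕ} (x : Matrix (Fin n) (Fin n) X)
    {W U : Matrix (Fin n) (Fin n) ℂ} {φ ψ : Fin n → ℝ} (h : Adm W U φ ψ) :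
    ∑ i, ∑ j, relForm L (φ j) (ψ i) (bimul W x U i j) ≤ relNorm L n x ^ 2 := by
  have key : ∀ r, relNorm L n x < r →
      ∑ i, ∑ j, relForm L (φ j) (ψ i) (bimul W x U i j) ≤ r ^ 2 := by
    intro r hr
    obtain ⟨a, b, hab, ha, hb⟩ := exists_lift_of_relNorm_lt hL hr
    have ha' : columnNorms H₁ n a ^ 2 ≤ r ^ 2 := pow_le_pow_left₀ (columnNorms_nonneg _ _) ha.le 2
    have hb' : rowNorms H₂ n b ^ 2 ≤ r ^ 2 := pow_le_pow_left₀ (rowNorms_nonneg _ _) hb.le 2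
    calc ∑ i, ∑ j, relForm L (φ j) (ψ i) (bimul W x U i j)
        ≤ ∑ i, ∑ j, (φ j * ‖bimul W a U i j‖ ^ 2 + ψ i * ‖bimul W b U i j‖ ^ 2) :=
          Finset.sum_le_sum fun i _ => Finset.sum_le_sum fun j _ =>
            relForm_le (h.pos_c j).le (h.pos_r i).le (bimul_lift hab W U i j)
      _ = ∑ j, φ j * ∑ i, ‖bimul W a U i j‖ ^ 2 + ∑ i, ψ i * ∑ j, ‖bimul W b U i j‖ ^ 2 := by
          simp only [Finset.sum_add_distrib, Finset.mul_sum]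
          rw [Finset.sum_comm]
      _ ≤ ∑ j, φ j * r ^ 2 + ∑ i, ψ i * r ^ 2 := by
          gcongr with j _ i _
          · exact (h.pos_c j).le
          · exact (sum_col_sq_le a h.left_mem h.right_mem j).trans ha'
          · exact (h.pos_r i).le
          · exact (sum_row_sq_le b h.left_mem h.right_mem i).trans hb'
      _ = (∑ j, φ j + ∑ i, ψ i) * r ^ 2 := by rw [← Finset.sum_mul, ← Finset.sum_mul, add_mul]
      _ ≤ 1 * r ^ 2 := by gcongr; exact h.sum_le
      _ = r ^ 2 := one_mul _
  -- The infimum defining the norm need not be attained, so the bound is obtained for all larger r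
  -- and passed to the limit.
  have hc : Filter.Tendsto (fun r : ℝ => r ^ 2) (nhdsWithin (relNorm L n x) (Set.Ioi (relNorm L n x)))
      (nhds (relNorm L n x ^ 2)) :=
    ((continuous_pow 2).tendsto _).mono_left nhdsWithin_le_nhds
  exact ge_of_tendsto hc (Filter.eventually_of_mem self_mem_nhdsWithin key)

lemma gram_isHermitian {n : ℕ} (a : Matrix (Fin n) (Fin n) H₁) : (gram a).IsHermitian := by
  ext i j
  simp [gram, Matrix.conjTranspose_apply]

/-- Evaluation at the j-th column of `U` undoes the multiplication by `star U`, and `star W` is a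
contraction. This returns the diagonalised functional to ordinary columns. -/
lemma colSq_col_bimul_le {n : ℕ} (c : Matrix (Fin n) (Fin n) H₁) {W U : Matrix (Fin n) (Fin n) ℂ}
    (hW : W ∈ Matrix.unitaryGroup (Fin n) ℂ) (hU : U ∈ Matrix.unitaryGroup (Fin n) ℂ) (j : Fin n) :
    colSq (bimul (star W) c (star U)) (fun k => U k j) ≤ ∑ l, ‖c l j‖ ^ 2 := by
  have e : ∀ l, ∑ k, U k j • bimul (star W) c (star U) l k = ∑ k, (star W) l k • c k j := by
    intro l
    rw [← bimul_one_left, bimul_bimul, Matrix.one_mul, Matrix.mem_unitaryGroup_iff'.1 hU,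
      bimul_one_right]
  simp only [colSq, e]
  refine (sum_norm_smul_sq_le _ _).trans ?_
  have hn : ‖star W‖ ≤ 1 := norm_le_one_of_mem_unitary (Unitary.star_mem hW)
  calc _ ≤ 1 ^ 2 * ∑ l, ‖c l j‖ ^ 2 := by gcongr
    _ = _ := by ring

/-- The Gram form is convex. -/
lemma colSq_convex {n : ℕ} (a a' : Matrix (Fin n) (Fin n) H₁) (α : Fin n → ℂ) {s t : ℝ}
    (hs : 0 ≤ s) (ht : 0 ≤ t) (hst : s + t = 1) :
    colSq ((s : ℂ) • a + (t : ℂ) • a') α ≤ s * colSq a α + t * colSq a' α := by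
  simp only [colSq, Finset.mul_sum]
  rw [← Finset.sum_add_distrib]
  refine Finset.sum_le_sum fun l _ => ?_
  have e : ∑ j, α j • ((s : ℂ) • a + (t : ℂ) • a') l j
      = (s : ℂ) • (∑ j, α j • a l j) + (t : ℂ) • ∑ j, α j • a' l j := by
    simp only [Matrix.add_apply, Matrix.smul_apply, smul_add, Finset.sum_add_distrib,
      Finset.smul_sum]
    congr 1 <;> exact Finset.sum_congr rfl fun j _ => smul_comm _ _ _
  rw [e]
  have h1 : ‖(s : ℂ) • (∑ j, α j • a l j) + (t : ℂ) • ∑ j, α j • a' l j‖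
      ≤ s * ‖∑ j, α j • a l j‖ + t * ‖∑ j, α j • a' l j‖ := by
    refine (norm_add_le _ _).trans ?_
    rw [norm_smul, norm_smul, Complex.norm_real, Complex.norm_real, Real.norm_of_nonneg hs,
      Real.norm_of_nonneg ht]
  refine (pow_le_pow_left₀ (norm_nonneg _) h1 2).trans ?_
  obtain rfl : t = 1 - s := by linarith
  nlinarith [mul_nonneg hs ht, sq_nonneg (‖∑ j, α j • a l j‖ - ‖∑ j, α j • a' l j‖),
    mul_nonneg (mul_nonneg hs ht) (sq_nonneg (‖∑ j, α j • a l j‖ - ‖∑ j, α j • a' l j‖))]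

lemma gram_form_re {n : ℕ} (a : Matrix (Fin n) (Fin n) H₁) (α : Fin n → ℂ) :
    (∑ i, star (α i) * ∑ j, gram a i j * α j).re = colSq a α := by
  rw [gram_form_self, Complex.ofReal_re]

lemma columnNorms_le_of_form {n : ℕ} {P : Matrix (Fin n) (Fin n) ℂ}
    {a : Matrix (Fin n) (Fin n) H₁}
    (h : ∀ α : Fin n → ℂ, colSq a α ≤ (∑ i, star (α i) * ∑ j, P i j * α j).re) :
    columnNorms H₁ n a ≤ √‖P‖ := by
  refine columnNorms_le _ (Real.sqrt_nonneg _) fun α => ?_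
  rw [Real.sq_sqrt (norm_nonneg _)]
  exact (h α).trans ((Complex.re_le_norm _).trans (norm_form_le P α))

/-- The set of pairs of matrices dominating the Gram matrices of a lift of `x`. -/
def gramUpper (L : Submodule ℂ ((H₁ × H₂) × X)) {n : ℕ} (x : Matrix (Fin n) (Fin n) X) :
    Set (Matrix (Fin n) (Fin n) ℂ × Matrix (Fin n) (Fin n) ℂ) :=
  {p | ∃ (a : Matrix (Fin n) (Fin n) H₁) (b : Matrix (Fin n) (Fin n) H₂),
    (∀ i j, ((a i j, b i j), x i j) ∈ L) ∧
    (∀ α : Fin n → ℂ, colSq a α ≤ (∑ i, star (α i) * ∑ j, p.1 i j * α j).re) ∧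
    (∀ α : Fin n → ℂ, colSq b.transpose α ≤ (∑ i, star (α i) * ∑ j, p.2 i j * α j).re)}

lemma form_comb_re {n : ℕ} (p p' : Matrix (Fin n) (Fin n) ℂ) (s t : ℝ) (α : Fin n → ℂ) :
    (∑ i, star (α i) * ∑ j, (s • p + t • p') i j * α j).re
      = s * (∑ i, star (α i) * ∑ j, p i j * α j).re
        + t * (∑ i, star (α i) * ∑ j, p' i j * α j).re := by
  have : ∑ i, star (α i) * ∑ j, (s • p + t • p') i j * α j
      = (s : ℂ) * (∑ i, star (α i) * ∑ j, p i j * α j)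
        + (t : ℂ) * (∑ i, star (α i) * ∑ j, p' i j * α j) := by
    simp only [Finset.mul_sum, ← Finset.sum_add_distrib]
    refine Finset.sum_congr rfl fun i _ => Finset.sum_congr rfl fun j _ => ?_
    simp only [Matrix.add_apply, Matrix.smul_apply, Complex.real_smul]
    ring
  rw [this, Complex.add_re, Complex.re_ofReal_mul, Complex.re_ofReal_mul]

lemma convex_gramUpper {n : ℕ} (x : Matrix (Fin n) (Fin n) X) : Convex ℝ (gramUpper L x) := by
  rintro ⟨p, q⟩ ⟨a, b, hab, ha, hb⟩ ⟨p', q'⟩ ⟨a', b', hab', ha', hb'⟩ s t hs ht hst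
  refine ⟨(s : ℂ) • a + (t : ℂ) • a', (s : ℂ) • b + (t : ℂ) • b', fun i j => ?_, fun α => ?_,
    fun α => ?_⟩
  · have h : (((s : ℂ) • a i j + (t : ℂ) • a' i j, (s : ℂ) • b i j + (t : ℂ) • b' i j),
        (s : ℂ) • x i j + (t : ℂ) • x i j) ∈ L :=
      L.add_mem (L.smul_mem (s : ℂ) (hab i j)) (L.smul_mem (t : ℂ) (hab' i j))
    have e : (s : ℂ) • x i j + (t : ℂ) • x i j = x i j := by
      rw [← add_smul, ← Complex.ofReal_add, hst, Complex.ofReal_one, one_smul]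
    rw [e] at h
    exact h
  · change _ ≤ (∑ i, star (α i) * ∑ j, (s • p + t • p') i j * α j).re
    rw [form_comb_re]
    refine (colSq_convex a a' α hs ht hst).trans ?_
    exact add_le_add (mul_le_mul_of_nonneg_left (ha α) hs) (mul_le_mul_of_nonneg_left (ha' α) ht)
  · change _ ≤ (∑ i, star (α i) * ∑ j, (s • q + t • q') i j * α j).re
    rw [form_comb_re]
    refine (colSq_convex b.transpose b'.transpose α hs ht hst).trans ?_
    exact add_le_add (mul_le_mul_of_nonneg_left (hb α) hs) (mul_le_mul_of_nonneg_left (hb' α) ht)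

/-- Used for the positivity of the separating functionals: `gramUpper` is stable under adding
positive matrices, and a functional bounded below along a ray is nonnegative in its direction. -/
lemma nonneg_of_ray {u c d : ℝ} (h : ∀ t : ℝ, 0 ≤ t → u ≤ c + t * d) : 0 ≤ d := by
  by_contra hd
  push Not at hd
  have h1 := h ((|c - u| + 1) / (-d)) (by have := abs_nonneg (c - u); apply div_nonneg <;> linarith)
  have h2 : (|c - u| + 1) / (-d) * d = -(|c - u| + 1) := by
    have := hd.ne
    field_simp
  rw [h2] at h1
  linarith [le_abs_self (c - u)]

/-- Minimax: if the norm of `x` is large, some diagonal quadratic form is large for all lifts. -/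
lemma exists_diag_of_lt_relNorm (hL : ∀ x, ∃ p, (p, x) ∈ L) {n : ℕ}
    (x : Matrix (Fin n) (Fin n) X) {c : ℝ} (hc0 : 0 < c) (hc : c < relNorm L n x ^ 2) :
    ∃ W ∈ Matrix.unitaryGroup (Fin n) ℂ, ∃ U ∈ Matrix.unitaryGroup (Fin n) ℂ,
      ∃ d e : Fin n → ℝ, (∀ j, 0 ≤ d j) ∧ (∀ i, 0 ≤ e i) ∧ 0 < ∑ j, d j + ∑ i, e i ∧
      ∀ (a : Matrix (Fin n) (Fin n) H₁) (b : Matrix (Fin n) (Fin n) H₂),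
        (∀ i j, ((a i j, b i j), bimul W x U i j) ∈ L) →
        c * (∑ j, d j + ∑ i, e i) ≤ ∑ i, ∑ j, (d j * ‖a i j‖ ^ 2 + e i * ‖b i j‖ ^ 2) := by
  classical
  set ρ := relNorm L n x ^ 2 with hρ
  let M := Matrix (Fin n) (Fin n) ℂ
  let B : Set (M × M) := {p | ‖p.1‖ < ρ ∧ ‖p.2‖ < ρ}
  have hBo : IsOpen B :=
    (isOpen_lt (continuous_norm.comp continuous_fst) continuous_const).inter
      (isOpen_lt (continuous_norm.comp continuous_snd) continuous_const)
  have hBc : Convex ℝ B := by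
    rintro ⟨p, q⟩ ⟨h1, h2⟩ ⟨p', q'⟩ ⟨h1', h2'⟩ s t hs ht hst
    have aux : ∀ P P' : M, ‖P‖ < ρ → ‖P'‖ < ρ → ‖s • P + t • P'‖ < ρ := by
      intro P P' hP hP'
      have := (convex_ball (0 : M) ρ) (by simpa using hP) (by simpa using hP') hs ht hst
      simpa using this
    exact ⟨aux _ _ h1 h1', aux _ _ h2 h2'⟩
  -- A common point would provide a lift with both norms below `relNorm L n x`.
  have hdisj : Disjoint B (gramUpper L x) := by
    rw [Set.disjoint_left]
    rintro ⟨p, q⟩ ⟨hp, hq⟩ ⟨a, b, hab, ha, hb⟩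
    have h1 : max (columnNorms H₁ n a) (rowNorms H₂ n b) ≤ max √‖p‖ √‖q‖ := by
      rw [rowNorms_eq]
      exact max_le_max (columnNorms_le_of_form ha) (columnNorms_le_of_form hb)
    have h2 : max √‖p‖ √‖q‖ < relNorm L n x := by
      have h0 := relNorm_nonneg (L := L) n x
      rw [← Real.sqrt_sq h0, ← hρ]
      exact max_lt (Real.sqrt_lt_sqrt (norm_nonneg _) hp) (Real.sqrt_lt_sqrt (norm_nonneg _) hq)
    exact absurd (relNorm_le hab) (not_le.2 (h1.trans_lt h2))
  obtain ⟨f, u, hfB, hfP⟩ := geometric_hahn_banach_open hBc hBo (convex_gramUpper x) hdisj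
  have hu : 0 < u := by
    have := hfB 0 ⟨by simpa using hc0.trans hc, by simpa using hc0.trans hc⟩
    simpa using this
  obtain ⟨a₀, b₀, h₀⟩ := exists_lift hL x
  let g₁ : M →ₗ[ℝ] ℝ := f.toLinearMap.comp (LinearMap.inl ℝ M M)
  let g₂ : M →ₗ[ℝ] ℝ := f.toLinearMap.comp (LinearMap.inr ℝ M M)
  have hf : ∀ p q, f (p, q) = g₁ p + g₂ q := by
    intro p q
    have : ((p, q) : M × M) = (p, 0) + (0, q) := by simp
    rw [this, map_add]; rfl
  have hg₁ : ∀ p : M, (∀ α : Fin n → ℂ, 0 ≤ (∑ i, star (α i) * ∑ j, p i j * α j).re) →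
      0 ≤ g₁ p := by
    intro p hp
    refine nonneg_of_ray (u := u) (c := g₁ (gram a₀) + g₂ (gram b₀.transpose)) fun t ht => ?_
    have hm : (gram a₀ + t • p, gram b₀.transpose) ∈ gramUpper L x := by
      refine ⟨a₀, b₀, h₀, fun α => ?_, fun α => (gram_form_re _ _).ge⟩
      have := form_comb_re (gram a₀) p 1 t α
      rw [one_smul, gram_form_re] at this
      rw [this]
      have := mul_nonneg ht (hp α)
      linarith
    have := hfP _ hm
    rw [hf, map_add, map_smul, smul_eq_mul] at this
    linarith
  have hg₂ : ∀ p : M, (∀ α : Fin n → ℂ, 0 ≤ (∑ i, star (α i) * ∑ j, p i j * α j).re) →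
      0 ≤ g₂ p := by
    intro p hp
    refine nonneg_of_ray (u := u) (c := g₁ (gram a₀) + g₂ (gram b₀.transpose)) fun t ht => ?_
    have hm : (gram a₀, gram b₀.transpose + t • p) ∈ gramUpper L x := by
      refine ⟨a₀, b₀, h₀, fun α => (gram_form_re _ _).ge, fun α => ?_⟩
      have := form_comb_re (gram b₀.transpose) p 1 t α
      rw [one_smul, gram_form_re] at this
      rw [this]
      have := mul_nonneg ht (hp α)
      linarith
    have := hfP _ hm
    rw [hf, map_add, map_smul, smul_eq_mul] at this
    linarith
  obtain ⟨U, hU, d, hd, hgU⟩ := exists_diagonalization g₁ hg₁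
  obtain ⟨V, hV, e, he, hgV⟩ := exists_diagonalization g₂ hg₂
  have hlift : ∀ (a : Matrix (Fin n) (Fin n) H₁) (b : Matrix (Fin n) (Fin n) H₂),
      (∀ i j, ((a i j, b i j), x i j) ∈ L) →
      u ≤ ∑ j, d j * colSq a (fun k => U k j) + ∑ i, e i * colSq b.transpose (fun k => V k i) := by
    intro a b hab
    have hm : (gram a, gram b.transpose) ∈ gramUpper L x :=
      ⟨a, b, hab, fun α => (gram_form_re _ _).ge, fun α => (gram_form_re _ _).ge⟩
    have := hfP _ hm
    rw [hf, hgU _ (gram_isHermitian _), hgV _ (gram_isHermitian _)] at this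
    simpa only [gram_form_re _ (fun k => U k _), gram_form_re _ (fun k => V k _)] using this
  have hone : ∀ {Q : M}, Q ∈ Matrix.unitaryGroup (Fin n) ℂ → ∀ j,
      (∑ i, star (Q i j) * ∑ k, (1 : Matrix (Fin n) (Fin n) ℂ) i k * Q k j).re = 1 := by
    intro Q hQ j
    have := congrFun (congrFun (Matrix.mem_unitaryGroup_iff'.1 hQ) j) j
    rw [Matrix.mul_apply, Matrix.one_apply_eq] at this
    simp only [Matrix.star_apply] at this
    have e1 : ∀ i, ∑ k, (1 : Matrix (Fin n) (Fin n) ℂ) i k * Q k j = Q i j := fun i => by simp [Matrix.one_apply]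
    simp only [e1, this, Complex.one_re]
  -- The pair (c·1, c·1) lies in `B` because c < ρ, and the functional takes there the value c times
  -- the total mass.
  have hcu : c * (∑ j, d j + ∑ i, e i) ≤ u := by
    have h1 : ‖(1 : M)‖ ≤ 1 := norm_le_one_of_mem_unitary (one_mem _)
    have h2 : ‖c • (1 : M)‖ < ρ := by
      rw [norm_smul, Real.norm_of_nonneg hc0.le]
      nlinarith
    have := hfB (c • 1, c • 1) ⟨h2, h2⟩
    rw [hf, map_smul, map_smul, hgU 1 Matrix.isHermitian_one, hgV 1 Matrix.isHermitian_one] at this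
    simp only [hone hU, hone hV, mul_one, smul_eq_mul] at this
    linarith
  -- The second functional acts on the Gram matrix of the transpose of b, hence the transpose of its
  -- diagonalising unitary.
  refine ⟨V.transpose, transpose_mem_unitary hV, U, hU, d, e, hd, he, ?_, fun a b hab => ?_⟩
  · have h1 := Finset.sum_nonneg fun j (_ : j ∈ Finset.univ) => hd j
    have h2 := Finset.sum_nonneg fun j (_ : j ∈ Finset.univ) => he j
    rcases h1.lt_or_eq with h1' | h1'
    · linarith
    rcases h2.lt_or_eq with h2' | h2'
    · linarith
    exfalso
    have hd0 := (Finset.sum_eq_zero_iff_of_nonneg fun j _ => hd j).1 h1'.symm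
    have he0 := (Finset.sum_eq_zero_iff_of_nonneg fun j _ => he j).1 h2'.symm
    have := hlift a₀ b₀ h₀
    rw [Finset.sum_eq_zero fun j hj => by rw [hd0 j hj, zero_mul],
      Finset.sum_eq_zero fun j hj => by rw [he0 j hj, zero_mul]] at this
    linarith
  · refine hcu.trans ?_
    have hVt := transpose_mem_unitary hV
    have hl := bimul_lift hab (star V.transpose) (star U)
    rw [bimul_bimul, Matrix.mem_unitaryGroup_iff'.1 hVt, Matrix.mem_unitaryGroup_iff.1 hU,
      bimul_one] at hl
    refine (hlift _ _ hl).trans ?_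
    have hb : ∀ i, colSq (bimul (star V.transpose) b (star U)).transpose (fun k => V k i)
        ≤ ∑ j, ‖b i j‖ ^ 2 := by
      intro i
      have := colSq_col_bimul_le b.transpose (transpose_mem_unitary hU) hV i
      rw [bimul_transpose]
      exact this
    calc ∑ j, d j * colSq (bimul (star V.transpose) a (star U)) (fun k => U k j)
          + ∑ i, e i * colSq (bimul (star V.transpose) b (star U)).transpose (fun k => V k i)
        ≤ ∑ j, d j * ∑ i, ‖a i j‖ ^ 2 + ∑ i, e i * ∑ j, ‖b i j‖ ^ 2 := by
          gcongr with j _ i _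
          · exact hd j
          · exact colSq_col_bimul_le a hVt hU j
          · exact he i
          · exact hb i
      _ = _ := by
          simp only [Finset.sum_add_distrib, Finset.mul_sum]
          rw [Finset.sum_comm]

/-- The diagonal quadratic forms determine the matrix norm up to a factor, even when only
well-spread weights are used. -/
lemma relNorm_sq_le (hL : ∀ x, ∃ p, (p, x) ∈ L) {n : ℕ} (x : Matrix (Fin n) (Fin n) X) {R : ℝ}
    (hR : 0 ≤ R)
    (h : ∀ W U φ ψ, Adm W U φ ψ → (∀ j, 1 / (4 * n) ≤ φ j) → (∀ j, 1 / (4 * n) ≤ ψ j) →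
      ∑ i, ∑ j, relForm L (φ j) (ψ i) (bimul W x U i j) ≤ R) :
    relNorm L n x ^ 2 ≤ 2 * R := by
  by_contra hlt
  push Not at hlt
  obtain ⟨c, hc1, hc2⟩ := exists_between hlt
  have hc0 : 0 < c := by linarith
  obtain ⟨W, hW, U, hU, d, e, hd, he, hτ, hlift⟩ := exists_diag_of_lt_relNorm hL x hc0 hc2
  set τ := ∑ j, d j + ∑ i, e i with hτd
  have hn : 0 < n := by
    rcases Nat.eq_zero_or_pos n with rfl | hn
    · simp at hτd; linarith
    · exact hn
  have hn' : (0 : ℝ) < n := by exact_mod_cast hn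
  -- Half of the mass is the normalised functional; the other half is spread uniformly over the 2n
  -- weights. This costs the factor 2 and keeps every weight above 1/(4n).
  let φ : Fin n → ℝ := fun j => d j / (2 * τ) + 1 / (4 * n)
  let ψ : Fin n → ℝ := fun j => e j / (2 * τ) + 1 / (4 * n)
  have hd' : ∀ j, 0 ≤ d j / (2 * τ) := fun j => div_nonneg (hd j) (by linarith)
  have he' : ∀ j, 0 ≤ e j / (2 * τ) := fun j => div_nonneg (he j) (by linarith)
  have hn4 : (0 : ℝ) < 1 / (4 * n) := by positivity
  have hadm : Adm W U φ ψ := by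
    refine ⟨hW, hU, fun j => add_pos_of_nonneg_of_pos (hd' j) hn4,
      fun j => add_pos_of_nonneg_of_pos (he' j) hn4, ?_⟩
    simp only [φ, ψ, Finset.sum_add_distrib, ← Finset.sum_div, Finset.sum_const, Finset.card_univ,
      Fintype.card_fin, nsmul_eq_mul]
    have : (∑ j, d j) / (2 * τ) + n * (1 / (4 * n)) + ((∑ i, e i) / (2 * τ) + n * (1 / (4 * n)))
        = τ / (2 * τ) + 1 / 2 := by
      rw [hτd]; field_simp; ring
    rw [mul_one_div] at this
    rw [mul_one, this]
    apply le_of_eq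
    field_simp; norm_num
  have hq := h W U φ ψ hadm (fun j => le_add_of_nonneg_left (hd' j))
    (fun j => le_add_of_nonneg_left (he' j))
  -- Almost optimal lifts are chosen entry by entry; the n² errors add up to half of the gap c/2 −
  -- R.
  set ε := (c / 2 - R) / (2 * n ^ 2) with hε
  have hε0 : 0 < ε := div_pos (by linarith) (by positivity)
  choose a b hab hlt' using fun i j =>
    exists_relForm_lt (L := L) hL (lt_add_of_pos_right (relForm L (φ j) (ψ i) (bimul W x U i j)) hε0)
  have h1 := hlift a b hab
  have h2 : ∑ i, ∑ j, (φ j * ‖a i j‖ ^ 2 + ψ i * ‖b i j‖ ^ 2) ≤ R + n ^ 2 * ε := by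
    calc _ ≤ ∑ i, ∑ j, (relForm L (φ j) (ψ i) (bimul W x U i j) + ε) :=
          Finset.sum_le_sum fun i _ => Finset.sum_le_sum fun j _ => (hlt' i j).le
      _ = ∑ i, ∑ j, relForm L (φ j) (ψ i) (bimul W x U i j) + n ^ 2 * ε := by
          simp [Finset.sum_add_distrib, pow_two, mul_assoc]
      _ ≤ _ := by gcongr
  have h3 : (1 / (2 * τ)) * ∑ i, ∑ j, (d j * ‖a i j‖ ^ 2 + e i * ‖b i j‖ ^ 2)
      ≤ ∑ i, ∑ j, (φ j * ‖a i j‖ ^ 2 + ψ i * ‖b i j‖ ^ 2) := by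
    simp only [Finset.mul_sum]
    refine Finset.sum_le_sum fun i _ => Finset.sum_le_sum fun j _ => ?_
    have : 1 / (2 * τ) * (d j * ‖a i j‖ ^ 2 + e i * ‖b i j‖ ^ 2)
        = d j / (2 * τ) * ‖a i j‖ ^ 2 + e i / (2 * τ) * ‖b i j‖ ^ 2 := by ring
    rw [this]
    gcongr
    · exact le_add_of_nonneg_right hn4.le
    · exact le_add_of_nonneg_right hn4.le
  have h4 : c / 2 ≤ (1 / (2 * τ)) * ∑ i, ∑ j, (d j * ‖a i j‖ ^ 2 + e i * ‖b i j‖ ^ 2) := by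
    calc c / 2 = (1 / (2 * τ)) * (c * τ) := by field_simp
      _ ≤ _ := by gcongr
  have h5 : (n : ℝ) ^ 2 * ε = (c / 2 - R) / 2 := by rw [hε]; field_simp
  linarith

end Rel

/-- A positive, monotone, homogeneous function of two positive variables. -/
structure IsKFun (k : ℝ → ℝ → ℝ) : Prop where
  nonneg : ∀ s t, 0 < s → 0 < t → 0 ≤ k s t
  homog : ∀ c s t, 0 < c → 0 < s → 0 < t → k (c * s) (c * t) = c * k s t
  mono : ∀ s t s' t', 0 < s → 0 < t → s ≤ s' → t ≤ t' → k s t ≤ k s' t'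
  pos : 0 < k 1 1

/-- The diagonal quadratic form attached to `k`. -/
def kForm (k : ℝ → ℝ → ℝ) {n : ℕ} (W U : Matrix (Fin n) (Fin n) ℂ) (φ ψ : Fin n → ℝ)
    (x : Matrix (Fin n) (Fin n) Ell2) : ℝ :=
  ∑ i, ∑ j, k (φ j) (ψ i) * ‖bimul W x U i j‖ ^ 2

/-- The matrix norms `N` on `E`, transported to `ℓ₂` by `T`, are given up to the constant `C`
by the suprema of the diagonal quadratic forms attached to `k`. -/
structure Represents {E : Type*} [AddCommGroup E] [Module ℂ E] (N : MatrixNorms E)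
    (T : E ≃ₗ[ℂ] Ell2) (k : ℝ → ℝ → ℝ) (C : ℝ) : Prop where
  pos : 0 < C
  nonneg : ∀ n x, 0 ≤ N n x
  upper : ∀ (n : ℕ) (x : Matrix (Fin n) (Fin n) E) (R : ℝ), 0 ≤ R →
    (∀ W U φ ψ, Adm W U φ ψ → kForm k W U φ ψ (x.map T) ≤ R) → N n x ^ 2 ≤ C * R
  lower : ∀ (n : ℕ) (x : Matrix (Fin n) (Fin n) E) W U φ ψ, Adm W U φ ψ →
    kForm k W U φ ψ (x.map T) ≤ C * N n x ^ 2

lemma kForm_mono {k k' : ℝ → ℝ → ℝ} {A : ℝ} (h : ∀ s t, 0 < s → 0 < t → k s t ≤ A * k' s t)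
    {n : ℕ} {W U : Matrix (Fin n) (Fin n) ℂ} {φ ψ : Fin n → ℝ} (hadm : Adm W U φ ψ)
    (x : Matrix (Fin n) (Fin n) Ell2) : kForm k W U φ ψ x ≤ A * kForm k' W U φ ψ x := by
  simp only [kForm, Finset.mul_sum]
  refine Finset.sum_le_sum fun i _ => Finset.sum_le_sum fun j _ => ?_
  rw [← mul_assoc]
  gcongr
  exact h _ _ (hadm.pos_c j) (hadm.pos_r i)

/-! ### Spaces represented by a function of two variables -/

section

variable {E E' : Type*} [AddCommGroup E] [Module ℂ E] [AddCommGroup E'] [Module ℂ E']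
  {N : MatrixNorms E} {N' : MatrixNorms E'} {T : E ≃ₗ[ℂ] Ell2} {T' : E' ≃ₗ[ℂ] Ell2}
  {k k' : ℝ → ℝ → ℝ} {C C' A : ℝ}

/-- The diagonal forms are monotone in the representing function, so comparing two functions
compares the matrix norms at all levels with one constant. -/
lemma Represents.le_of_le (h : Represents N T k C) (h' : Represents N' T' k' C') (hA : 0 ≤ A)
    (h1 : ∀ s t, 0 < s → 0 < t → k s t ≤ A * k' s t) {n : ℕ} (x : Matrix (Fin n) (Fin n) E)
    (x' : Matrix (Fin n) (Fin n) E') (hx : x.map T = x'.map T') :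
    N n x ≤ √(A * C * C') * N' n x' := by
  have hC := h.pos
  have hC' := h'.pos
  have h0 := h'.nonneg n x'
  refine le_of_sq_le_sq ?_ (by positivity)
  rw [mul_pow, Real.sq_sqrt (by positivity)]
  have := h.upper n x (A * (C' * N' n x' ^ 2)) (by positivity) fun W U φ ψ hadm => by
    refine (kForm_mono h1 hadm _).trans ?_
    rw [hx]
    exact mul_le_mul_of_nonneg_left (h'.lower n x' W U φ ψ hadm) hA
  linarith

lemma Represents.completelyIsoWith (h : Represents N T k C) (h' : Represents N' T' k' C')
    (hA : 0 ≤ A) (h1 : ∀ s t, 0 < s → 0 < t → k s t ≤ A * k' s t)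
    (h2 : ∀ s t, 0 < s → 0 < t → k' s t ≤ A * k s t) :
    CompletelyIsoWith √(A * C * C') N N' := by
  refine ⟨T.trans T'.symm, fun n x => ?_⟩
  have hx : x.map T = (x.map (T.trans T'.symm)).map T' := by
    ext1 i j; simp
  refine ⟨?_, h.le_of_le h' hA h1 _ _ hx⟩
  have := h'.le_of_le h hA h2 _ _ hx.symm
  rwa [mul_right_comm] at this

lemma CompletelyIsoWith.represents {K : ℝ} (hiso : CompletelyIsoWith K N N')
    (hN : ∀ n x, 0 ≤ N n x) (hK : 0 < K)
    (h' : Represents N' T' k' C') : ∃ T : E ≃ₗ[ℂ] Ell2, Represents N T k' (C' * K ^ 2) := by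
  obtain ⟨S, hS⟩ := hiso
  have hC := h'.pos
  refine ⟨S.trans T', by positivity, hN, fun n x R hR hx => ?_, fun n x W U φ ψ hadm => ?_⟩
  · have h1 := h'.upper n (x.map S) R hR fun W U φ ψ hadm => hx W U φ ψ hadm
    have h2 := pow_le_pow_left₀ (hN n x) (hS n x).2 2
    rw [mul_pow] at h2
    nlinarith [mul_le_mul_of_nonneg_left h1 (sq_nonneg K)]
  · have h1 := h'.lower n (x.map S) W U φ ψ hadm
    have h2 := pow_le_pow_left₀ (h'.nonneg n _) (hS n x).1 2
    rw [mul_pow] at h2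
    refine le_trans h1 ?_
    rw [mul_assoc]
    gcongr

/-- The opposite matrix norms. -/
def opNorms (N : MatrixNorms E) : MatrixNorms E := fun n x => N n x.transpose

lemma Adm.transpose {n : ℕ} {W U : Matrix (Fin n) (Fin n) ℂ} {φ ψ : Fin n → ℝ}
    (h : Adm W U φ ψ) : Adm U.transpose W.transpose ψ φ :=
  ⟨transpose_mem_unitary h.right_mem, transpose_mem_unitary h.left_mem, h.pos_r, h.pos_c, by
    have := h.sum_le; linarith⟩

lemma kForm_transpose (k : ℝ → ℝ → ℝ) {n : ℕ} (W U : Matrix (Fin n) (Fin n) ℂ) (φ ψ : Fin n → ℝ)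
    (x : Matrix (Fin n) (Fin n) Ell2) :
    kForm (fun s t => k t s) W U φ ψ x = kForm k U.transpose W.transpose ψ φ x.transpose := by
  unfold kForm
  rw [Finset.sum_comm, ← bimul_transpose]
  rfl

/-- The opposite structure exchanges the two variables; it converts every result on columns into one
on rows. -/
lemma Represents.op (h : Represents N T k C) :
    Represents (opNorms N) T (fun s t => k t s) C where
  pos := h.pos
  nonneg n x := h.nonneg n _
  upper n x R hR hx := by
    refine h.upper n x.transpose R hR fun W U φ ψ hadm => ?_
    have := hx _ _ _ _ hadm.transpose
    rwa [kForm_transpose, Matrix.transpose_transpose, Matrix.transpose_transpose] at this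
  lower n x W U φ ψ hadm := by
    rw [kForm_transpose]
    exact h.lower n x.transpose _ _ _ _ hadm.transpose

lemma IsKFun.op (h : IsKFun k) : IsKFun (fun s t => k t s) :=
  ⟨fun s t hs ht => h.nonneg t s ht hs, fun c s t hc hs ht => h.homog c t s hc ht hs,
    fun s t s' t' hs ht hss htt => h.mono t s t' s' ht hs htt hss, h.pos⟩

lemma Adm.one_half : Adm (1 : Matrix (Fin 1) (Fin 1) ℂ) 1 (fun _ => 1 / 2) (fun _ => 1 / 2) :=
  ⟨one_mem _, one_mem _, fun _ => by norm_num, fun _ => by norm_num, by norm_num⟩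

/-- At level 1 the form is k(φ, ψ) times a squared norm at most ‖T x‖², with weights at most 1; the
weights 1/2, 1/2 give the reverse bound. Hence `T` is a Hilbert space isomorphism. -/
lemma Represents.exists_norm1_le (h : Represents N T k C) (hk : IsKFun k) :
    ∃ A : ℝ, 0 < A ∧ ∀ x, norm1 N x ≤ A * ‖T x‖ ∧ ‖T x‖ ≤ A * norm1 N x := by
  have hC := h.pos
  have hk1 := hk.pos
  have hkh : 0 < k (1 / 2) (1 / 2) := by
    have := hk.homog (1 / 2) 1 1 (by norm_num) one_pos one_pos
    rw [mul_one] at this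
    rw [this]; positivity
  refine ⟨√(C * k 1 1) + √(C / k (1 / 2) (1 / 2)), by positivity, fun x => ⟨?_, ?_⟩⟩
  · let X : Matrix (Fin 1) (Fin 1) E := fun _ _ => x
    have h1 : norm1 N x ^ 2 ≤ C * (k 1 1 * ‖T x‖ ^ 2) := by
      refine h.upper 1 _ _ (by positivity) fun W U φ ψ hadm => ?_
      simp only [kForm, Finset.univ_unique, Fin.default_eq_zero, Finset.sum_singleton]
      have h2 := sum_col_sq_le (X.map T) hadm.left_mem
        hadm.right_mem 0
      rw [columnNorms_one] at h2
      simp only [Finset.univ_unique, Fin.default_eq_zero, Finset.sum_singleton] at h2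
      exact mul_le_mul (hk.mono _ _ _ _ (hadm.pos_c 0) (hadm.pos_r 0) (hadm.le_one_c 0)
        (hadm.le_one_r 0)) h2 (by positivity) hk1.le
    have h3 : norm1 N x ≤ √(C * k 1 1) * ‖T x‖ := by
      refine le_of_sq_le_sq ?_ (by positivity)
      rw [mul_pow, Real.sq_sqrt (by positivity)]; linarith
    refine h3.trans ?_
    gcongr
    exact le_add_of_nonneg_right (Real.sqrt_nonneg _)
  · have h1 := h.lower 1 (fun _ _ => x) _ _ _ _ Adm.one_half
    rw [kForm, bimul_one] at h1
    simp only [Finset.univ_unique, Fin.default_eq_zero, Finset.sum_singleton] at h1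
    change k (1 / 2) (1 / 2) * ‖T x‖ ^ 2 ≤ _ at h1
    have h0 := h.nonneg 1 (fun _ _ => x)
    change _ ≤ _ * N 1 _
    have h3 : ‖T x‖ ≤ √(C / k (1 / 2) (1 / 2)) * N 1 (fun _ _ => x) := by
      refine le_of_sq_le_sq ?_ (by positivity)
      rw [mul_pow, Real.sq_sqrt (by positivity), div_mul_eq_mul_div, le_div_iff₀ hkh]; linarith
    refine h3.trans ?_
    gcongr
    exact le_add_of_nonneg_left (Real.sqrt_nonneg _)

lemma orthonormal_stdVec : Orthonormal ℂ stdVec := by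
  rw [orthonormal_iff_ite]
  intro i j
  simp only [stdVec, lp.inner_single_left, lp.coeFn_single]
  by_cases h : i = j
  · subst h; simp
  · simp [h]

lemma norm_stdVec (i : ℕ) : ‖stdVec i‖ = 1 := orthonormal_stdVec.1 i

lemma norm_sum_stdVec_sq {n : ℕ} {i : Fin n → ℕ} (hi : Function.Injective i) (c : Fin n → ℂ) :
    ‖∑ a, c a • stdVec (i a)‖ ^ 2 = ∑ a, ‖c a‖ ^ 2 := by
  have h := (orthonormal_stdVec.comp i hi).inner_sum c c Finset.univ
  rw [inner_self_eq_norm_sq_to_K] at h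
  have h2 : (((‖∑ a, c a • stdVec (i a)‖ ^ 2 : ℝ)) : ℂ) = ((∑ a, ‖c a‖ ^ 2 : ℝ) : ℂ) := by
    push_cast
    refine Eq.trans h (Finset.sum_congr rfl fun a _ => ?_)
    rw [← Complex.normSq_eq_conj_mul_self, Complex.normSq_eq_norm_sq]
    push_cast; rfl
  exact_mod_cast h2

lemma sum_norm_sq_of_mem_unitary {n : ℕ} {W : Matrix (Fin n) (Fin n) ℂ}
    (hW : W ∈ Matrix.unitaryGroup (Fin n) ℂ) (i : Fin n) : ∑ k, ‖W i k‖ ^ 2 = 1 := by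
  have h := congrFun (congrFun (Matrix.mem_unitaryGroup_iff.1 hW) i) i
  rw [Matrix.mul_apply, Matrix.one_apply_eq] at h
  have h2 : ((∑ k, ‖W i k‖ ^ 2 : ℝ) : ℂ) = 1 := by
    rw [← h]
    push_cast
    refine Finset.sum_congr rfl fun k _ => ?_
    rw [Matrix.star_apply, RCLike.star_def, Complex.mul_conj, Complex.normSq_eq_norm_sq]
    push_cast; rfl
  exact_mod_cast h2

/-- The dilate of (s, t₀) by 1 + t/t₀ dominates (s, t); homogeneity and monotonicity thus replace
concavity. -/
lemma IsKFun.le_mul (hk : IsKFun k) {s t t₀ : ℝ} (hs : 0 < s) (ht : 0 < t) (ht₀ : 0 < t₀) :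
    k s t ≤ (1 + t / t₀) * k s t₀ := by
  have h1 : 0 < 1 + t / t₀ := by positivity
  rw [← hk.homog _ _ _ h1 hs ht₀]
  refine hk.mono _ _ _ _ hs ht ?_ ?_
  · exact le_mul_of_one_le_left hs.le (le_add_of_nonneg_right (by positivity))
  · rw [add_mul, div_mul_cancel₀ _ ht₀.ne']; linarith

/-- The column fundamental function is `k (n, 1)` up to constants, for every orthonormal basis. -/
lemma Represents.fundC_equiv (h : Represents N T k C) (hk : IsKFun k) {J : Ell2 ≃ₗ[ℂ] E}
    (hJ : IsHilbertIso N J) : EquivOn (fun n : ℕ => 1 ≤ n) (fundC N J) (fun n => k n 1) := by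
  have hC := h.pos
  obtain ⟨A, hA, hAT⟩ := h.exists_norm1_le hk
  obtain ⟨A', hA'⟩ := hJ
  set B := A * max A' 1 with hB
  have hB0 : 0 < B := by positivity
  -- Compares the basis `J e_k` with the coordinates of the representation. Only its bounds by `B`
  -- in both directions matter, so the result holds for every orthonormal basis.
  let u : Ell2 ≃ₗ[ℂ] Ell2 := J.trans T
  have hu1 : ∀ y, ‖u y‖ ≤ B * ‖y‖ := by
    intro y
    have h1 := (hAT (J y)).2
    have h2 := (hA' y).1
    calc ‖u y‖ ≤ A * norm1 N (J y) := h1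
      _ ≤ A * (max A' 1 * ‖y‖) := by
          gcongr; exact h2.trans (by gcongr; exact le_max_left _ _)
      _ = _ := by rw [hB]; ring
  have hu2 : ∀ y, ‖y‖ ≤ B * ‖u y‖ := by
    intro y
    have h1 := (hAT (J y)).1
    have h2 := (hA' y).2
    calc ‖y‖ ≤ A' * norm1 N (J y) := h2
      _ ≤ max A' 1 * (A * ‖u y‖) := by
          gcongr
          · exact h.nonneg _ _
          · exact le_max_left _ _
          · exact h1
      _ = _ := by rw [hB]; ring
  refine ⟨4 * C * B ^ 2, by positivity, fun n hn => ?_⟩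
  have hn0 : (0 : ℝ) < n := by exact_mod_cast hn
  set z : Fin n := ⟨0, hn⟩ with hz
  set X : Matrix (Fin n) (Fin n) E := fun i j => if (j : ℕ) = 0 then J (stdVec i) else 0 with hX
  have hXz : ∀ i j, X.map T i j = if j = z then u (stdVec i) else 0 := by
    intro i j
    change T (if (j : ℕ) = 0 then J (stdVec i) else 0) = _
    by_cases hj : j = z
    · simp [hj, hz, u]
    · have : (j : ℕ) ≠ 0 := fun h0 => hj (Fin.ext h0)
      simp [hj, this]
  obtain ⟨Y, hY⟩ : ∃ Y, Y = X.map T := ⟨_, rfl⟩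
  have hfund : fundC N J n = N n X ^ 2 := rfl
  rw [hfund]
  rw [← hY] at hXz
  clear_value X
  have hkn : k n 1 = n * k 1 (1 / n) := by
    rw [← hk.homog _ _ _ hn0 one_pos (by positivity), mul_one, mul_one_div_cancel hn0.ne']
  have hk1 : 0 ≤ k 1 (1 / n) := hk.nonneg _ _ one_pos (by positivity)
  constructor
  · rw [inv_mul_le_iff₀ (by positivity)]
    -- Mass 1/4 goes to the only nonzero column and 1/(4n) to each of the 2n weights, 3/4 in total.
    -- Each of the n rows then contributes at least k(1, 1/n)/4 up to B², and n k(1, 1/n) = k(n, 1).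
    have hadm : Adm (1 : Matrix (Fin n) (Fin n) ℂ) 1
        (fun j => 1 / (4 * n) + if j = z then 1 / 4 else 0) (fun _ => 1 / (4 * n)) := by
      refine ⟨one_mem _, one_mem _, fun j => ?_, fun _ => by positivity, ?_⟩
      · split_ifs <;> positivity
      · simp only [Finset.sum_add_distrib, Finset.sum_const, Finset.card_univ, Fintype.card_fin,
          nsmul_eq_mul, Finset.sum_ite_eq', Finset.mem_univ, if_true]
        have : (n : ℝ) * (1 / (4 * n)) = 1 / 4 := by field_simp
        rw [this]; norm_num
    have h1 := h.lower n X _ _ _ _ hadm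
    rw [← hY] at h1
    have h2 : k n 1 ≤ 4 * B ^ 2 * kForm k (1 : Matrix (Fin n) (Fin n) ℂ) 1
        (fun j => 1 / (4 * n) + if j = z then 1 / 4 else 0) (fun _ => 1 / (4 * n)) (Y) := by
      have h3 : ∀ i : Fin n, (1 / 4 * k 1 (1 / n)) ≤ B ^ 2 * ∑ j : Fin n,
          k (1 / (4 * n) + if j = z then 1 / 4 else 0) (1 / (4 * n)) * ‖Y i j‖ ^ 2 := by
        intro i
        have h4 : ∑ j : Fin n,
          k (1 / (4 * n) + if j = z then 1 / 4 else 0) (1 / (4 * n)) * ‖Y i j‖ ^ 2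
            = k (1 / (4 * n) + 1 / 4) (1 / (4 * n)) * ‖u (stdVec i)‖ ^ 2 := by
          rw [Finset.sum_eq_single z]
          · simp [hXz]
          · intro j _ hj; simp [hXz, hj]
          · simp
        have h5 : 1 / 4 * k 1 (1 / n) ≤ k (1 / (4 * n) + 1 / 4) (1 / (4 * n)) := by
          rw [← hk.homog _ _ _ (by norm_num) one_pos (by positivity)]
          refine hk.mono _ _ _ _ (by norm_num) (by positivity) ?_ ?_
          · rw [mul_one]; exact le_add_of_nonneg_left (by positivity)
          · apply le_of_eq; field_simp
        have h6 : 1 ≤ B ^ 2 * ‖u (stdVec i)‖ ^ 2 := by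
          rw [← mul_pow]
          have := hu2 (stdVec i)
          rw [norm_stdVec] at this
          exact one_le_pow₀ this
        rw [h4]
        have h7 : 0 ≤ 1 / 4 * k 1 (1 / n) := by positivity
        calc 1 / 4 * k 1 (1 / n) ≤ 1 / 4 * k 1 (1 / n) * (B ^ 2 * ‖u (stdVec i)‖ ^ 2) :=
              le_mul_of_one_le_right h7 h6
          _ ≤ k (1 / (4 * n) + 1 / 4) (1 / (4 * n)) * (B ^ 2 * ‖u (stdVec i)‖ ^ 2) := by gcongr
          _ = _ := by ring
      have h4 := Finset.sum_le_sum fun i (_ : i ∈ Finset.univ) => h3 i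
      rw [Finset.sum_const, Finset.card_univ, Fintype.card_fin,
        nsmul_eq_mul, ← Finset.mul_sum] at h4
      rw [kForm, bimul_one, hkn]
      linarith
    calc k n 1 ≤ _ := h2
      _ ≤ 4 * B ^ 2 * (C * N n X ^ 2) := by gcongr
      _ = _ := by ring
  · have h1 : N n X ^ 2 ≤ C * (2 * B ^ 2 * k n 1) := by
      refine h.upper n X _ (by rw [hkn]; positivity) fun W U φ ψ hadm => ?_
      rw [← hY]
      -- Only one column is nonzero, so the entry is the scalar `U z j` times the image under u of
      -- the unit vector with coordinates `W i k`.
      have h2 : ∀ i j, ‖bimul W (Y) U i j‖ ^ 2 ≤ B ^ 2 * ‖U z j‖ ^ 2 := by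
        intro i j
        have e : bimul W (Y) U i j = u (∑ k, (W i k * U z j) • stdVec k) := by
          rw [map_sum]
          refine Finset.sum_congr rfl fun k _ => ?_
          rw [Finset.sum_eq_single z]
          · simp [hXz]
          · intro l _ hl; simp [hXz, hl]
          · simp
        have e2 : ‖∑ k : Fin n, (W i k * U z j) • stdVec k‖ ^ 2 = ‖U z j‖ ^ 2 := by
          rw [norm_sum_stdVec_sq (i := fun k : Fin n => (k : ℕ)) Fin.val_injective]
          simp only [norm_mul, mul_pow]
          rw [← Finset.sum_mul, sum_norm_sq_of_mem_unitary hadm.left_mem, one_mul]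
        rw [e, ← e2, ← mul_pow]
        exact pow_le_pow_left₀ (norm_nonneg _) (hu1 _) 2
      -- Each coefficient is at most (1 + n ψ_i) k(1, 1/n); the sum over the rows costs n + n ∑ ψ_i
      -- ≤ 2n.
      calc kForm k W U φ ψ (Y)
          ≤ ∑ i, ∑ j, ((1 + ψ i / (1 / n)) * k 1 (1 / n)) * (B ^ 2 * ‖U z j‖ ^ 2) := by
            refine Finset.sum_le_sum fun i _ => Finset.sum_le_sum fun j _ => ?_
            have h3 := hk.nonneg _ _ (hadm.pos_c j) (hadm.pos_r i)
            have h4 : k (φ j) (ψ i) ≤ (1 + ψ i / (1 / n)) * k 1 (1 / n) :=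
              (hk.mono _ _ _ _ (hadm.pos_c j) (hadm.pos_r i) (hadm.le_one_c j) le_rfl).trans
                (hk.le_mul one_pos (hadm.pos_r i) (by positivity))
            exact mul_le_mul h4 (h2 i j) (by positivity) (h3.trans h4)
        _ = (n + n * ∑ i, ψ i) * (B ^ 2 * k 1 (1 / n)) := by
            simp only [← Finset.mul_sum, sum_norm_sq_of_mem_unitary hadm.right_mem, mul_one,
              ← Finset.sum_mul, Finset.sum_add_distrib, Finset.sum_const, Finset.card_univ,
              Fintype.card_fin, nsmul_eq_mul, ← Finset.sum_div]
            field_simp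
        _ ≤ (n + n * 1) * (B ^ 2 * k 1 (1 / n)) := by
            gcongr
            have := Finset.sum_nonneg fun j (_ : j ∈ Finset.univ) => (hadm.pos_c j).le
            linarith [hadm.sum_le]
        _ = 2 * B ^ 2 * k n 1 := by rw [hkn]; ring
    have h2 : 0 ≤ k n 1 := by rw [hkn]; positivity
    calc N n X ^ 2 ≤ _ := h1
      _ ≤ 4 * C * B ^ 2 * k n 1 := by nlinarith [mul_nonneg hC.le (mul_nonneg (sq_nonneg B) h2)]

lemma Represents.fundR_equiv (h : Represents N T k C) (hk : IsKFun k) {J : Ell2 ≃ₗ[ℂ] E}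
    (hJ : IsHilbertIso N J) : EquivOn (fun n : ℕ => 1 ≤ n) (fundR N J) (fun n => k 1 n) :=
  h.op.fundC_equiv hk.op (J := J) hJ

end

/-! ### Relations on ℓ₂: representation, Ruan's axioms and maps -/

section Rel

variable {H₁ H₂ : Type*} [NormedAddCommGroup H₁] [InnerProductSpace ℂ H₁]
  [NormedAddCommGroup H₂] [InnerProductSpace ℂ H₂] {L : Submodule ℂ ((H₁ × H₂) × Ell2)}

/-- The minimax estimates transfer the scalar bounds on the forms to the matrix norms; the 2 in the
constant is that of `relNorm_sq_le`. -/
lemma represents_relNorm (hL : ∀ x, ∃ p, (p, x) ∈ L) {k : ℝ → ℝ → ℝ} {A : ℝ} (hA : 0 < A)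
    (h1 : ∀ s t x, 0 < s → 0 < t → relForm L s t x ≤ A * (k s t * ‖x‖ ^ 2))
    (h2 : ∀ s t x, 0 < s → 0 < t → k s t * ‖x‖ ^ 2 ≤ A * relForm L s t x) :
    Represents (relNorm L) (LinearEquiv.refl ℂ Ell2) k (2 * A) where
  pos := by positivity
  nonneg := relNorm_nonneg
  upper n x R hR hx := by
    have := relNorm_sq_le hL x (R := A * R) (by positivity) fun W U φ ψ hadm _ _ => by
      refine le_trans ?_ (mul_le_mul_of_nonneg_left (hx W U φ ψ hadm) hA.le)
      simp only [kForm, Finset.mul_sum]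
      exact Finset.sum_le_sum fun i _ => Finset.sum_le_sum fun j _ =>
        h1 _ _ _ (hadm.pos_c j) (hadm.pos_r i)
    linarith
  lower n x W U φ ψ hadm := by
    have h3 : kForm k W U φ ψ x ≤ A * relNorm L n x ^ 2 := by
      refine le_trans ?_ (mul_le_mul_of_nonneg_left (sum_relForm_le hL x hadm) hA.le)
      simp only [kForm, Finset.mul_sum]
      exact Finset.sum_le_sum fun i _ => Finset.sum_le_sum fun j _ =>
        h2 _ _ _ (hadm.pos_c j) (hadm.pos_r i)
    refine le_trans h3 ?_
    nlinarith [mul_nonneg hA.le (sq_nonneg (relNorm L n x))]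

/-- Operator space axioms for the norms defined by a relation. -/
lemma isOperatorSpace_relNorm (hL : ∀ x, ∃ p, (p, x) ∈ L) {A : ℝ}
    (h1 : ∀ x : Ell2, norm1 (relNorm L) x ≤ A * ‖x‖)
    (h2 : ∀ a b x, ((a, b), x) ∈ L → ‖x‖ ≤ A * max ‖a‖ ‖b‖) (hA : 0 < A) :
    IsOperatorSpace (relNorm L) := by
  have hbi : ∀ (m n : ℕ) (a : Matrix (Fin m) (Fin n) ℂ) (x : Matrix (Fin n) (Fin n) Ell2)
      (b : Matrix (Fin n) (Fin m) ℂ), relNorm L m (bimul a x b) ≤ ‖a‖ * relNorm L n x * ‖b‖ := by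
    intro m n a x b
    have key : ∀ r, relNorm L n x < r → relNorm L m (bimul a x b) ≤ ‖a‖ * r * ‖b‖ := by
      intro r hr
      obtain ⟨c, d, hcd, hc, hd⟩ := exists_lift_of_relNorm_lt hL hr
      refine (relNorm_le (bimul_lift hcd a b)).trans (max_le ?_ ?_)
      · exact (columnNorms_bimul_le _ _ _).trans (by gcongr)
      · exact (rowNorms_bimul_le _ _ _).trans (by gcongr)
    have hc : Filter.Tendsto (fun r : ℝ => ‖a‖ * r * ‖b‖)
        (nhdsWithin (relNorm L n x) (Set.Ioi (relNorm L n x)))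
        (nhds (‖a‖ * relNorm L n x * ‖b‖)) :=
      ((by fun_prop : Continuous fun r : ℝ => ‖a‖ * r * ‖b‖).tendsto _).mono_left
        nhdsWithin_le_nhds
    exact ge_of_tendsto hc (Filter.eventually_of_mem self_mem_nhdsWithin key)
  have hent : ∀ n (x : Matrix (Fin n) (Fin n) Ell2) i j, ‖x i j‖ ≤ A * relNorm L n x := by
    intro n x i j
    refine le_of_forall_pos_lt_add fun ε hε => ?_
    obtain ⟨c, d, hcd, hc, hd⟩ := exists_lift_of_relNorm_lt hL
      (show relNorm L n x < relNorm L n x + ε / A by linarith [div_pos hε hA])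
    calc ‖x i j‖ ≤ A * max ‖c i j‖ ‖d i j‖ := h2 _ _ _ (hcd i j)
      _ < A * (relNorm L n x + ε / A) := by
          gcongr
          exact max_lt ((norm_entry_le_columnNorms _ _ _).trans_lt hc)
            ((norm_entry_le_rowNorms _ _ _).trans_lt hd)
      _ = A * relNorm L n x + ε := by rw [mul_add, mul_div_cancel₀ _ hA.ne']
  refine ⟨relNorm_nonneg, fun n x => ⟨fun h => ?_, ?_⟩, fun n x y => ?_, hbi, fun m n x y => ?_, ?_⟩
  · ext1 i j
    have := hent n x i j
    rw [h, mul_zero] at this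
    exact norm_le_zero_iff.1 this
  · rintro rfl
    refine le_antisymm ?_ (relNorm_nonneg _ _)
    have := relNorm_le (L := L) (x := (0 : Matrix (Fin n) (Fin n) Ell2)) (a := 0) (b := 0)
      fun i j => L.zero_mem
    refine this.trans (le_of_eq ?_)
    have e1 : columnNorms H₁ n 0 = 0 :=
      le_antisymm (columnNorms_le _ le_rfl fun α => by simp [colSq]) (columnNorms_nonneg _ _)
    have e2 : rowNorms H₂ n 0 = 0 := by
      rw [rowNorms_eq]
      exact le_antisymm (columnNorms_le _ le_rfl fun α => by simp [colSq]) (columnNorms_nonneg _ _)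
    rw [e1, e2, max_self]
  · refine le_of_forall_pos_lt_add fun ε hε => ?_
    obtain ⟨a, b, hab, ha, hb⟩ := exists_lift_of_relNorm_lt hL
      (show relNorm L n x < relNorm L n x + ε / 2 by linarith)
    obtain ⟨c, d, hcd, hc, hd⟩ := exists_lift_of_relNorm_lt hL
      (show relNorm L n y < relNorm L n y + ε / 2 by linarith)
    refine (relNorm_le (a := a + c) (b := b + d)
      fun i j => L.add_mem (hab i j) (hcd i j)).trans_lt (max_lt ?_ ?_)
    · exact (columnNorms_add_le _ _ _).trans_lt (by linarith)
    · exact (rowNorms_add_le _ _ _).trans_lt (by linarith)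
  · refine le_antisymm ?_ (max_le ?_ ?_)
    · refine le_of_forall_pos_lt_add fun ε hε => ?_
      obtain ⟨a, b, hab, ha, hb⟩ := exists_lift_of_relNorm_lt hL
        (show relNorm L m x < relNorm L m x + ε by linarith)
      obtain ⟨c, d, hcd, hc, hd⟩ := exists_lift_of_relNorm_lt hL
        (show relNorm L n y < relNorm L n y + ε by linarith)
      have hl : ∀ i j, ((blockDiag a c i j, blockDiag b d i j), blockDiag x y i j) ∈ L := by
        intro i j
        refine Fin.addCases (fun i => ?_) (fun i => ?_) i <;>
        refine Fin.addCases (fun j => ?_) (fun j => ?_) j <;>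
        simp [blockDiag, hab, hcd]
        · exact L.zero_mem
        · exact L.zero_mem
      have hx : relNorm L m x ≤ max (relNorm L m x) (relNorm L n y) := le_max_left _ _
      have hy : relNorm L n y ≤ max (relNorm L m x) (relNorm L n y) := le_max_right _ _
      refine (relNorm_le hl).trans_lt (max_lt ?_ ?_)
      · exact (columnNorms_blockDiag_le _ _).trans_lt (max_lt (by linarith) (by linarith))
      · exact (rowNorms_blockDiag_le _ _).trans_lt (max_lt (by linarith) (by linarith))
    -- Compression to a corner by a contraction on each side recovers the block, so the lower bound
    -- follows from `hbi`.
    · let P : Matrix (Fin m) (Fin (m + n)) ℂ := fun i k => if Fin.castAdd n i = k then 1 else 0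
      let Q : Matrix (Fin (m + n)) (Fin m) ℂ := fun k i => if Fin.castAdd n i = k then 1 else 0
      have e : bimul P (blockDiag x y) Q = x := by
        ext1 i j
        simp [bimul, P, Q, blockDiag]
      have hP : ‖P‖ ≤ 1 := l2_norm_le_of_forall _ zero_le_one fun α => by
        simp [P, Fin.sum_univ_add]
        positivity
      have hQ : ‖Q‖ ≤ 1 := (l2_norm_transpose_le P).trans hP
      have := hbi _ _ P (blockDiag x y) Q
      rw [e] at this
      have h0 := relNorm_nonneg (L := L) _ (blockDiag x y)
      calc _ ≤ _ := this
        _ ≤ 1 * relNorm L _ (blockDiag x y) * 1 := by gcongr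
        _ = _ := by ring
    · let P : Matrix (Fin n) (Fin (m + n)) ℂ := fun i k => if Fin.natAdd m i = k then 1 else 0
      let Q : Matrix (Fin (m + n)) (Fin n) ℂ := fun k i => if Fin.natAdd m i = k then 1 else 0
      have e : bimul P (blockDiag x y) Q = y := by
        ext1 i j
        simp [bimul, P, Q, blockDiag]
      have hP : ‖P‖ ≤ 1 := l2_norm_le_of_forall _ zero_le_one fun α => by
        simp [P, Fin.sum_univ_add]
        positivity
      have hQ : ‖Q‖ ≤ 1 := (l2_norm_transpose_le P).trans hP
      have := hbi _ _ P (blockDiag x y) Q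
      rw [e] at this
      have h0 := relNorm_nonneg (L := L) _ (blockDiag x y)
      calc _ ≤ _ := this
        _ ≤ 1 * relNorm L _ (blockDiag x y) * 1 := by gcongr
        _ = _ := by ring
  · intro f hf
    have hc : CauchySeq f := by
      rw [Metric.cauchySeq_iff]
      intro ε hε
      obtain ⟨k, hk⟩ := hf (ε / A) (div_pos hε hA)
      refine ⟨k, fun i hi j hj => ?_⟩
      rw [dist_eq_norm]
      have h3 := hent 1 (fun _ _ => f i - f j) 0 0
      have h4 := hk i hi j hj
      calc ‖f i - f j‖ ≤ A * norm1 (relNorm L) (f i - f j) := h3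
        _ < A * (ε / A) := by gcongr
        _ = ε := mul_div_cancel₀ _ hA.ne'
    obtain ⟨x, hx⟩ := cauchySeq_tendsto_of_complete hc
    refine ⟨x, fun ε hε => ?_⟩
    obtain ⟨k, hk⟩ := Metric.tendsto_atTop.1 hx (ε / A) (div_pos hε hA)
    refine ⟨k, fun i hi => ?_⟩
    have := hk i hi
    rw [dist_eq_norm] at this
    calc _ ≤ A * ‖f i - x‖ := h1 _
      _ < A * (ε / A) := by gcongr
      _ = ε := mul_div_cancel₀ _ hA.ne'

end Rel

section Rel

variable {H₁ H₂ X : Type*} [NormedAddCommGroup H₁] [InnerProductSpace ℂ H₁]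
  [NormedAddCommGroup H₂] [InnerProductSpace ℂ H₂] [AddCommGroup X] [Module ℂ X]
  {L : Submodule ℂ ((H₁ × H₂) × X)}

/-- Operators acting on the lifts compatibly with the relation descend to the quotient with the same
cb bound. This is the source of the homogeneity of K. -/
lemma relNorm_map_le (hL : ∀ x, ∃ p, (p, x) ∈ L) (U₁ : H₁ →ₗ[ℂ] H₁) (U₂ : H₂ →ₗ[ℂ] H₂)
    (u : X →ₗ[ℂ] X) {B : ℝ} (hB : 0 ≤ B) (h1 : ∀ a, ‖U₁ a‖ ≤ B * ‖a‖)
    (h2 : ∀ b, ‖U₂ b‖ ≤ B * ‖b‖)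
    (h : ∀ a b x, ((a, b), x) ∈ L → ((U₁ a, U₂ b), u x) ∈ L) {n : ℕ}
    (x : Matrix (Fin n) (Fin n) X) : relNorm L n (x.map u) ≤ B * relNorm L n x := by
  have key : ∀ r, relNorm L n x < r → relNorm L n (x.map u) ≤ B * r := by
    intro r hr
    obtain ⟨a, b, hab, ha, hb⟩ := exists_lift_of_relNorm_lt hL hr
    refine (relNorm_le (a := a.map U₁) (b := b.map U₂) fun i j => h _ _ _ (hab i j)).trans
      (max_le ?_ ?_)
    · exact (columnNorms_map_le U₁ hB h1 a).trans (by gcongr)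
    · exact (rowNorms_map_le U₂ hB h2 b).trans (by gcongr)
  have hc : Filter.Tendsto (fun r : ℝ => B * r)
      (nhdsWithin (relNorm L n x) (Set.Ioi (relNorm L n x))) (nhds (B * relNorm L n x)) :=
    ((by fun_prop : Continuous fun r : ℝ => B * r).tendsto _).mono_left nhdsWithin_le_nhds
  exact ge_of_tendsto hc (Filter.eventually_of_mem self_mem_nhdsWithin key)

lemma relNorm_one_sq_le (a : H₁) (b : H₂) (x : X) (h : ((a, b), x) ∈ L) :
    norm1 (relNorm L) x ≤ max ‖a‖ ‖b‖ := by
  refine (relNorm_le (a := fun _ _ => a) (b := fun _ _ => b) fun _ _ => h).trans ?_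
  exact max_le_max (columnNorms_one (Matrix.of fun _ _ => a)).le
    (rowNorms_one (Matrix.of fun _ _ => b)).le

end Rel

/-! ### The spaces K and the intersections with C and R -/

section Weighted

variable {Ω : Type*} [MeasurableSpace Ω] {ν : Measure Ω} {uc ur : Ω → ℝ}

lemma norm_toLp_weighted_sq {u : Ω → ℝ} (hu : Measurable u) (h0 : ∀ ω, 0 ≤ u ω) {a : Ω → Ell2}
    (ha : MemLp a 2 (weighted ν u)) : Integrable (fun ω => u ω * ‖a ω‖ ^ 2) ν ∧
      ‖ha.toLp a‖ ^ 2 = ∫ ω, u ω * ‖a ω‖ ^ 2 ∂ν := by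
  have hm : Measurable fun ω => Real.toNNReal (u ω) := hu.real_toNNReal
  have h1 : Integrable (fun ω => ‖a ω‖ ^ 2) (weighted ν u) := ha.integrable_norm_pow two_ne_zero
  have e : ∀ ω, Real.toNNReal (u ω) • ‖a ω‖ ^ 2 = u ω * ‖a ω‖ ^ 2 := fun ω => by
    rw [NNReal.smul_def, Real.coe_toNNReal _ (h0 ω), smul_eq_mul]
  refine ⟨?_, ?_⟩
  · have := (integrable_withDensity_iff_integrable_smul hm).1 h1
    simpa only [e] using this
  · have h2 := integral_withDensity_eq_integral_smul (μ := ν) hm (fun ω => ‖a ω‖ ^ 2)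
    simp only [e] at h2
    rw [← h2, Lp.norm_toLp, ha.eLpNorm_eq_integral_rpow_norm two_ne_zero ENNReal.ofNat_ne_top]
    have h3 : 0 ≤ ∫ ω, ‖a ω‖ ^ 2 ∂(weighted ν u) := integral_nonneg fun ω => by positivity
    rw [ENNReal.toReal_ofReal (by positivity)]
    simp only [ENNReal.toReal_ofNat, Real.rpow_ofNat]
    rw [← Real.rpow_natCast, ← Real.rpow_mul h3]
    norm_num
    rfl

lemma memLp_weighted_indicator_const {u : Ω → ℝ} {S : Set Ω} (hS : MeasurableSet S) (hi : Integrable (S.indicator u) ν) (x : Ell2) :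
    MemLp (S.indicator fun _ => x) 2 (weighted ν u) := by
  refine memLp_indicator_const 2 hS x (Or.inr ?_)
  rw [weighted, withDensity_apply _ hS, ← lintegral_indicator hS]
  have : (fun ω => S.indicator (fun ω => ENNReal.ofReal (u ω)) ω)
      = fun ω => ENNReal.ofReal (S.indicator u ω) := by
    ext ω; by_cases h : ω ∈ S <;> simp [h]
  rw [this]
  exact hi.lintegral_lt_top.ne

/-- The relation between `(a, b)` and `x` expressing that `a + b` is the constant `x`. -/
def kRel (ν : Measure Ω) (uc ur : Ω → ℝ) :
    Submodule ℂ ((Lp Ell2 2 (weighted ν uc) × Lp Ell2 2 (weighted ν ur)) × Ell2) where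
  carrier := {p | ∃ (a b : Ω → Ell2) (ha : MemLp a 2 (weighted ν uc))
    (hb : MemLp b 2 (weighted ν ur)), ha.toLp a = p.1.1 ∧ hb.toLp b = p.1.2 ∧
      ∀ᵐ ω ∂ν, a ω + b ω = p.2}
  add_mem' := by
    rintro p q ⟨a, b, ha, hb, h1, h2, h⟩ ⟨a', b', ha', hb', h1', h2', h'⟩
    refine ⟨a + a', b + b', ha.add ha', hb.add hb', ?_, ?_, ?_⟩
    · rw [MemLp.toLp_add ha ha', h1, h1']; rfl
    · rw [MemLp.toLp_add hb hb', h2, h2']; rfl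
    · filter_upwards [h, h'] with ω hω hω'
      rw [Prod.snd_add, ← hω, ← hω', Pi.add_apply, Pi.add_apply]
      abel
  zero_mem' := ⟨0, 0, MemLp.zero, MemLp.zero, rfl, rfl, by simp⟩
  smul_mem' := by
    rintro c p ⟨a, b, ha, hb, h1, h2, h⟩
    refine ⟨c • a, c • b, ha.const_smul c, hb.const_smul c, ?_, ?_, ?_⟩
    · rw [MemLp.toLp_const_smul c ha, h1]; rfl
    · rw [MemLp.toLp_const_smul c hb, h2]; rfl
    · filter_upwards [h] with ω hω
      rw [Prod.smul_snd, ← hω, smul_add]; rfl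

lemma K_eq_relNorm (ν : Measure Ω) (uc ur : Ω → ℝ) : K ν uc ur = relNorm (kRel ν uc ur) := by
  funext n x
  unfold K relNorm
  congr 1
  ext t
  constructor
  · rintro ⟨a, b, ha, hb, h, rfl⟩
    exact ⟨_, _, fun i j => ⟨a i j, b i j, ha i j, hb i j, rfl, rfl, h i j⟩, rfl⟩
  · rintro ⟨a, b, hab, rfl⟩
    choose f g hf hg h1 h2 h using hab
    refine ⟨f, g, hf, hg, h, ?_⟩
    have e1 : (fun i j => (hf i j).toLp (f i j)) = a := funext fun i => funext fun j => h1 i j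
    have e2 : (fun i j => (hg i j).toLp (g i j)) = b := funext fun i => funext fun j => h2 i j
    rw [e1, e2]

/-- The function `∫ min (s u_c, t u_r)`. -/
def kWeight (ν : Measure Ω) (uc ur : Ω → ℝ) (s t : ℝ) : ℝ := ∫ ω, min (s * uc ω) (t * ur ω) ∂ν

lemma IsWeightPair.integrable_min_mul (h : IsWeightPair ν uc ur) {s t : ℝ} (hs : 0 ≤ s)
    (ht : 0 ≤ t) : Integrable (fun ω => min (s * uc ω) (t * ur ω)) ν := by
  refine Integrable.mono' (h.integrable_min.const_mul (max s t)) ?_ (ae_of_all _ fun ω => ?_)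
  · exact ((h.measurable_c.const_mul s).min (h.measurable_r.const_mul t)).aestronglyMeasurable
  · have h1 := h.nonneg_c ω
    have h2 := h.nonneg_r ω
    rw [Real.norm_of_nonneg (by positivity), mul_min_of_nonneg _ _ (by positivity)]
    exact min_le_min (mul_le_mul_of_nonneg_right (le_max_left _ _) h1)
      (mul_le_mul_of_nonneg_right (le_max_right _ _) h2)

/-- Pointwise optimisation: x is put into the column part where s u_c ≤ t u_r and into the row part
elsewhere, so the weight paid is the minimum. -/
lemma IsWeightPair.exists_kRel (h : IsWeightPair ν uc ur) {s t : ℝ} (hs : 0 < s) (ht : 0 < t)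
    (x : Ell2) : ∃ a b, ((a, b), x) ∈ kRel ν uc ur ∧
      s * ‖a‖ ^ 2 + t * ‖b‖ ^ 2 = kWeight ν uc ur s t * ‖x‖ ^ 2 := by
  let S : Set Ω := {ω | s * uc ω ≤ t * ur ω}
  have hS : MeasurableSet S :=
    measurableSet_le (h.measurable_c.const_mul s) (h.measurable_r.const_mul t)
  have hint := h.integrable_min_mul hs.le ht.le
  have hc : Integrable (S.indicator uc) ν := by
    have : S.indicator uc
        = S.indicator fun ω => s⁻¹ * min (s * uc ω) (t * ur ω) := by
      refine Set.indicator_congr fun ω hω => ?_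
      rw [min_eq_left hω, inv_mul_cancel_left₀ hs.ne']
    rw [this]
    exact (hint.const_mul _).indicator hS
  have hr : Integrable (Sᶜ.indicator ur) ν := by
    have : Sᶜ.indicator ur
        = Sᶜ.indicator fun ω => t⁻¹ * min (s * uc ω) (t * ur ω) := by
      refine Set.indicator_congr fun ω hω => ?_
      rw [min_eq_right (not_le.1 (show ¬ s * uc ω ≤ t * ur ω from hω)).le, inv_mul_cancel_left₀ ht.ne']
    rw [this]
    exact (hint.const_mul _).indicator hS.compl
  have hA := memLp_weighted_indicator_const hS hc x
  have hB := memLp_weighted_indicator_const hS.compl hr x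
  refine ⟨hA.toLp _, hB.toLp _, ⟨_, _, hA, hB, rfl, rfl, ae_of_all _ fun ω => ?_⟩, ?_⟩
  · by_cases hω : ω ∈ S <;> simp [hω]
  · obtain ⟨i1, e1⟩ := norm_toLp_weighted_sq h.measurable_c h.nonneg_c hA
    obtain ⟨i2, e2⟩ := norm_toLp_weighted_sq h.measurable_r h.nonneg_r hB
    rw [e1, e2, kWeight, ← integral_const_mul, ← integral_const_mul, ← integral_mul_const,
      ← integral_add (i1.const_mul s) (i2.const_mul t)]
    refine integral_congr_ae (ae_of_all _ fun ω => ?_)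
    by_cases hω : ω ∈ S
    · simp only [hω, Set.indicator_of_mem, Set.mem_compl_iff, not_true_eq_false, not_false_eq_true,
        Set.indicator_of_notMem]
      rw [min_eq_left hω]; simp; ring
    · simp only [hω, Set.indicator_of_mem, Set.mem_compl_iff, not_false_eq_true,
        Set.indicator_of_notMem]
      rw [min_eq_right (not_le.1 hω).le]; simp; ring

lemma IsWeightPair.kRel_surj (h : IsWeightPair ν uc ur) (x : Ell2) :
    ∃ p, (p, x) ∈ kRel ν uc ur := by
  obtain ⟨a, b, hab, -⟩ := h.exists_kRel one_pos one_pos x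
  exact ⟨_, hab⟩

/-- No splitting does better than the pointwise one by more than a factor 2, which comes from ‖f +
g‖² ≤ 2(‖f‖² + ‖g‖²). -/
lemma IsWeightPair.kWeight_mul_le (h : IsWeightPair ν uc ur) {s t : ℝ} (hs : 0 < s) (ht : 0 < t)
    {a b} {x : Ell2} (hab : ((a, b), x) ∈ kRel ν uc ur) :
    kWeight ν uc ur s t * ‖x‖ ^ 2 ≤ 2 * (s * ‖a‖ ^ 2 + t * ‖b‖ ^ 2) := by
  obtain ⟨f, g, hf, hg, h1, h2, hfg⟩ := hab
  obtain rfl : hf.toLp f = a := h1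
  obtain rfl : hg.toLp g = b := h2
  obtain ⟨i1, e1⟩ := norm_toLp_weighted_sq h.measurable_c h.nonneg_c hf
  obtain ⟨i2, e2⟩ := norm_toLp_weighted_sq h.measurable_r h.nonneg_r hg
  rw [e1, e2, kWeight, ← integral_const_mul, ← integral_const_mul, ← integral_mul_const,
    ← integral_add (i1.const_mul s) (i2.const_mul t), ← integral_const_mul]
  refine integral_mono_ae ((h.integrable_min_mul hs.le ht.le).mul_const _)
    (((i1.const_mul s).add (i2.const_mul t)).const_mul 2) ?_
  filter_upwards [hfg] with ω hω
  have h3 : ‖x‖ ≤ ‖f ω‖ + ‖g ω‖ := by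
    have : x = f ω + g ω := hω.symm
    rw [this]; exact norm_add_le _ _
  have h4 : ‖x‖ ^ 2 ≤ 2 * (‖f ω‖ ^ 2 + ‖g ω‖ ^ 2) := by
    nlinarith [norm_nonneg x, sq_nonneg (‖f ω‖ - ‖g ω‖)]
  have h5 := min_le_left (s * uc ω) (t * ur ω)
  have h6 := min_le_right (s * uc ω) (t * ur ω)
  have h7 : 0 ≤ min (s * uc ω) (t * ur ω) :=
    le_min (mul_nonneg hs.le (h.nonneg_c ω)) (mul_nonneg ht.le (h.nonneg_r ω))
  calc min (s * uc ω) (t * ur ω) * ‖x‖ ^ 2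
      ≤ min (s * uc ω) (t * ur ω) * (2 * (‖f ω‖ ^ 2 + ‖g ω‖ ^ 2)) := by gcongr
    _ = 2 * (min (s * uc ω) (t * ur ω) * ‖f ω‖ ^ 2 + min (s * uc ω) (t * ur ω) * ‖g ω‖ ^ 2) := by
        ring
    _ ≤ 2 * (s * uc ω * ‖f ω‖ ^ 2 + t * ur ω * ‖g ω‖ ^ 2) := by gcongr
    _ = _ := by ring

lemma IsWeightPair.represents_K (h : IsWeightPair ν uc ur) :
    Represents (K ν uc ur) (LinearEquiv.refl ℂ Ell2) (kWeight ν uc ur) 4 := by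
  rw [K_eq_relNorm]
  have := represents_relNorm (L := kRel ν uc ur) h.kRel_surj (k := kWeight ν uc ur) (A := 2)
    two_pos (fun s t x hs ht => ?_) fun s t x hs ht => ?_
  · norm_num at this; exact this
  · obtain ⟨a, b, hab, e⟩ := h.exists_kRel hs ht x
    have h1 := relForm_le hs.le ht.le hab
    rw [e] at h1
    linarith [relForm_nonneg (L := kRel ν uc ur) hs.le ht.le x]
  · have := le_relForm (L := kRel ν uc ur) (s := s) (t := t) (x := x)
      (r := kWeight ν uc ur s t * ‖x‖ ^ 2 / 2) h.kRel_surj fun a b hab => by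
        have := h.kWeight_mul_le hs ht hab
        linarith
    linarith

lemma IsWeightPair.kWeight_nonneg (h : IsWeightPair ν uc ur) {s t : ℝ} (hs : 0 ≤ s)
    (ht : 0 ≤ t) : 0 ≤ kWeight ν uc ur s t :=
  integral_nonneg fun ω => le_min (mul_nonneg hs (h.nonneg_c ω)) (mul_nonneg ht (h.nonneg_r ω))

lemma IsWeightPair.kWeight_mono (h : IsWeightPair ν uc ur) {s t s' t' : ℝ} (hs : 0 ≤ s)
    (ht : 0 ≤ t) (hss : s ≤ s') (htt : t ≤ t') : kWeight ν uc ur s t ≤ kWeight ν uc ur s' t' := by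
  refine integral_mono (h.integrable_min_mul hs ht)
    (h.integrable_min_mul (hs.trans hss) (ht.trans htt)) fun ω => ?_
  exact min_le_min (mul_le_mul_of_nonneg_right hss (h.nonneg_c ω))
    (mul_le_mul_of_nonneg_right htt (h.nonneg_r ω))

lemma kWeight_homog {c : ℝ} (hc : 0 ≤ c) (s t : ℝ) :
    kWeight ν uc ur (c * s) (c * t) = c * kWeight ν uc ur s t := by
  rw [kWeight, kWeight, ← integral_const_mul]
  congr 1
  ext ω
  rw [mul_min_of_nonneg _ _ hc, mul_assoc, mul_assoc]

lemma IsWeightPair.isKFun (h : IsWeightPair ν uc ur) (hpos : 0 < kWeight ν uc ur 1 1) :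
    IsKFun (kWeight ν uc ur) :=
  ⟨fun _ _ hs ht => h.kWeight_nonneg hs.le ht.le, fun _ _ _ hc _ _ => kWeight_homog hc.le _ _,
    fun _ _ _ _ hs ht => h.kWeight_mono hs.le ht.le, hpos⟩

/-- C is the quotient norm for the relation a = x with b free; its form is s‖x‖², attained at b = 0.
-/
lemma represents_C : Represents C (LinearEquiv.refl ℂ Ell2) (fun s _ => s) 2 := by
  let L : Submodule ℂ ((Ell2 × Ell2) × Ell2) :=
    LinearMap.eqLocus ((LinearMap.fst ℂ Ell2 Ell2).comp (LinearMap.fst ℂ (Ell2 × Ell2) Ell2))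
      (LinearMap.snd ℂ (Ell2 × Ell2) Ell2)
  have hmem : ∀ a b x, ((a, b), x) ∈ L ↔ a = x := fun a b x => Iff.rfl
  have hL : ∀ x, ∃ p, (p, x) ∈ L := fun x => ⟨(x, 0), rfl⟩
  have e : C = relNorm L := by
    funext n x
    refine le_antisymm (le_of_forall_gt fun r hr => ?_) ?_
    · obtain ⟨a, b, hab, ha, -⟩ := exists_lift_of_relNorm_lt hL hr
      obtain rfl : a = x := by ext1 i j; exact hab i j
      exact ha
    · refine (relNorm_le (L := L) (a := x) (b := 0) fun i j => rfl).trans (max_le le_rfl ?_)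
      rw [rowNorms_eq]
      exact (columnNorms_le _ le_rfl fun α => by simp [colSq]).trans (columnNorms_nonneg _ _)
  rw [e]
  have := represents_relNorm (L := L) hL (k := fun s _ => s) (A := 1) one_pos
    (fun s t x hs ht => ?_) fun s t x hs ht => ?_
  · simpa using this
  · have := relForm_le hs.le ht.le ((hmem x 0 x).2 rfl)
    simpa using this
  · rw [one_mul]
    refine le_relForm hL fun a b hab => ?_
    rw [(hmem a b x).1 hab]
    exact le_add_of_nonneg_right (by positivity)

lemma represents_R : Represents R (LinearEquiv.refl ℂ Ell2) (fun _ t => t) 2 := by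
  have : R = opNorms C := by
    funext n x
    exact rowNorms_eq n x
  rw [this]
  exact represents_C.op

lemma Represents.scaled_sq_le {E : Type*} [AddCommGroup E] [Module ℂ E] {N : MatrixNorms E}
    {T : E ≃ₗ[ℂ] Ell2} {k : ℝ → ℝ → ℝ} {C : ℝ} (h : Represents N T k C) {n : ℕ}
    {x : Matrix (Fin n) (Fin n) E} {lam R : ℝ} (hR : 0 ≤ R)
    (hx : ∀ W U φ ψ, Adm W U φ ψ → lam ^ 2 * kForm k W U φ ψ (x.map T) ≤ R) :
    (lam * N n x) ^ 2 ≤ C * R := by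
  have hC := h.pos
  rcases eq_or_ne lam 0 with rfl | hl
  · rw [zero_mul, zero_pow two_ne_zero]; positivity
  have hl2 : 0 < lam ^ 2 := by positivity
  have := h.upper n x (R / lam ^ 2) (by positivity) fun W U φ ψ hadm => by
    rw [le_div_iff₀ hl2, mul_comm]; exact hx W U φ ψ hadm
  rw [mul_pow]
  calc lam ^ 2 * N n x ^ 2 ≤ lam ^ 2 * (C * (R / lam ^ 2)) := by gcongr
    _ = C * R := by field_simp

/-- The intersection `lam C ∩ gam R ∩ K` is represented by `lam² s + gam² t + ∫ min`. -/
lemma IsWeightPair.represents_interCRK (h : IsWeightPair ν uc ur) {lam gam : ℝ} (hl : 0 ≤ lam)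
    (hg : 0 ≤ gam) : Represents (interCRK lam gam ν uc ur) (LinearEquiv.refl ℂ Ell2)
      (fun s t => lam ^ 2 * s + gam ^ 2 * t + kWeight ν uc ur s t) 8 := by
  have hK := h.represents_K
  have e : ∀ (n : ℕ) (x : Matrix (Fin n) (Fin n) Ell2) (W U) (φ ψ),
      kForm (fun s t => lam ^ 2 * s + gam ^ 2 * t + kWeight ν uc ur s t) W U φ ψ x
        = lam ^ 2 * kForm (fun s _ => s) W U φ ψ x + gam ^ 2 * kForm (fun _ t => t) W U φ ψ x
          + kForm (kWeight ν uc ur) W U φ ψ x := by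
    intro n x W U φ ψ
    simp only [kForm, Finset.mul_sum, ← Finset.sum_add_distrib]
    refine Finset.sum_congr rfl fun i _ => Finset.sum_congr rfl fun j _ => ?_
    ring
  have hn : ∀ {k : ℝ → ℝ → ℝ} (n : ℕ) (x : Matrix (Fin n) (Fin n) Ell2) (W U) (φ ψ),
      Adm W U φ ψ → (∀ s t, 0 < s → 0 < t → 0 ≤ k s t) → 0 ≤ kForm k W U φ ψ x :=
    fun n x W U φ ψ hadm hk => Finset.sum_nonneg fun i _ => Finset.sum_nonneg fun j _ =>
      mul_nonneg (hk _ _ (hadm.pos_c j) (hadm.pos_r i)) (by positivity)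
  have hnC := fun (n : ℕ) (x : Matrix (Fin n) (Fin n) Ell2) W U φ ψ (hadm : Adm W U φ ψ) =>
    mul_nonneg (sq_nonneg lam) (hn n x W U φ ψ hadm fun (s t : ℝ) (hs : 0 < s) (_ : 0 < t) => hs.le)
  have hnR := fun (n : ℕ) (x : Matrix (Fin n) (Fin n) Ell2) W U φ ψ (hadm : Adm W U φ ψ) =>
    mul_nonneg (sq_nonneg gam) (hn n x W U φ ψ hadm fun (s t : ℝ) (_ : 0 < s) (ht : 0 < t) => ht.le)
  have hnK := fun (n : ℕ) (x : Matrix (Fin n) (Fin n) Ell2) W U φ ψ (hadm : Adm W U φ ψ) =>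
    hn n x W U φ ψ hadm fun (s t : ℝ) (hs : 0 < s) (ht : 0 < t) => h.kWeight_nonneg hs.le ht.le
  refine ⟨by norm_num, fun n x => le_max_of_le_right (hK.nonneg n x), fun n x R' hR hx => ?_,
    fun n x W U φ ψ hadm => ?_⟩
  · have h1 : lam * C n x ≤ √(4 * R') := by
      refine Real.le_sqrt_of_sq_le (le_trans (represents_C.scaled_sq_le hR
        fun W U φ ψ hadm => ?_) (by linarith : 2 * R' ≤ 4 * R'))
      have := hx W U φ ψ hadm
      rw [e] at this
      linarith [hnR n (x.map (LinearEquiv.refl ℂ Ell2)) W U φ ψ hadm,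
        hnK n (x.map (LinearEquiv.refl ℂ Ell2)) W U φ ψ hadm]
    have h2 : gam * R n x ≤ √(4 * R') := by
      refine Real.le_sqrt_of_sq_le (le_trans (represents_R.scaled_sq_le hR
        fun W U φ ψ hadm => ?_) (by linarith : 2 * R' ≤ 4 * R'))
      have := hx W U φ ψ hadm
      rw [e] at this
      linarith [hnC n (x.map (LinearEquiv.refl ℂ Ell2)) W U φ ψ hadm,
        hnK n (x.map (LinearEquiv.refl ℂ Ell2)) W U φ ψ hadm]
    have h3 : K ν uc ur n x ≤ √(4 * R') := by
      refine Real.le_sqrt_of_sq_le (hK.upper n x R' hR fun W U φ ψ hadm => ?_)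
      have := hx W U φ ψ hadm
      rw [e] at this
      linarith [hnC n (x.map (LinearEquiv.refl ℂ Ell2)) W U φ ψ hadm,
        hnR n (x.map (LinearEquiv.refl ℂ Ell2)) W U φ ψ hadm]
    have h4 : interCRK lam gam ν uc ur n x ≤ √(4 * R') := max_le (max_le h1 h2) h3
    have h5 := pow_le_pow_left₀ (le_max_of_le_right (hK.nonneg n x)) h4 2
    rw [Real.sq_sqrt (by positivity)] at h5
    exact h5.trans (by linarith)
  · rw [e]
    have hC0 : 0 ≤ C n x := represents_C.nonneg n x
    have hR0 : 0 ≤ R n x := represents_R.nonneg n x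
    have h1 := mul_le_mul_of_nonneg_left (represents_C.lower n x W U φ ψ hadm) (sq_nonneg lam)
    have h2 := mul_le_mul_of_nonneg_left (represents_R.lower n x W U φ ψ hadm) (sq_nonneg gam)
    have h3 := hK.lower n x W U φ ψ hadm
    have m1 : lam * C n x ≤ interCRK lam gam ν uc ur n x :=
      (le_max_left _ _).trans (le_max_left _ _)
    have m2 : gam * R n x ≤ interCRK lam gam ν uc ur n x :=
      (le_max_right _ _).trans (le_max_left _ _)
    have m3 : K ν uc ur n x ≤ interCRK lam gam ν uc ur n x := le_max_right _ _
    have q1 := pow_le_pow_left₀ (mul_nonneg hl hC0) m1 2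
    have q2 := pow_le_pow_left₀ (mul_nonneg hg hR0) m2 2
    have q3 := pow_le_pow_left₀ (hK.nonneg n x) m3 2
    rw [mul_pow] at q1 q2
    linarith

/-- A bounded operator applied pointwise preserves the equation a + b = x and acts on both weighted
L₂ spaces. -/
lemma kRel_map_mem (u : Ell2 →L[ℂ] Ell2) {a b} {x : Ell2} (h : ((a, b), x) ∈ kRel ν uc ur) :
    ((u.compLpL 2 _ a, u.compLpL 2 _ b), u x) ∈ kRel ν uc ur := by
  obtain ⟨f, g, hf, hg, h1, h2, hfg⟩ := h
  obtain rfl : hf.toLp f = a := h1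
  obtain rfl : hg.toLp g = b := h2
  refine ⟨fun ω => u (f ω), fun ω => u (g ω), u.comp_memLp' hf, u.comp_memLp' hg, ?_, ?_, ?_⟩
  · apply Lp.ext
    refine (MemLp.coeFn_toLp _).trans ?_
    refine Filter.EventuallyEq.trans ?_ (u.coeFn_compLpL _).symm
    filter_upwards [hf.coeFn_toLp] with ω hω
    rw [hω]
  · apply Lp.ext
    refine (MemLp.coeFn_toLp _).trans ?_
    refine Filter.EventuallyEq.trans ?_ (u.coeFn_compLpL _).symm
    filter_upwards [hg.coeFn_toLp] with ω hω
    rw [hω]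
  · filter_upwards [hfg] with ω hω
    rw [← map_add, hω]

lemma IsWeightPair.exists_norm1_K_le (h : IsWeightPair ν uc ur) (hpos : 0 < kWeight ν uc ur 1 1) :
    ∃ A : ℝ, 0 < A ∧ ∀ x : Ell2, norm1 (K ν uc ur) x ≤ A * ‖x‖ ∧ ‖x‖ ≤ A * norm1 (K ν uc ur) x :=
  h.represents_K.exists_norm1_le (h.isKFun hpos)

lemma IsWeightPair.isHilbertIso_refl (h : IsWeightPair ν uc ur)
    (hpos : 0 < kWeight ν uc ur 1 1) : IsHilbertIso (K ν uc ur) (LinearEquiv.refl ℂ Ell2) := by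
  obtain ⟨A, -, hA⟩ := h.exists_norm1_K_le hpos
  exact ⟨A, hA⟩

lemma IsWeightPair.isHomogeneous_K (h : IsWeightPair ν uc ur)
    (hpos : 0 < kWeight ν uc ur 1 1) : ∃ κ, IsHomogeneousWith κ (K ν uc ur) := by
  obtain ⟨A, hA, hA'⟩ := h.exists_norm1_K_le hpos
  refine ⟨A * A, fun u B hB hu n x => ?_⟩
  have hb : ∀ x, ‖u x‖ ≤ A * A * B * ‖x‖ := by
    intro x
    calc ‖u x‖ ≤ A * norm1 (K ν uc ur) (u x) := (hA' _).2
      _ ≤ A * (B * (A * ‖x‖)) := by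
          gcongr
          exact (hu x).trans (by gcongr; exact (hA' x).1)
      _ = _ := by ring
  let v : Ell2 →L[ℂ] Ell2 := u.mkContinuous _ hb
  have hv : ‖v‖ ≤ A * A * B := u.mkContinuous_norm_le (by positivity) hb
  rw [K_eq_relNorm]
  refine relNorm_map_le h.kRel_surj (v.compLpL 2 (weighted ν uc)).toLinearMap
    (v.compLpL 2 (weighted ν ur)).toLinearMap u (B := A * A * B) (by positivity) (fun a => ?_) (fun b => ?_)
    (fun a b x hab => kRel_map_mem v hab) x
  · exact (v.norm_compLp_le a).trans (by gcongr)
  · exact (v.norm_compLp_le b).trans (by gcongr)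

lemma IsWeightPair.isOperatorSpace_K (h : IsWeightPair ν uc ur)
    (hpos : 0 < kWeight ν uc ur 1 1) : IsOperatorSpace (K ν uc ur) := by
  obtain ⟨A, hA, hA'⟩ := h.exists_norm1_K_le hpos
  rw [K_eq_relNorm] at *
  refine isOperatorSpace_relNorm h.kRel_surj (A := A) (fun x => (hA' x).1) (fun a b x hab => ?_) hA
  refine (hA' x).2.trans ?_
  gcongr
  exact relNorm_one_sq_le a b x hab

end Weighted

/-! ### Separable Hilbert spaces inside ℓ₂ -/

section Separable

variable {G : Type*} [NormedAddCommGroup G] [InnerProductSpace ℂ G]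

/-- Orthonormal vectors have mutual distance √2, so the balls of radius 1/2 around them are
disjoint. -/
lemma countable_of_orthonormal [TopologicalSpace.SeparableSpace G] {w : Set G}
    (hw : Orthonormal ℂ ((↑) : w → G)) : w.Countable := by
  refine Set.PairwiseDisjoint.countable_of_isOpen (s := fun x => Metric.ball x (1 / 2)) ?_
    (fun _ _ => Metric.isOpen_ball) fun _ _ => Metric.nonempty_ball.2 (by norm_num)
  intro x hx y hy hxy
  refine Metric.ball_disjoint_ball ?_
  have h0 : inner ℂ x y = (0 : ℂ) :=
    hw.2 (i := ⟨x, hx⟩) (j := ⟨y, hy⟩) fun h => hxy (congrArg Subtype.val h)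
  have h1 : ‖x‖ = 1 := hw.1 ⟨x, hx⟩
  have h2 : ‖y‖ = 1 := hw.1 ⟨y, hy⟩
  have h3 := norm_sub_sq (𝕜 := ℂ) x y
  rw [h0, h1, h2] at h3
  rw [dist_eq_norm]
  norm_num at h3 ⊢
  nlinarith [norm_nonneg (x - y)]

lemma exists_isometry_ell2 [CompleteSpace G] [TopologicalSpace.SeparableSpace G] :
    Nonempty (G →ₗᵢ[ℂ] Ell2) := by
  obtain ⟨w, b, hb⟩ := exists_hilbertBasis ℂ G
  have hw : w.Countable := countable_of_orthonormal (hb ▸ b.orthonormal)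
  have : Countable w := hw.to_subtype
  obtain ⟨e, he⟩ := exists_injective_nat w
  exact ⟨(orthonormal_stdVec.comp e he).orthogonalFamily.linearIsometry.comp
    b.repr.toLinearIsometry⟩

lemma exists_equiv_ell2 [CompleteSpace G] [TopologicalSpace.SeparableSpace G]
    (hG : ¬ FiniteDimensional ℂ G) : Nonempty (G ≃ₗᵢ[ℂ] Ell2) := by
  obtain ⟨w, b, hb⟩ := exists_hilbertBasis ℂ G
  have hw : w.Countable := countable_of_orthonormal (hb ▸ b.orthonormal)
  have : Countable w := hw.to_subtype
  have : Infinite w := by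
    by_contra hfin
    rw [not_infinite_iff_finite] at hfin
    apply hG
    have hd := b.dense_span
    have : FiniteDimensional ℂ (Submodule.span ℂ (Set.range b)) :=
      FiniteDimensional.span_of_finite ℂ (Set.finite_range b)
    rw [IsClosed.submodule_topologicalClosure_eq (Submodule.closed_of_finiteDimensional _)] at hd
    rw [hd] at this
    exact (LinearEquiv.finiteDimensional (Submodule.topEquiv : (⊤ : Submodule ℂ G) ≃ₗ[ℂ] G))
  obtain ⟨e⟩ : Nonempty (w ≃ ℕ) := nonempty_equiv_of_countable
  have ho : Orthonormal ℂ (b ∘ e.symm) := b.orthonormal.comp _ e.symm.injective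
  refine ⟨(HilbertBasis.mk ho ?_).repr⟩
  rw [e.symm.surjective.range_comp, b.dense_span]

end Separable

instance : TopologicalSpace.SeparableSpace Ell2 := by
  rw [← TopologicalSpace.isSeparable_univ_iff]
  let b : HilbertBasis ℕ ℂ Ell2 := default
  have h := (Set.countable_range b).isSeparable.span (R := ℂ) |>.closure
  have hd := b.dense_span
  have : closure (Submodule.span ℂ (Set.range b) : Set Ell2) = Set.univ := by
    rw [← Submodule.topologicalClosure_coe, hd, Submodule.top_coe]
  rwa [this] at h

/-! ### Making the quadratic forms scalar along the unit vector basis -/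

/-- Near-orthogonal subsequences for finitely many bounded operators. -/
lemma exists_almost_orthogonal {P : Type*} [Finite P] {G : Type*} [NormedAddCommGroup G]
    [InnerProductSpace ℂ G] [CompleteSpace G] (A : P → Ell2 →L[ℂ] G) (κ : P → ℝ)
    (hA : ∀ p, Filter.Tendsto (fun i => ‖A p (stdVec i)‖ ^ 2) (Filter.hyperfilter ℕ : Filter ℕ)
      (nhds (κ p))) (d : ℕ) {ε : ℝ} (hε : 0 < ε) :
    ∃ i : Fin d → ℕ, Function.Injective i ∧ (∀ p a, |‖A p (stdVec (i a))‖ ^ 2 - κ p| < ε) ∧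
      ∀ p a b, a ≠ b → ‖inner ℂ (A p (stdVec (i a))) (A p (stdVec (i b)))‖ < ε := by
  induction d with
  | zero => exact ⟨Fin.elim0, fun a => a.elim0, fun p a => a.elim0, fun p a => a.elim0⟩
  | succ d ih =>
    obtain ⟨i, hi, h1, h2⟩ := ih
    have hcof : (Filter.hyperfilter ℕ : Filter ℕ) ≤ Filter.cofinite := Filter.hyperfilter_le_cofinite
    have e1 : ∀ᶠ j in (Filter.hyperfilter ℕ : Filter ℕ), ∀ p, |‖A p (stdVec j)‖ ^ 2 - κ p| < ε := by
      rw [Filter.eventually_all]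
      intro p
      have := (Metric.tendsto_nhds.1 (hA p)) ε hε
      simpa only [Real.dist_eq] using this
    have e2 : ∀ᶠ j in (Filter.hyperfilter ℕ : Filter ℕ), ∀ a : Fin d, j ≠ i a := by
      rw [Filter.eventually_all]
      intro a
      exact hcof (Set.Finite.compl_mem_cofinite (Set.finite_singleton (i a)))
    have e3 : ∀ᶠ j in (Filter.hyperfilter ℕ : Filter ℕ), ∀ p, ∀ a : Fin d,
        ‖inner ℂ (A p (stdVec j)) (A p (stdVec (i a)))‖ < ε := by
      rw [Filter.eventually_all]
      intro p
      rw [Filter.eventually_all]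
      intro a
      apply hcof
      -- Through the adjoint the inner product becomes a coordinate of a fixed vector, and these
      -- tend to 0 by Bessel's inequality.
      have h3 := (orthonormal_stdVec.inner_products_summable
        (ContinuousLinearMap.adjoint (A p) (A p (stdVec (i a))))).tendsto_cofinite_zero
      filter_upwards [h3 (gt_mem_nhds (show (0 : ℝ) < ε ^ 2 by positivity))] with j hj
      rw [Set.mem_preimage, Set.mem_ofPred_eq, ContinuousLinearMap.adjoint_inner_right] at hj
      exact lt_of_pow_lt_pow_left₀ 2 hε.le hj
    obtain ⟨j, hj1, hj2, hj3⟩ := (e1.and (e2.and e3)).exists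
    refine ⟨Fin.cons j i, ?_, fun p a => ?_, fun p a b hab => ?_⟩
    · rw [Fin.cons_injective_iff]
      exact ⟨fun ⟨a, ha⟩ => hj2 a ha.symm, hi⟩
    · refine Fin.cases ?_ (fun a => ?_) a
      · simpa using hj1 p
      · simpa using h1 p a
    · revert hab
      refine Fin.cases ?_ (fun a => ?_) a <;> refine Fin.cases ?_ (fun b => ?_) b
      · intro h; exact absurd rfl h
      · intro _; simpa using hj3 p b
      · intro _
        rw [norm_inner_symm]
        simpa using hj3 p a
      · intro hab
        simpa using h2 p a b fun h => hab (congrArg Fin.succ h)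

/-- The Gram matrix of v differs from κ times the identity by entries of modulus at most ε, and (∑
‖c a‖)² ≤ d ∑ ‖c a‖². -/
lemma abs_norm_sum_sq_sub_le {G : Type*} [NormedAddCommGroup G] [InnerProductSpace ℂ G] {d : ℕ}
    (v : Fin d → G) {κ ε : ℝ} (hε : 0 ≤ ε) (h1 : ∀ a, |‖v a‖ ^ 2 - κ| ≤ ε)
    (h2 : ∀ a b, a ≠ b → ‖inner ℂ (v a) (v b)‖ ≤ ε) (c : Fin d → ℂ) :
    |‖∑ a, c a • v a‖ ^ 2 - κ * ∑ a, ‖c a‖ ^ 2| ≤ ε * d * ∑ a, ‖c a‖ ^ 2 := by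
  classical
  have e : ((‖∑ a, c a • v a‖ ^ 2 - κ * ∑ a, ‖c a‖ ^ 2 : ℝ) : ℂ)
      = ∑ a, ∑ b, (starRingEnd ℂ (c a) * c b) *
        (inner ℂ (v a) (v b) - if a = b then (κ : ℂ) else 0) := by
    have h3 := inner_self_eq_norm_sq_to_K (𝕜 := ℂ) (∑ a, c a • v a)
    push_cast
    rw [← Complex.coe_algebraMap] at *
    erw [← h3]
    simp only [sum_inner, inner_sum, inner_smul_left, inner_smul_right, mul_sub,
      Finset.sum_sub_distrib]
    congr 1
    · rw [Finset.sum_comm]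
      refine Finset.sum_congr rfl fun a _ => ?_
      rw [Finset.mul_sum]
      exact Finset.sum_congr rfl fun b _ => by ring
    · rw [Finset.mul_sum]
      refine Finset.sum_congr rfl fun a _ => ?_
      simp only [mul_ite, mul_zero, Finset.sum_ite_eq, Finset.mem_univ, if_true]
      rw [← Complex.normSq_eq_conj_mul_self, Complex.normSq_eq_norm_sq]
      push_cast
      simp only [Complex.coe_algebraMap]
      ring
  rw [← Real.norm_eq_abs, ← Complex.norm_real, e]
  calc _ ≤ ∑ a, ∑ b, ‖c a‖ * ‖c b‖ * ε := by
        refine (norm_sum_le _ _).trans (Finset.sum_le_sum fun a _ => (norm_sum_le _ _).trans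
          (Finset.sum_le_sum fun b _ => ?_))
        rw [norm_mul, norm_mul, RCLike.norm_conj]
        gcongr
        by_cases hab : a = b
        · subst hab
          rw [if_pos rfl, inner_self_eq_norm_sq_to_K]
          have := h1 a
          rw [← Real.norm_eq_abs, ← Complex.norm_real] at this
          push_cast at this
          exact this
        · rw [if_neg hab, sub_zero]; exact h2 a b hab
    _ = ε * (∑ a, ‖c a‖) ^ 2 := by
        rw [sq, Finset.sum_mul_sum, Finset.mul_sum]
        refine Finset.sum_congr rfl fun a _ => ?_
        rw [Finset.mul_sum]
        exact Finset.sum_congr rfl fun b _ => by ring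
    _ ≤ ε * (d * ∑ a, ‖c a‖ ^ 2) := by
        gcongr
        have := sq_sum_le_card_mul_sum_sq (s := Finset.univ) (f := fun a => ‖c a‖)
        simpa using this
    _ = _ := by ring

/-- A family of quadratic forms on `ℓ₂`, monotone and homogeneous in `(s, t)`, given by bounded
operators and normalised at `(1, 1)`. -/
structure IsFormFamily (q : ℝ → ℝ → Ell2 → ℝ) : Prop where
  exists_op : ∀ s t, 0 < s → 0 < t → ∃ A : Ell2 →L[ℂ] WithLp 2 (Ell2 × Ell2),
    ∀ x, q s t x = ‖A x‖ ^ 2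
  homog : ∀ c s t x, 0 < c → 0 < s → 0 < t → q (c * s) (c * t) x = c * q s t x
  mono : ∀ s t s' t' x, 0 < s → 0 < t → s ≤ s' → t ≤ t' → q s t x ≤ q s' t' x
  concave : ∀ s t x, 0 < s → 0 < t → 2 * q s t x + q s (4 * t) x ≤ 3 * q s (2 * t) x
  one : ∀ x, q 1 1 x = ‖x‖ ^ 2

variable {q : ℝ → ℝ → Ell2 → ℝ}

/-- Monotonicity and homogeneity reduce to (1, 1), where the form is normalised to ‖x‖². -/
lemma IsFormFamily.le_max (hq : IsFormFamily q) {s t : ℝ} (hs : 0 < s) (ht : 0 < t) (x : Ell2) :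
    q s t x ≤ max s t * ‖x‖ ^ 2 := by
  have h0 : 0 < max s t := lt_max_of_lt_left hs
  rw [← hq.one, ← hq.homog _ _ _ _ h0 one_pos one_pos, mul_one]
  exact hq.mono _ _ _ _ _ hs ht (le_max_left _ _) (le_max_right _ _)

lemma IsFormFamily.min_le (hq : IsFormFamily q) {s t : ℝ} (hs : 0 < s) (ht : 0 < t) (x : Ell2) :
    min s t * ‖x‖ ^ 2 ≤ q s t x := by
  have h0 : 0 < min s t := lt_min hs ht
  rw [← hq.one, ← hq.homog _ _ _ _ h0 one_pos one_pos, mul_one]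
  exact hq.mono _ _ _ _ _ h0 h0 (min_le_left _ _) (min_le_right _ _)

/-- Limits of the forms along the unit vector basis. -/
lemma IsFormFamily.exists_limit (hq : IsFormFamily q) : ∃ k : ℝ → ℝ → ℝ,
    (∀ s t, 0 < s → 0 < t → Filter.Tendsto (fun i => q s t (stdVec i))
      (Filter.hyperfilter ℕ : Filter ℕ) (nhds (k s t))) ∧
    IsKFun k ∧ k 1 1 = 1 ∧ (∀ s t, 0 < s → 0 < t → min s t ≤ k s t) ∧
    ∀ s t, 0 < s → 0 < t → 2 * k s t + k s (4 * t) ≤ 3 * k s (2 * t) := by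
  have hex : ∀ s t, ∃ l, 0 < s → 0 < t → Filter.Tendsto (fun i => q s t (stdVec i))
      (Filter.hyperfilter ℕ : Filter ℕ) (nhds l) := by
    intro s t
    by_cases h : 0 < s ∧ 0 < t
    · obtain ⟨hs, ht⟩ := h
      -- All values lie in a compact interval, so the ultrafilter limit exists for every (s, t)
      -- simultaneously, without extracting subsequences.
      have hmem : ∀ i, q s t (stdVec i) ∈ Set.Icc 0 (max s t) := fun i => by
        have h1 := hq.le_max hs ht (stdVec i)
        have h2 := hq.min_le hs ht (stdVec i)
        rw [norm_stdVec, one_pow, mul_one] at h1 h2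
        exact ⟨(lt_min hs ht).le.trans h2, h1⟩
      obtain ⟨l, -, hl⟩ := (isCompact_Icc (a := (0 : ℝ)) (b := max s t)).ultrafilter_le_nhds
        ((Filter.hyperfilter ℕ).map fun i => q s t (stdVec i))
        (Filter.le_principal_iff.2 (Filter.mem_map.2 (Filter.univ_mem' hmem)))
      exact ⟨l, fun _ _ => hl⟩
    · exact ⟨0, fun hs ht => absurd ⟨hs, ht⟩ h⟩
  choose k hk using hex
  have hmin : ∀ s t, 0 < s → 0 < t → min s t ≤ k s t := fun s t hs ht => by
    refine ge_of_tendsto' (hk s t hs ht) fun i => ?_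
    have h2 := hq.min_le hs ht (stdVec i)
    rwa [norm_stdVec, one_pow, mul_one] at h2
  have h11 : k 1 1 = 1 := by
    refine tendsto_nhds_unique (hk 1 1 one_pos one_pos) ?_
    simp only [hq.one, norm_stdVec, one_pow]
    exact tendsto_const_nhds
  refine ⟨k, hk, ⟨fun s t hs ht => (lt_min hs ht).le.trans (hmin s t hs ht),
    fun c s t hc hs ht => ?_, fun s t s' t' hs ht hss htt => ?_, by rw [h11]; exact one_pos⟩,
    h11, hmin, fun s t hs ht => ?_⟩
  · refine tendsto_nhds_unique (hk _ _ (mul_pos hc hs) (mul_pos hc ht)) ?_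
    simp only [hq.homog _ _ _ _ hc hs ht]
    exact (hk s t hs ht).const_mul c
  · exact le_of_tendsto_of_tendsto' (hk s t hs ht) (hk s' t' (hs.trans_le hss) (ht.trans_le htt))
      fun i => hq.mono _ _ _ _ _ hs ht hss htt
  · exact le_of_tendsto_of_tendsto'
      (((hk s t hs ht).const_mul 2).add (hk s (4 * t) hs (by positivity)))
      ((hk s (2 * t) hs (by positivity)).const_mul 3) fun i => hq.concave _ _ _ hs ht

lemma exists_dyadic {δ : ℝ} {P : ℕ} (hP : (1 / 2 : ℝ) ^ P < δ) {s : ℝ} (hs : δ ≤ s)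
    (hs1 : s ≤ 1) : ∃ p : Fin (P + 1), s ≤ (1 / 2 : ℝ) ^ (p : ℕ) ∧ (1 / 2 : ℝ) ^ (p : ℕ) ≤ 2 * s := by
  have h0 : 0 < s := lt_of_lt_of_le (lt_trans (by positivity) hP) hs
  obtain ⟨p, h1, h2⟩ := exists_nat_pow_near_of_lt_one h0 hs1 (y := (1 / 2 : ℝ)) (by norm_num)
    (by norm_num)
  have hp : p < P + 1 := by
    by_contra hlt
    push Not at hlt
    have : (1 / 2 : ℝ) ^ p ≤ (1 / 2) ^ P :=
      pow_le_pow_of_le_one (by norm_num) (by norm_num) (by omega)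
    linarith
  refine ⟨⟨p, hp⟩, h2, ?_⟩
  rw [pow_succ] at h1
  change (1 / 2 : ℝ) ^ p ≤ 2 * s
  linarith

/-- On a finite dimensional subspace some partial isometry makes all the forms scalar. -/
lemma IsFormFamily.exists_scalarizing (hq : IsFormFamily q) {k : ℝ → ℝ → ℝ}
    (hk : ∀ s t, 0 < s → 0 < t → Filter.Tendsto (fun i => q s t (stdVec i))
      (Filter.hyperfilter ℕ : Filter ℕ) (nhds (k s t)))
    (hkf : IsKFun k) (hmin : ∀ s t, 0 < s → 0 < t → min s t ≤ k s t)
    (X : Submodule ℂ Ell2) [FiniteDimensional ℂ X] {δ : ℝ} (hδ : 0 < δ) :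
    ∃ u u' : Ell2 →ₗ[ℂ] Ell2, (∀ y, ‖u y‖ ≤ ‖y‖) ∧ (∀ y, ‖u' y‖ ≤ ‖y‖) ∧
      (∀ y ∈ X, u' (u y) = y) ∧ ∀ s t, δ ≤ s → s ≤ 1 → δ ≤ t → t ≤ 1 → ∀ y ∈ X,
        q s t (u y) ≤ 4 * (k s t * ‖y‖ ^ 2) ∧ k s t * ‖y‖ ^ 2 ≤ 4 * q s t (u y) := by
  obtain ⟨P, hP⟩ := exists_pow_lt_of_lt_one hδ (show (1 / 2 : ℝ) < 1 by norm_num)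
  let g : Fin (P + 1) → ℝ := fun p => (1 / 2 : ℝ) ^ (p : ℕ)
  have hg : ∀ p, 0 < g p := fun p => by positivity
  have hgP : ∀ p, (1 / 2 : ℝ) ^ P ≤ g p := fun p =>
    pow_le_pow_of_le_one (by norm_num) (by norm_num) (Nat.lt_succ_iff.1 p.2)
  choose A hA using fun p : Fin (P + 1) × Fin (P + 1) => hq.exists_op _ _ (hg p.1) (hg p.2)
  set d := Module.finrank ℂ X with hd
  let b := stdOrthonormalBasis ℂ X
  -- On the grid k ≥ 2^(-P) = 2η, so an error η is at most half of k. Dividing η by d + 1 absorbs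
  -- the dimension factor of `abs_norm_sum_sq_sub_le`.
  set η : ℝ := (1 / 2) ^ P / 2 with hη
  have hη0 : 0 < η := by positivity
  have hε0 : 0 < η / (d + 1) := by positivity
  obtain ⟨i, hi, hi1, hi2⟩ := exists_almost_orthogonal A (fun p => k (g p.1) (g p.2))
    (fun p => by simpa only [hA] using hk _ _ (hg p.1) (hg p.2)) d hε0
  have hgrid : ∀ p r, ∀ c : Fin d → ℂ,
      |q (g p) (g r) (∑ a, c a • stdVec (i a)) - k (g p) (g r) * ∑ a, ‖c a‖ ^ 2|
        ≤ η * ∑ a, ‖c a‖ ^ 2 := by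
    intro p r c
    have h1 := abs_norm_sum_sq_sub_le (fun a => A (p, r) (stdVec (i a))) hε0.le
      (fun a => (hi1 (p, r) a).le) (fun a b hab => (hi2 (p, r) a b hab).le) c
    rw [hA (p, r)]
    simp only [map_sum, map_smul]
    refine h1.trans ?_
    gcongr
    rw [div_mul_eq_mul_div, div_le_iff₀ (by positivity)]
    gcongr
    linarith
  let bv : Fin d → Ell2 := fun a => (b a : Ell2)
  have hbv : Orthonormal ℂ bv := b.orthonormal.comp_linearIsometry X.subtypeₗᵢ
  let ev : Fin d → Ell2 := fun a => stdVec (i a)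
  have hev : Orthonormal ℂ ev := orthonormal_stdVec.comp i hi
  -- The partial isometry carrying the family v to the family w; u sends an orthonormal basis of `X`
  -- to the chosen unit vectors and u' brings it back.
  let tr : (Fin d → Ell2) → (Fin d → Ell2) → Ell2 →ₗ[ℂ] Ell2 := fun v w =>
    ∑ a, (innerSL ℂ (v a)).toLinearMap.smulRight (w a)
  have htr : ∀ v w y, tr v w y = ∑ a, inner ℂ (v a) y • w a := by
    intro v w y; simp [tr]
  have hnorm : ∀ {w : Fin d → Ell2}, Orthonormal ℂ w → ∀ c : Fin d → ℂ,
      ‖∑ a, c a • w a‖ ^ 2 = ∑ a, ‖c a‖ ^ 2 := by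
    intro w hw c
    have := norm_sum_stdVec_sq (i := fun a : Fin d => (a : ℕ)) Fin.val_injective c
    rw [← this]
    have h1 := hw.inner_sum c c Finset.univ
    have h2 := (orthonormal_stdVec.comp (fun a : Fin d => (a : ℕ)) Fin.val_injective).inner_sum c c
      Finset.univ
    have h3 : inner ℂ (∑ a, c a • w a) (∑ a, c a • w a)
      = inner ℂ (∑ a : Fin d, c a • stdVec a) (∑ a : Fin d, c a • stdVec a) := h1.trans h2.symm
    rw [inner_self_eq_norm_sq_to_K, inner_self_eq_norm_sq_to_K] at h3
    exact_mod_cast h3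
  have hcontr : ∀ {v w : Fin d → Ell2}, Orthonormal ℂ v → Orthonormal ℂ w → ∀ y,
      ‖tr v w y‖ ≤ ‖y‖ := by
    intro v w hv hw y
    refine le_of_sq_le_sq ?_ (norm_nonneg _)
    rw [htr, hnorm hw]
    exact hv.sum_inner_products_le y
  have hX : ∀ y ∈ X, ∑ a, inner ℂ (bv a) y • bv a = y := by
    intro y hy
    have := congrArg Subtype.val (b.sum_repr' ⟨y, hy⟩)
    simpa [bv] using this
  refine ⟨tr bv ev, tr ev bv, hcontr hbv hev, hcontr hev hbv, fun y hy => ?_, ?_⟩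
  · rw [htr bv, htr]
    have : ∀ a, inner ℂ (ev a) (∑ a', inner ℂ (bv a') y • ev a') = inner ℂ (bv a) y :=
      fun a => hev.inner_right_fintype _ a
    simp only [this]
    exact hX y hy
  · intro s t hs hs1 ht ht1 y hy
    have hs0 : 0 < s := hδ.trans_le hs
    have ht0 : 0 < t := hδ.trans_le ht
    obtain ⟨p, hp1, hp2⟩ := exists_dyadic hP hs hs1
    obtain ⟨r, hr1, hr2⟩ := exists_dyadic hP ht ht1
    change s ≤ g p at hp1
    change g p ≤ 2 * s at hp2
    change t ≤ g r at hr1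
    change g r ≤ 2 * t at hr2
    have hy2 : ∑ a, ‖inner ℂ (bv a) y‖ ^ 2 = ‖y‖ ^ 2 := by
      rw [← hnorm hbv, hX y hy]
    have h1 := abs_le.1 (hgrid p r fun a => inner ℂ (bv a) y)
    rw [hy2] at h1
    have hu : tr bv ev y = ∑ a, inner ℂ (bv a) y • stdVec (i a) := htr _ _ _
    rw [← hu] at h1
    set z := tr bv ev y with hz
    have hkη : 2 * η ≤ k (g p) (g r) := by
      refine le_trans ?_ (hmin _ _ (hg p) (hg r))
      rw [hη]
      have := le_min (hgP p) (hgP r)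
      linarith
    have hY : 0 ≤ ‖y‖ ^ 2 := by positivity
    have hηY := mul_le_mul_of_nonneg_right hkη hY
    have q1 := hq.mono _ _ _ _ z hs0 ht0 hp1 hr1
    have q2 : q (g p) (g r) z ≤ 2 * q s t z := by
      rw [← hq.homog _ _ _ _ two_pos hs0 ht0]
      exact hq.mono _ _ _ _ z (hg p) (hg r) hp2 hr2
    have k1 := mul_le_mul_of_nonneg_right (hkf.mono _ _ _ _ hs0 ht0 hp1 hr1) hY
    have k2 : k (g p) (g r) * ‖y‖ ^ 2 ≤ 2 * k s t * ‖y‖ ^ 2 := by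
      rw [← hkf.homog _ _ _ two_pos hs0 ht0]
      exact mul_le_mul_of_nonneg_right (hkf.mono _ _ _ _ (hg p) (hg r) hp2 hr2) hY
    -- Rounding to the grid costs a factor 2, and the error on the grid a factor 3/2 in one
    -- direction and 2 in the other.
    constructor <;> nlinarith

/-! ### Subquotients of C ⊕ R as normalised families of forms -/

/-- The square of the norm of the component orthogonal to a subspace is an infimum. -/
lemma orthogonal_component_le {G : Type*} [NormedAddCommGroup G] [InnerProductSpace ℂ G]
    [CompleteSpace G] (D : Submodule ℂ G) (x : G) {z : G} (hz : z ∈ D) :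
    ‖(D.topologicalClosure)ᗮ.starProjection x‖ ≤ ‖x + z‖ := by
  have h : (D.topologicalClosure)ᗮ.starProjection (x + z)
      = (D.topologicalClosure)ᗮ.starProjection x := by
    rw [map_add, Submodule.starProjection_orthogonal_apply_eq_zero
      (D.le_topologicalClosure hz), add_zero]
  rw [← h]
  exact Submodule.norm_starProjection_apply_le _ _

/-- Complements `orthogonal_component_le`: `D` is not assumed closed, so the distance is only
approached. -/
lemma exists_near_orthogonal_component {G : Type*} [NormedAddCommGroup G] [InnerProductSpace ℂ G]
    [CompleteSpace G] (D : Submodule ℂ G) (x : G) {ε : ℝ} (hε : 0 < ε) :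
    ∃ z ∈ D, ‖x + z‖ < ‖(D.topologicalClosure)ᗮ.starProjection x‖ + ε := by
  have hmem : -(D.topologicalClosure.starProjection x) ∈ closure (D : Set G) := by
    rw [← Submodule.topologicalClosure_coe]
    exact neg_mem (Submodule.starProjection_apply_mem _ _)
  obtain ⟨z, hz, hd⟩ := Metric.mem_closure_iff.1 hmem ε hε
  refine ⟨z, hz, ?_⟩
  have e : x + z = (D.topologicalClosure)ᗮ.starProjection x
      + (z - -(D.topologicalClosure.starProjection x)) := by
    rw [Submodule.starProjection_orthogonal']
    simp
  rw [e]
  refine (norm_add_le _ _).trans_lt ?_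
  rw [dist_comm, dist_eq_norm] at hd
  linarith

/-- The Hilbert space sum of two copies of `ℓ₂`. -/
abbrev HilbSum : Type := WithLp 2 (Ell2 × Ell2)

/-- The identity from the Hilbert sum to the product. -/
def toProd : HilbSum ≃L[ℂ] Ell2 × Ell2 := WithLp.prodContinuousLinearEquiv 2 ℂ Ell2 Ell2

lemma norm_sq_hilbSum (z : HilbSum) : ‖z‖ ^ 2 = ‖(toProd z).1‖ ^ 2 + ‖(toProd z).2‖ ^ 2 :=
  WithLp.prod_norm_sq_eq_of_L2 z

/-- The dilation `(a, b) ↦ (√s a, √t b)`. -/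
def dil (s t : ℝ) : HilbSum →L[ℂ] HilbSum :=
  (toProd.symm : Ell2 × Ell2 →L[ℂ] HilbSum).comp
    ((((√s : ℂ) • ContinuousLinearMap.id ℂ Ell2).prodMap
      ((√t : ℂ) • ContinuousLinearMap.id ℂ Ell2)).comp (toProd : HilbSum →L[ℂ] Ell2 × Ell2))

lemma norm_dil_sq {s t : ℝ} (hs : 0 ≤ s) (ht : 0 ≤ t) (z : HilbSum) :
    ‖dil s t z‖ ^ 2 = s * ‖(toProd z).1‖ ^ 2 + t * ‖(toProd z).2‖ ^ 2 := by
  have h1 : (toProd (dil s t z)).1 = (√s : ℂ) • (toProd z).1 := rfl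
  have h2 : (toProd (dil s t z)).2 = (√t : ℂ) • (toProd z).2 := rfl
  rw [norm_sq_hilbSum, h1, h2, norm_smul, norm_smul, mul_pow, mul_pow, Complex.norm_real,
    Complex.norm_real, Real.norm_eq_abs, Real.norm_eq_abs, sq_abs, sq_abs, Real.sq_sqrt hs,
    Real.sq_sqrt ht]

/-- The relation attached to a subspace `S` and an isometry `τ` onto a space orthogonal to `S`. -/
def quotRel (S : Submodule ℂ (Ell2 × Ell2)) (τ : Ell2 →ₗᵢ[ℂ] HilbSum) :
    Submodule ℂ ((Ell2 × Ell2) × Ell2) :=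
  S.comap (LinearMap.fst ℂ (Ell2 × Ell2) Ell2
    - (toProd.toLinearMap.comp τ.toLinearMap).comp (LinearMap.snd ℂ (Ell2 × Ell2) Ell2))

variable {S : Submodule ℂ (Ell2 × Ell2)} {τ : Ell2 →ₗᵢ[ℂ] HilbSum}

lemma mem_quotRel {p : Ell2 × Ell2} {x : Ell2} :
    (p, x) ∈ quotRel S τ ↔ p - toProd (τ x) ∈ S := Iff.rfl

lemma quotRel_surj (x : Ell2) : ∃ p, (p, x) ∈ quotRel S τ :=
  ⟨toProd (τ x), by rw [mem_quotRel, sub_self]; exact S.zero_mem⟩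

/-- After the dilation `dil s t` the form is a squared distance to a subspace, hence the squared
norm of an orthogonal projection. Concavity holds because the form is an infimum of functions affine
in (s, t), and 2t = (2/3)t + (1/3)4t. Orthogonality of the range of τ to `S` gives the value ‖x‖² at
(1, 1). -/
lemma isFormFamily_quotRel (hτ : ∀ x, ∀ z : HilbSum, toProd z ∈ S → inner ℂ (τ x) z = 0) :
    IsFormFamily (relForm (quotRel S τ)) := by
  have hL := quotRel_surj (S := S) (τ := τ)
  refine ⟨fun s t hs ht => ?_, fun c s t x hc hs ht => ?_, fun s t s' t' x hs ht hss htt => ?_,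
    fun s t x hs ht => ?_, fun x => ?_⟩
  · let D : Submodule ℂ HilbSum :=
      (S.comap (toProd : HilbSum →ₗ[ℂ] Ell2 × Ell2)).map (dil s t : HilbSum →ₗ[ℂ] HilbSum)
    refine ⟨((D.topologicalClosure)ᗮ.starProjection).comp
      ((dil s t).comp τ.toContinuousLinearMap), fun x => le_antisymm ?_ ?_⟩
    · refine le_of_forall_pos_le_add fun ε hε => ?_
      set P := ‖(D.topologicalClosure)ᗮ.starProjection (dil s t (τ x))‖ with hP
      have hP0 : 0 ≤ P := norm_nonneg _
      have hcont : Filter.Tendsto (fun r : ℝ => (P + r) ^ 2) (nhdsWithin 0 (Set.Ioi 0))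
          (nhds ((P + 0) ^ 2)) :=
        ((by fun_prop : Continuous fun r : ℝ => (P + r) ^ 2).tendsto 0).mono_left nhdsWithin_le_nhds
      have key : ∀ r : ℝ, 0 < r → relForm (quotRel S τ) s t x ≤ (P + r) ^ 2 := by
        intro r hr
        obtain ⟨z, ⟨σ, hσ, rfl⟩, hz⟩ := exists_near_orthogonal_component D (dil s t (τ x)) hr
        have hmem : (toProd (τ x + σ), x) ∈ quotRel S τ := by
          rw [mem_quotRel, map_add, add_sub_cancel_left]; exact hσ
        have h1 := relForm_le hs.le ht.le (a := (toProd (τ x + σ)).1) (b := (toProd (τ x + σ)).2)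
          (x := x) hmem
        rw [← norm_dil_sq hs.le ht.le, map_add] at h1
        exact h1.trans (pow_le_pow_left₀ (norm_nonneg _) hz.le 2)
      have h2 := ge_of_tendsto hcont (Filter.eventually_of_mem self_mem_nhdsWithin key)
      rw [add_zero] at h2
      exact h2.trans (le_add_of_nonneg_right hε.le)
    · refine le_relForm hL fun a b hab => ?_
      let σ : HilbSum := toProd.symm ((a, b) - toProd (τ x))
      have hσ : toProd σ ∈ S := by
        simp only [σ, ContinuousLinearEquiv.apply_symm_apply]; exact hab
      have e : toProd (τ x + σ) = (a, b) := by
        rw [map_add]; simp [σ]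
      have h1 := orthogonal_component_le D (dil s t (τ x)) (z := dil s t σ) ⟨σ, hσ, rfl⟩
      have h2 := pow_le_pow_left₀ (norm_nonneg _) h1 2
      rw [← map_add, norm_dil_sq hs.le ht.le, e] at h2
      exact h2
  · refine le_antisymm ?_ ?_
    · rw [← div_le_iff₀' hc]
      refine le_relForm hL fun a b hab => ?_
      rw [div_le_iff₀' hc]
      refine (relForm_le (mul_pos hc hs).le (mul_pos hc ht).le hab).trans (le_of_eq (by ring))
    · refine le_relForm hL fun a b hab => ?_
      have := mul_le_mul_of_nonneg_left (relForm_le hs.le ht.le hab) hc.le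
      linarith
  · refine le_relForm hL fun a b hab => (relForm_le hs.le ht.le hab).trans ?_
    gcongr
  · have h4 : 0 ≤ 4 * t := by positivity
    have : (2 * relForm (quotRel S τ) s t x + relForm (quotRel S τ) s (4 * t) x) / 3
        ≤ relForm (quotRel S τ) s (2 * t) x := by
      refine le_relForm hL fun a b hab => ?_
      have h1 := relForm_le hs.le ht.le hab
      have h2 := relForm_le hs.le h4 hab
      linarith
    linarith
  · have e : ∀ z : HilbSum, ‖z‖ ^ 2 = 1 * ‖(toProd z).1‖ ^ 2 + 1 * ‖(toProd z).2‖ ^ 2 := fun z => by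
      rw [one_mul, one_mul, norm_sq_hilbSum]
    refine le_antisymm ?_ (le_relForm hL fun a b hab => ?_)
    · have hmem : (toProd (τ x), x) ∈ quotRel S τ := by
        rw [mem_quotRel, sub_self]; exact S.zero_mem
      have := relForm_le zero_le_one zero_le_one (a := (toProd (τ x)).1) (b := (toProd (τ x)).2)
          (x := x) hmem
      rwa [← e, τ.norm_map] at this
    · let σ : HilbSum := toProd.symm ((a, b) - toProd (τ x))
      have hσ : toProd σ ∈ S := by
        simp only [σ, ContinuousLinearEquiv.apply_symm_apply]; exact hab
      have e2 : toProd (τ x + σ) = (a, b) := by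
        rw [map_add]; simp [σ]
      have h1 := e (τ x + σ)
      rw [e2] at h1
      rw [← h1, ← τ.norm_map x, norm_add_sq (𝕜 := ℂ), hτ x σ hσ]
      simp

/-- A subquotient of `C ⊕ R` of infinite dimension is given by a normalised form family. -/
lemma exists_quotRel {E : Type*} [AddCommGroup E] [Module ℂ E] {N : MatrixNorms E} {M : ℝ}
    (h : IsQSWith M N) (hE : ¬ FiniteDimensional ℂ E) :
    ∃ (L : Submodule ℂ ((Ell2 × Ell2) × Ell2)) (T : E ≃ₗ[ℂ] Ell2), (∀ x, ∃ p, (p, x) ∈ L) ∧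
      IsFormFamily (relForm L) ∧ ∀ (n : ℕ) (x : Matrix (Fin n) (Fin n) E),
        relNorm L n (x.map T) ≤ M * N n x ∧ N n x ≤ M * relNorm L n (x.map T) := by
  obtain ⟨V, S, hV, hS, hSV, T₁, hT₁⟩ := h
  let V' : Submodule ℂ HilbSum := V.comap (toProd : HilbSum →ₗ[ℂ] Ell2 × Ell2)
  let S' : Submodule ℂ HilbSum := S.comap (toProd : HilbSum →ₗ[ℂ] Ell2 × Ell2)
  have hV' : IsClosed (V' : Set HilbSum) := hV.preimage toProd.continuous
  have hS' : IsClosed (S' : Set HilbSum) := hS.preimage toProd.continuous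
  have : CompleteSpace S' := hS'.completeSpace_coe
  -- The Hilbert space complement of S in V is a copy of V / S; being infinite dimensional and
  -- separable, it is isometric to ℓ₂.
  let G : Submodule ℂ HilbSum := V' ⊓ S'ᗮ
  have hG : IsClosed (G : Set HilbSum) := hV'.inter (Submodule.isClosed_orthogonal S')
  have : CompleteSpace G := hG.completeSpace_coe
  let π : G →ₗ[ℂ] (V ⧸ S.submoduleOf V) := (S.submoduleOf V).mkQ.comp
    ((((toProd : HilbSum →ₗ[ℂ] Ell2 × Ell2).comp G.subtype)).codRestrict V fun g => g.2.1)
  have hπ : ∀ g : G, π g = Submodule.Quotient.mk ⟨toProd (g : HilbSum), g.2.1⟩ := fun g => rfl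
  have hπinj : Function.Injective π := by
    rw [← LinearMap.ker_eq_bot, LinearMap.ker_eq_bot']
    intro g hg
    rw [hπ, Submodule.Quotient.mk_eq_zero] at hg
    have h1 : (g : HilbSum) ∈ S' := hg
    have h2 : (g : HilbSum) ∈ S'ᗮ := g.2.2
    have h3 := h2 _ h1
    exact Subtype.ext (inner_self_eq_zero.1 h3)
  have hπsurj : Function.Surjective π := by
    intro y
    obtain ⟨v, rfl⟩ := Submodule.Quotient.mk_surjective _ y
    let v' : HilbSum := toProd.symm v
    have hv' : toProd v' = v := toProd.apply_symm_apply _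
    have hP : S'.starProjection v' ∈ S' := Submodule.starProjection_apply_mem _ _
    have hPV : S'.starProjection v' ∈ V' := hSV hP
    have hvV : v' ∈ V' := by
      change toProd v' ∈ V
      rw [hv']; exact v.2
    refine ⟨⟨v' - S'.starProjection v', V'.sub_mem hvV hPV,
      Submodule.sub_starProjection_mem_orthogonal _⟩, ?_⟩
    rw [hπ, Submodule.Quotient.eq]
    change toProd (v' - S'.starProjection v') - (v : Ell2 × Ell2) ∈ S
    rw [map_sub, hv', sub_sub_cancel_left]
    exact S.neg_mem hP
  let πe : G ≃ₗ[ℂ] (V ⧸ S.submoduleOf V) := LinearEquiv.ofBijective π ⟨hπinj, hπsurj⟩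
  have hGinf : ¬ FiniteDimensional ℂ G := fun hfin =>
    hE (LinearEquiv.finiteDimensional (πe.trans T₁.symm))
  have : TopologicalSpace.SeparableSpace HilbSum :=
    toProd.symm.surjective.denseRange.separableSpace toProd.symm.continuous
  have : SecondCountableTopology HilbSum := UniformSpace.secondCountable_of_separable _
  obtain ⟨θ⟩ := exists_equiv_ell2 hGinf
  let τ : Ell2 →ₗᵢ[ℂ] HilbSum := G.subtypeₗᵢ.comp θ.symm.toLinearIsometry
  let ρ : Ell2 ≃ₗ[ℂ] (V ⧸ S.submoduleOf V) := θ.symm.toLinearEquiv.trans πe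
  have hρ : ∀ x, ∃ hx, ρ x = Submodule.Quotient.mk ⟨toProd (τ x), hx⟩ :=
    fun x => ⟨(θ.symm x).2.1, rfl⟩
  have hsub : ∀ n (x : Matrix (Fin n) (Fin n) Ell2),
      subquotientNorms CsumR V S n (x.map ρ) = relNorm (quotRel S τ) n x := by
    intro n x
    unfold subquotientNorms relNorm
    congr 1
    ext t
    constructor
    · rintro ⟨y, hy, rfl⟩
      refine ⟨y.map fun v => (v : Ell2 × Ell2).1, y.map fun v => (v : Ell2 × Ell2).2,
        fun i j => ?_, rfl⟩
      have h1 : (Submodule.Quotient.mk (y i j) : V ⧸ S.submoduleOf V) = ρ (x i j) :=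
        congrFun (congrFun hy i) j
      obtain ⟨hx, h2⟩ := hρ (x i j)
      rw [h2, Submodule.Quotient.eq] at h1
      exact h1
    · rintro ⟨a, b, hab, rfl⟩
      have hm : ∀ i j, (a i j, b i j) ∈ V := by
        intro i j
        obtain ⟨hx, -⟩ := hρ (x i j)
        have h1 := V.add_mem (hSV (mem_quotRel.1 (hab i j))) hx
        rwa [sub_add_cancel] at h1
      refine ⟨fun i j => ⟨(a i j, b i j), hm i j⟩, ?_, rfl⟩
      ext1 i j
      obtain ⟨hx, h2⟩ := hρ (x i j)
      change Submodule.Quotient.mk _ = ρ (x i j)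
      rw [h2, Submodule.Quotient.eq]
      exact hab i j
  refine ⟨quotRel S τ, T₁.trans ρ.symm, quotRel_surj, isFormFamily_quotRel fun x z hz => ?_,
    fun n x => ?_⟩
  · rw [inner_eq_zero_symm]
    exact (θ.symm x).2.2 z hz
  · have e : (x.map (T₁.trans ρ.symm)).map ρ = x.map T₁ := by
      ext1 i j; simp
    rw [← hsub, e]
    exact hT₁ n x

/-! ### Homogeneous subquotients are represented by a single function -/

/-- The constant of the representation of homogeneous subquotients. -/
def reprConst (κ M : ℝ) : ℝ := 8 * (M ^ 2 * (κ * (2 * M ^ 2)) ^ 2) + 1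

/-- Every infinite dimensional homogeneous subquotient of `C ⊕ R` is represented by a concave
function. -/
theorem IsHQSWith.exists_represents {E : Type*} [AddCommGroup E] [Module ℂ E] {N : MatrixNorms E}
    {κ M : ℝ} (h : IsHQSWith κ M N) (hE : ¬ FiniteDimensional ℂ E) :
    ∃ (T : E ≃ₗ[ℂ] Ell2) (k : ℝ → ℝ → ℝ), IsKFun k ∧ k 1 1 = 1 ∧
      (∀ s t, 0 < s → 0 < t → min s t ≤ k s t) ∧
      (∀ s t, 0 < s → 0 < t → 2 * k s t + k s (4 * t) ≤ 3 * k s (2 * t)) ∧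
      Represents N T k (reprConst κ M) := by
  obtain ⟨L, T, hL, hq, hT⟩ := exists_quotRel h.subquotient hE
  obtain ⟨k, hlim, hk, h11, hmin, hconc⟩ := hq.exists_limit
  have hN := h.isOperatorSpace.nonneg
  set K₁ := κ * (2 * M ^ 2) with hK₁
  -- The quotient norm at level 1 is built from the maximum of ‖a‖ and ‖b‖, the Hilbert norm from
  -- their ℓ₂-sum.
  have hone : ∀ y : Ell2, norm1 (relNorm L) y ≤ ‖y‖ ∧ ‖y‖ ≤ 2 * norm1 (relNorm L) y := by
    intro y
    constructor
    · refine le_of_forall_pos_lt_add fun ε hε => ?_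
      have h1 : relForm L 1 1 y < (‖y‖ + ε) ^ 2 := by
        rw [hq.one]; gcongr; linarith
      obtain ⟨a, b, hab, h2⟩ := exists_relForm_lt hL h1
      refine (relNorm_one_sq_le a b y hab).trans_lt (max_lt ?_ ?_)
      · refine lt_of_pow_lt_pow_left₀ 2 (by positivity) (lt_of_le_of_lt ?_ h2)
        have := sq_nonneg ‖b‖
        linarith
      · refine lt_of_pow_lt_pow_left₀ 2 (by positivity) (lt_of_le_of_lt ?_ h2)
        have := sq_nonneg ‖a‖
        linarith
    · refine le_of_forall_pos_lt_add fun ε hε => ?_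
      obtain ⟨a, b, hab, ha, hb⟩ := exists_lift_of_relNorm_lt hL
        (x := fun _ _ : Fin 1 => y) (lt_add_of_pos_right _ (half_pos hε))
      have ha' := (norm_entry_le_columnNorms a 0 0).trans_lt ha
      have hb' := (norm_entry_le_rowNorms b 0 0).trans_lt hb
      have h1 := relForm_le zero_le_one zero_le_one (hab 0 0)
      rw [hq.one] at h1
      change ‖a 0 0‖ < norm1 (relNorm L) y + ε / 2 at ha'
      change ‖b 0 0‖ < norm1 (relNorm L) y + ε / 2 at hb'
      have h2 : ‖y‖ ≤ ‖a 0 0‖ + ‖b 0 0‖ := by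
        refine le_of_sq_le_sq ?_ (by positivity)
        nlinarith [norm_nonneg (a 0 0), norm_nonneg (b 0 0)]
      linarith
  have hM0 : 0 ≤ M := by
    by_contra hM
    push Not at hM
    obtain ⟨x, hx⟩ : ∃ x : E, x ≠ 0 := by
      by_contra hx
      push Not at hx
      have : Subsingleton E := ⟨fun a b => by rw [hx a, hx b]⟩
      exact hE inferInstance
    have h1 := (hT 1 (fun _ _ => x)).2
    have h2 := hN 1 (fun _ _ => x)
    have h3 := relNorm_nonneg (L := L) 1 (Matrix.map (fun _ _ => x) T)
    have h4 : N 1 (fun _ _ => x) = 0 := le_antisymm (h1.trans (by nlinarith)) h2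
    have h5 := (h.isOperatorSpace.eq_zero_iff _ _).1 h4
    exact hx (congrFun (congrFun h5 0) 0)
  -- The only use of homogeneity: a contraction of ℓ₂ becomes a map of norm at most 2M² on E, hence
  -- of cb norm at most κ · 2M².
  have hcontr : ∀ u : Ell2 →ₗ[ℂ] Ell2, (∀ y, ‖u y‖ ≤ ‖y‖) → ∀ n (x : Matrix (Fin n) (Fin n) E),
      N n (x.map fun z => T.symm (u (T z))) ≤ K₁ * N n x := by
    intro u hu n x
    let v : E →ₗ[ℂ] E := T.symm.toLinearMap.comp (u.comp T.toLinearMap)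
    refine h.homogeneous v (2 * M ^ 2) (by positivity) (fun z => ?_) n x
    have h1 : norm1 N (v z) ≤ M * norm1 (relNorm L) (u (T z)) := by
      have := (hT 1 (fun _ _ => v z)).2
      have e : Matrix.map (fun _ _ : Fin 1 => v z) T = fun _ _ => u (T z) := by
        ext1 i j
        exact T.apply_symm_apply _
      rw [e] at this
      exact this
    have h2 : norm1 (relNorm L) (T z) ≤ M * norm1 N z := (hT 1 (fun _ _ => z)).1
    calc norm1 N (v z) ≤ M * norm1 (relNorm L) (u (T z)) := h1
      _ ≤ M * (2 * (M * norm1 N z)) := by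
          gcongr
          exact (hone _).1.trans ((hu _).trans ((hone _).2.trans (by gcongr)))
      _ = _ := by ring
  have hentry : ∀ {n : ℕ} (y : Matrix (Fin n) (Fin n) Ell2) (W U : Matrix (Fin n) (Fin n) ℂ) i j,
      bimul W y U i j ∈ Submodule.span ℂ (Set.range fun p : Fin n × Fin n => y p.1 p.2) := by
    intro n y W U i j
    exact Submodule.sum_mem _ fun a _ => Submodule.sum_mem _ fun b _ =>
      Submodule.smul_mem _ _ (Submodule.subset_span ⟨(a, b), rfl⟩)
  have hyent : ∀ {n : ℕ} (y : Matrix (Fin n) (Fin n) Ell2) i j,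
      y i j ∈ Submodule.span ℂ (Set.range fun p : Fin n × Fin n => y p.1 p.2) :=
    fun y i j => Submodule.subset_span ⟨(i, j), rfl⟩
  have hrev : ∀ {n : ℕ} (x : Matrix (Fin n) (Fin n) E) (u : Ell2 →ₗ[ℂ] Ell2),
      (x.map fun z => T.symm (u (T z))).map T = (x.map T).map u := by
    intro n x u
    ext1 i j; simp
  refine ⟨T, k, hk, h11, hmin, hconc, ⟨by unfold reprConst; positivity, hN, fun n x R hR hx => ?_,
    fun n x W U φ ψ hadm => ?_⟩⟩
  · have hle : N n x ^ 2 ≤ 8 * (M ^ 2 * K₁ ^ 2) * R := by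
      rcases Nat.eq_zero_or_pos n with rfl | hn
      · have : N 0 x = 0 := (h.isOperatorSpace.eq_zero_iff 0 x).2 (by ext i; exact i.elim0)
        rw [this, zero_pow two_ne_zero]; positivity
      have hn' : (0 : ℝ) < n := by exact_mod_cast hn
      set y := x.map T with hy
      let Y := Submodule.span ℂ (Set.range fun p : Fin n × Fin n => y p.1 p.2)
      have : FiniteDimensional ℂ Y := FiniteDimensional.span_of_finite ℂ (Set.finite_range _)
      -- Since x = u'(u x), it is enough to bound the moved matrix, on whose entries the forms are
      -- scalar. The minimax bound needs only weights in [1/(4n), 1], a compact range.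
      obtain ⟨u, u', hu, hu', huu, hquv⟩ := hq.exists_scalarizing hlim hk hmin Y
        (show (0 : ℝ) < 1 / (4 * n) by positivity)
      have h1 : relNorm L n (y.map u) ^ 2 ≤ 2 * (4 * R) := by
        refine relNorm_sq_le hL _ (by positivity) fun W U φ ψ hadm hφ hψ => ?_
        rw [bimul_map]
        refine le_trans ?_ (mul_le_mul_of_nonneg_left (hx W U φ ψ hadm) (by norm_num))
        simp only [kForm, Finset.mul_sum]
        exact Finset.sum_le_sum fun i _ => Finset.sum_le_sum fun j _ =>
          (hquv _ _ (hφ j) (hadm.le_one_c j) (hψ i) (hadm.le_one_r i) _ (hentry y W U i j)).1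
      have h2 := hcontr u' hu' n (x.map fun z => T.symm (u (T z)))
      have e : (x.map fun z => T.symm (u (T z))).map (fun z => T.symm (u' (T z))) = x := by
        ext1 i j
        have := huu (T (x i j)) (hyent y i j)
        simp [this]
      rw [e] at h2
      have h3 := (hT n (x.map fun z => T.symm (u (T z)))).2
      rw [hrev] at h3
      have h4 := pow_le_pow_left₀ (hN _ _) h2 2
      have h5 := pow_le_pow_left₀ (hN _ _) h3 2
      calc N n x ^ 2 ≤ K₁ ^ 2 * N n (x.map fun z => T.symm (u (T z))) ^ 2 := by
            rw [← mul_pow]; exact h4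
        _ ≤ K₁ ^ 2 * (M ^ 2 * (2 * (4 * R))) := by
            gcongr
            refine h5.trans ?_
            rw [mul_pow]
            gcongr
        _ = _ := by ring
    refine hle.trans ?_
    unfold reprConst
    nlinarith
  -- For the lower bound the weights are given in advance; being finitely many and positive, they
  -- have a common lower bound.
  · obtain ⟨δ, ⟨hδ, hδ1⟩, hδ0⟩ : ∃ δ : ℝ, ((∀ j, δ ≤ φ j) ∧ (∀ i, δ ≤ ψ i)) ∧ 0 < δ := by
      have e1 : ∀ᶠ δ in nhdsWithin (0 : ℝ) (Set.Ioi 0), ∀ j, δ ≤ φ j := by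
        rw [Filter.eventually_all]
        exact fun j => nhdsWithin_le_nhds ((gt_mem_nhds (hadm.pos_c j)).mono fun _ h => h.le)
      have e2 : ∀ᶠ δ in nhdsWithin (0 : ℝ) (Set.Ioi 0), ∀ i, δ ≤ ψ i := by
        rw [Filter.eventually_all]
        exact fun j => nhdsWithin_le_nhds ((gt_mem_nhds (hadm.pos_r j)).mono fun _ h => h.le)
      exact ((e1.and e2).and self_mem_nhdsWithin).exists
    set y := x.map T with hy
    let Y := Submodule.span ℂ (Set.range fun p : Fin n × Fin n => y p.1 p.2)
    have : FiniteDimensional ℂ Y := FiniteDimensional.span_of_finite ℂ (Set.finite_range _)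
    obtain ⟨u, u', hu, hu', huu, hquv⟩ := hq.exists_scalarizing hlim hk hmin Y hδ0
    have h1 : kForm k W U φ ψ y ≤ 4 * relNorm L n (y.map u) ^ 2 := by
      have h2 := sum_relForm_le hL (y.map u) hadm
      rw [bimul_map] at h2
      refine le_trans ?_ (mul_le_mul_of_nonneg_left h2 (by norm_num))
      simp only [kForm, Finset.mul_sum]
      exact Finset.sum_le_sum fun i _ => Finset.sum_le_sum fun j _ =>
          (hquv _ _ (hδ j) (hadm.le_one_c j) (hδ1 i) (hadm.le_one_r i) _ (hentry y W U i j)).2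
    have h3 := (hT n (x.map fun z => T.symm (u (T z)))).1
    rw [hrev] at h3
    have h2 := hcontr u hu n x
    have h4 := pow_le_pow_left₀ (hN _ _) h2 2
    have h5 := pow_le_pow_left₀ (relNorm_nonneg _ _) h3 2
    rw [mul_pow] at h4 h5
    have h6 : 0 ≤ N n x ^ 2 := sq_nonneg _
    calc kForm k W U φ ψ y ≤ 4 * relNorm L n (y.map u) ^ 2 := h1
      _ ≤ 4 * (M ^ 2 * (K₁ ^ 2 * N n x ^ 2)) := by
          gcongr
          exact h5.trans (by gcongr)
      _ ≤ reprConst κ M * N n x ^ 2 := by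
          unfold reprConst
          rw [← hK₁]
          nlinarith [mul_nonneg (mul_nonneg (sq_nonneg M) (sq_nonneg K₁)) h6]

/-! ### Concave functions as integrals of minima -/

/-- The dyadic form of the representation of a concave function by second differences. -/
lemma exists_dyadic_representation {f : ℤ → ℝ} (h0 : ∀ n, 0 ≤ f n) (h1 : ∀ n, f n ≤ f (n + 1))
    (h2 : ∀ n, f (n + 1) ≤ 2 * f n) (h3 : ∀ n, 2 * f n + f (n + 2) ≤ 3 * f (n + 1)) :
    ∃ (a b : ℝ) (σ : ℤ → ℝ), 0 ≤ a ∧ a ≤ f 0 ∧ 0 ≤ b ∧ b ≤ f 0 ∧ (∀ n, 0 ≤ σ n) ∧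
      ∀ m : ℤ, HasSum (fun n : ℤ => σ n * min ((2 : ℝ) ^ m) (2 ^ n)) (f m - a - b * 2 ^ m) := by
  have hz : ∀ n : ℤ, (0 : ℝ) < 2 ^ n := fun n => by positivity
  have hz1 : ∀ n : ℤ, (2 : ℝ) ^ (n + 1) = 2 * 2 ^ n := fun n => by
    rw [zpow_add_one₀ two_ne_zero, mul_comm]
  -- Slopes of the piecewise linear interpolation between the points 2^n; `h3` says that they
  -- decrease.
  let s : ℤ → ℝ := fun n => (f (n + 1) - f n) / 2 ^ n
  have hs0 : ∀ n, 0 ≤ s n := fun n => div_nonneg (sub_nonneg.2 (h1 n)) (hz n).le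
  have hsmul : ∀ n, s n * 2 ^ n = f (n + 1) - f n := fun n => div_mul_cancel₀ _ (hz n).ne'
  have hs1 : ∀ n, s (n + 1) ≤ s n := by
    intro n
    simp only [s]
    rw [div_le_div_iff₀ (hz _) (hz _), hz1, show n + 1 + 1 = n + 2 by ring]
    have := h3 n
    nlinarith [hz n]
  have hfm : Monotone f := monotone_int_of_le_succ h1
  have hsm : Antitone s := antitone_int_of_succ_le hs1
  have hfb : BddBelow (Set.range f) := ⟨0, by rintro _ ⟨n, rfl⟩; exact h0 n⟩
  have hsb : BddBelow (Set.range s) := ⟨0, by rintro _ ⟨n, rfl⟩; exact hs0 n⟩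
  have hfl := tendsto_atBot_ciInf hfm hfb
  have hsl := tendsto_atTop_ciInf hsm hsb
  -- The limit value at 0 and the limit slope at infinity give the constant and the linear term.
  set a := ⨅ n, f n with ha
  set b := ⨅ n, s n with hb
  let σ : ℤ → ℝ := fun n => s (n - 1) - s n
  have hσ : ∀ n, 0 ≤ σ n := fun n => by
    have := hs1 (n - 1)
    rw [sub_add_cancel] at this
    exact sub_nonneg.2 this
  refine ⟨a, b, σ, le_ciInf h0, ciInf_le hfb 0, le_ciInf hs0, ?_, hσ, fun m => ?_⟩
  · refine (ciInf_le hsb 0).trans ?_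
    have := h2 0
    simp only [s, zpow_zero, div_one]
    linarith
  -- For indices at or above m the minimum is 2^m, and the slope jumps telescope.
  have hright : HasSum (fun j : ℕ => σ (m + j) * min ((2 : ℝ) ^ m) (2 ^ (m + (j : ℤ))))
      ((s (m - 1) - b) * 2 ^ m) := by
    have e : ∀ j : ℕ, min ((2 : ℝ) ^ m) (2 ^ (m + (j : ℤ))) = 2 ^ m := fun j =>
      min_eq_left (zpow_le_zpow_right₀ one_le_two (by omega))
    simp only [e]
    refine HasSum.mul_right _ ?_
    rw [hasSum_iff_tendsto_nat_of_nonneg fun j => hσ _]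
    have hsum : ∀ J : ℕ, ∑ j ∈ Finset.range J, σ (m + j) = s (m - 1) - s (m - 1 + J) := by
      intro J
      induction J with
      | zero => simp
      | succ J ih =>
        rw [Finset.sum_range_succ, ih]
        simp only [σ]
        push_cast
        rw [show m - 1 + ((J : ℤ) + 1) = m + J by ring, show m + (J : ℤ) - 1 = m - 1 + J by ring]
        ring
    simp only [hsum]
    refine tendsto_const_nhds.sub (hsl.comp ?_)
    exact Filter.tendsto_atTop_add_const_left _ _ tendsto_natCast_atTop_atTop
  have hleft : HasSum (fun j : ℕ => σ (m + -((j : ℤ) + 1)) *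
      min ((2 : ℝ) ^ m) (2 ^ (m + -((j : ℤ) + 1)))) (2 * f (m - 1) - f m - a) := by
    have e : ∀ j : ℕ, min ((2 : ℝ) ^ m) (2 ^ (m + -((j : ℤ) + 1))) = 2 ^ (m + -((j : ℤ) + 1)) :=
      fun j => min_eq_right (zpow_le_zpow_right₀ one_le_two (by omega))
    simp only [e]
    rw [hasSum_iff_tendsto_nat_of_nonneg fun j => mul_nonneg (hσ _) (hz _).le]
    -- The quantity 2 f(n − 1) − f(n) is the intercept at 0 of the linear piece on [2^(n−1), 2^n];
    -- its increments are σ_n 2^n, so the sum below m telescopes too.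
    have hterm : ∀ n, σ n * 2 ^ n = (2 * f n - f (n + 1)) - (2 * f (n - 1) - f n) := by
      intro n
      have e1 := hsmul n
      have e2 := hsmul (n - 1)
      have e3 := hz1 (n - 1)
      rw [sub_add_cancel] at e2 e3
      simp only [σ]
      rw [sub_mul, e1, e3, ← mul_assoc, mul_comm (s (n - 1)) 2, mul_assoc, e2]
      ring
    have hsum : ∀ J : ℕ, ∑ j ∈ Finset.range J, σ (m + -((j : ℤ) + 1)) * 2 ^ (m + -((j : ℤ) + 1))
        = (2 * f (m - 1) - f m) - (2 * f (m - 1 - J) - f (m - J)) := by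
      intro J
      induction J with
      | zero => simp
      | succ J ih =>
        rw [Finset.sum_range_succ, ih, hterm]
        push_cast
        rw [show m + -((J : ℤ) + 1) + 1 = m - J by ring, show m + -((J : ℤ) + 1) = m - 1 - J by ring,
          show m - 1 - (J : ℤ) - 1 = m - 1 - ((J : ℤ) + 1) by ring,
          show m - ((J : ℤ) + 1) = m - 1 - J by ring]
        ring
    simp only [hsum]
    have hl : ∀ c : ℤ, Filter.Tendsto (fun J : ℕ => f (c - J)) Filter.atTop (nhds a) := by
      intro c
      refine hfl.comp ?_
      simp only [sub_eq_add_neg]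
      exact Filter.tendsto_atBot_add_const_left _ _
        (Filter.tendsto_neg_atTop_atBot.comp tendsto_natCast_atTop_atTop)
    have := ((hl (m - 1)).const_mul 2).sub (hl m)
    have h4 := (tendsto_const_nhds (x := 2 * f (m - 1) - f m)).sub this
    rwa [show 2 * f (m - 1) - f m - (2 * a - a) = 2 * f (m - 1) - f m - a by ring] at h4
  have hall := HasSum.of_nat_of_neg_add_one
    (f := fun j : ℤ => σ (m + j) * min ((2 : ℝ) ^ m) (2 ^ (m + j))) hright hleft
  have e : (s (m - 1) - b) * 2 ^ m + (2 * f (m - 1) - f m - a) = f m - a - b * 2 ^ m := by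
    have e2 := hsmul (m - 1)
    have e3 := hz1 (m - 1)
    rw [sub_add_cancel] at e2 e3
    rw [sub_mul]
    nth_rewrite 1 [e3]
    rw [← mul_assoc, mul_comm (s (m - 1)) 2, mul_assoc, e2]
    ring
  rw [e] at hall
  exact (Equiv.addLeft m).hasSum_iff.1 hall

/-- Each fibre of the floor function is an interval of length 1. -/
lemma map_floor_volume : (volume : Measure ℝ).map (fun x => ⌊x⌋) = Measure.count := by
  refine Measure.ext_of_singleton fun n => ?_
  rw [Measure.map_apply Int.measurable_floor (measurableSet_singleton n),
    Int.preimage_floor_singleton, Real.volume_Ico, Measure.count_singleton]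
  simp

/-- Integrals of step functions on the line are sums. -/
lemma hasSum_integral_floor {F : ℤ → ℝ} {S : ℝ} (hF : HasSum F S) (h0 : ∀ n, 0 ≤ F n) :
    Integrable (fun x : ℝ => F ⌊x⌋) ∧ ∫ x : ℝ, F ⌊x⌋ = S := by
  have hm : AEMeasurable (fun x : ℝ => ⌊x⌋) volume := Int.measurable_floor.aemeasurable
  have hs : AEStronglyMeasurable F ((volume : Measure ℝ).map fun x => ⌊x⌋) :=
    (measurable_from_top (f := F)).aestronglyMeasurable
  have hi : Integrable F ((volume : Measure ℝ).map fun x => ⌊x⌋) := by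
    rw [map_floor_volume, integrable_count_iff]
    simpa only [Real.norm_of_nonneg (h0 _)] using hF.summable
  refine ⟨(integrable_map_measure hs hm).1 hi, ?_⟩
  rw [← integral_map hm hs]
  rw [map_floor_volume] at hi ⊢
  rw [integral_countable hi]
  simpa [Measure.real] using hF.tsum_eq

/-- A summable strictly positive sequence of perturbations. -/
def pert (n : ℤ) : ℝ := (1 / 4) ^ n.natAbs

lemma pert_pos (n : ℤ) : 0 < pert n := by unfold pert; positivity

lemma summable_half_natAbs : Summable fun n : ℤ => (1 / 2 : ℝ) ^ n.natAbs := by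
  have h := summable_geometric_of_lt_one (r := (1 / 2 : ℝ)) (by norm_num) (by norm_num)
  exact Summable.of_nat_of_neg (by simpa using h) (by simpa using h)

/-- The perturbation, which makes the weights strictly positive, is measured against min(1, 2^m), a
lower bound for k(1, 2^m), so it costs only a constant. -/
lemma pert_mul_min_le (m n : ℤ) :
    pert n * min ((2 : ℝ) ^ m) (2 ^ n) ≤ min 1 (2 ^ m) * (1 / 2) ^ n.natAbs := by
  have hz : ∀ n : ℤ, (0 : ℝ) < 2 ^ n := fun n => by positivity
  have h1 : min ((2 : ℝ) ^ m) (2 ^ n) ≤ min 1 (2 ^ m) * max 1 (2 ^ n) := by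
    rcases le_total (1 : ℝ) (2 ^ m) with h | h
    · rw [min_eq_left h, one_mul]
      exact (min_le_right _ _).trans (le_max_right _ _)
    · rw [min_eq_right h]
      exact (min_le_left _ _).trans (le_mul_of_one_le_right (hz m).le (le_max_left _ _))
  have h2 : pert n * max 1 ((2 : ℝ) ^ n) ≤ (1 / 2) ^ n.natAbs := by
    unfold pert
    rw [mul_max_of_nonneg _ _ (by positivity), mul_one]
    refine max_le (pow_le_pow_left₀ (by norm_num) (by norm_num) _) ?_
    have h3 : (2 : ℝ) ^ n ≤ 2 ^ n.natAbs := by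
      rw [← zpow_natCast]
      exact zpow_le_zpow_right₀ one_le_two (Int.le_natAbs)
    calc (1 / 4 : ℝ) ^ n.natAbs * 2 ^ n ≤ (1 / 4 : ℝ) ^ n.natAbs * 2 ^ n.natAbs := by gcongr
      _ = (1 / 2) ^ n.natAbs := by rw [← mul_pow]; norm_num
  calc pert n * min ((2 : ℝ) ^ m) (2 ^ n) ≤ pert n * (min 1 (2 ^ m) * max 1 (2 ^ n)) := by
        gcongr
        exact (pert_pos n).le
    _ = min 1 (2 ^ m) * (pert n * max 1 (2 ^ n)) := by ring
    _ ≤ _ := by gcongr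

/-- The constant in the representation of concave functions by weights. -/
def weightConst : ℝ := 2 * (1 + ∑' n : ℤ, (1 / 2 : ℝ) ^ n.natAbs)

lemma two_le_weightConst : 2 ≤ weightConst := by
  have : 0 ≤ ∑' n : ℤ, (1 / 2 : ℝ) ^ n.natAbs := tsum_nonneg fun n => by positivity
  unfold weightConst
  linarith

/-- Concave functions are represented by weights on the line. -/
lemma exists_weights {k : ℝ → ℝ → ℝ} (hk : IsKFun k) (h11 : k 1 1 = 1)
    (hmin : ∀ s t, 0 < s → 0 < t → min s t ≤ k s t)
    (hconc : ∀ s t, 0 < s → 0 < t → 2 * k s t + k s (4 * t) ≤ 3 * k s (2 * t)) :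
    ∃ (lam gam : ℝ) (uc ur : ℝ → ℝ), 0 ≤ lam ∧ lam ≤ 1 ∧ 0 ≤ gam ∧ gam ≤ 1 ∧
      IsWeightPair volume uc ur ∧ (∀ s, 0 < uc s) ∧ (∀ s, 0 < ur s) ∧
      ∀ s t, 0 < s → 0 < t →
        k s t ≤ weightConst * (lam ^ 2 * s + gam ^ 2 * t + kWeight volume uc ur s t) ∧
        lam ^ 2 * s + gam ^ 2 * t + kWeight volume uc ur s t ≤ weightConst * k s t := by
  have hz : ∀ n : ℤ, (0 : ℝ) < 2 ^ n := fun n => by positivity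
  have hz1 : ∀ n : ℤ, (2 : ℝ) ^ (n + 1) = 2 * 2 ^ n := fun n => by
    rw [zpow_add_one₀ two_ne_zero, mul_comm]
  let f : ℤ → ℝ := fun n => k 1 (2 ^ n)
  have hf1 : ∀ n, f n ≤ f (n + 1) := fun n => hk.mono _ _ _ _ one_pos (hz n) le_rfl
    (zpow_le_zpow_right₀ one_le_two (by omega))
  have hf2 : ∀ n, f (n + 1) ≤ 2 * f n := fun n => by
    simp only [f]
    rw [← hk.homog _ _ _ two_pos one_pos (hz n), hz1]
    exact hk.mono _ _ _ _ one_pos (by positivity) (by norm_num) le_rfl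
  obtain ⟨a, b, σ, ha0, ha1, hb0, hb1, hσ, hsum⟩ := exists_dyadic_representation (f := f)
    (fun n => hk.nonneg _ _ one_pos (hz n)) hf1 hf2 fun n => by
      simp only [f]
      rw [show n + 2 = n + 1 + 1 by ring, hz1 (n + 1), hz1 n,
        show (2 : ℝ) * (2 * 2 ^ n) = 4 * 2 ^ n by ring]
      exact hconc 1 _ one_pos (hz n)
  have hf0 : f 0 = 1 := by simp only [f, zpow_zero, h11]
  rw [hf0] at ha1 hb1
  let τ : ℤ → ℝ := fun n => σ n + pert n
  have hτ : ∀ n, 0 < τ n := fun n => add_pos_of_nonneg_of_pos (hσ n) (pert_pos n)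
  have hpert : ∀ m : ℤ, Summable fun n => pert n * min ((2 : ℝ) ^ m) (2 ^ n) := fun m =>
    Summable.of_nonneg_of_le
      (fun n => mul_nonneg (pert_pos n).le (le_min (hz m).le (hz n).le))
      (fun n => pert_mul_min_le m n) (summable_half_natAbs.mul_left _)
  -- With these step weights, one unit interval for each n, the integral of min(u_c, 2^m u_r) is ∑
  -- τ_n min(2^n, 2^m).
  let uc : ℝ → ℝ := fun x => τ ⌊x⌋ * 2 ^ ⌊x⌋
  let ur : ℝ → ℝ := fun x => τ ⌊x⌋
  have hsumτ : ∀ m : ℤ, HasSum (fun n => min (1 * (τ n * 2 ^ n)) (2 ^ m * τ n))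
      (f m - a - b * 2 ^ m + ∑' n, pert n * min ((2 : ℝ) ^ m) (2 ^ n)) := by
    intro m
    have h := (hsum m).add (hpert m).hasSum
    refine h.congr_fun fun n => ?_
    rw [one_mul, mul_comm ((2 : ℝ) ^ m), ← mul_min_of_nonneg _ _ (hτ n).le, min_comm, ← add_mul]
  have hnn : ∀ m n : ℤ, 0 ≤ min (1 * (τ n * 2 ^ n)) ((2 : ℝ) ^ m * τ n) := fun m n => by
    have := hτ n
    positivity
  have hint := fun m : ℤ => hasSum_integral_floor (hsumτ m) (hnn m)
  have hpair : IsWeightPair volume uc ur := by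
    refine ⟨?_, ?_, fun x => (mul_pos (hτ _) (hz _)).le, fun x => (hτ _).le, ?_⟩
    · exact (measurable_from_top (f := fun n : ℤ => τ n * 2 ^ n)).comp Int.measurable_floor
    · exact (measurable_from_top (f := τ)).comp Int.measurable_floor
    · simpa using (hint 0).1
  refine ⟨√a, √b, uc, ur, Real.sqrt_nonneg _, Real.sqrt_le_one.2 ha1, Real.sqrt_nonneg _,
    Real.sqrt_le_one.2 hb1, hpair, fun x => mul_pos (hτ _) (hz _), fun x => hτ _,
    fun s t hs ht => ?_⟩
  rw [Real.sq_sqrt ha0, Real.sq_sqrt hb0]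
  set B := ∑' n : ℤ, (1 / 2 : ℝ) ^ n.natAbs with hB
  let g : ℝ → ℝ → ℝ := fun s t => a * s + b * t + kWeight volume uc ur s t
  have hgrid : ∀ m : ℤ, f m ≤ g 1 (2 ^ m) ∧ g 1 (2 ^ m) ≤ (1 + B) * f m := by
    intro m
    have e : g 1 (2 ^ m) = f m + ∑' n, pert n * min ((2 : ℝ) ^ m) (2 ^ n) := by
      have : kWeight volume uc ur 1 (2 ^ m) = _ := (hint m).2
      simp only [g]
      rw [this]
      ring
    have h1 : 0 ≤ ∑' n, pert n * min ((2 : ℝ) ^ m) (2 ^ n) :=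
      tsum_nonneg fun n => mul_nonneg (pert_pos n).le (le_min (hz m).le (hz n).le)
    have h2 : ∑' n, pert n * min ((2 : ℝ) ^ m) (2 ^ n) ≤ min 1 (2 ^ m) * B := by
      rw [hB, ← tsum_mul_left]
      exact (hpert m).tsum_le_tsum (fun n => pert_mul_min_le m n)
        (summable_half_natAbs.mul_left _)
    have h3 : min 1 (2 ^ m) ≤ f m := hmin 1 _ one_pos (hz m)
    have hB0 : 0 ≤ B := tsum_nonneg fun n => by positivity
    rw [e]
    exact ⟨by linarith, by nlinarith⟩
  have hghom : ∀ t, 0 < t → g s (s * t) = s * g 1 t := fun t _ => by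
    simp only [g]
    have := kWeight_homog (ν := volume) (uc := uc) (ur := ur) hs.le 1 t
    rw [mul_one] at this
    rw [this]; ring
  have hgmono : ∀ t t', 0 < t → t ≤ t' → g 1 t ≤ g 1 t' := fun t t' h h' => by
    have := hpair.kWeight_mono zero_le_one h.le (le_refl (1 : ℝ)) h'
    simp only [g]
    nlinarith
  have hkhom : ∀ t, 0 < t → k s (s * t) = s * k 1 t := fun t h => by
    have := hk.homog s 1 t hs one_pos h
    rwa [mul_one] at this
  -- By homogeneity only t/s matters; enclosing it between consecutive powers of 2 costs the factor
  -- 2 in `weightConst`.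
  obtain ⟨m, hm1, hm2⟩ := exists_mem_Ico_zpow (x := t / s) (div_pos ht hs) one_lt_two
  have hts : s * (t / s) = t := mul_div_cancel₀ _ hs.ne'
  have hpos := div_pos ht hs
  have kk1 : f m ≤ k 1 (t / s) := hk.mono _ _ _ _ one_pos (hz m) le_rfl hm1
  have kk2 : k 1 (t / s) ≤ f (m + 1) := hk.mono _ _ _ _ one_pos hpos le_rfl hm2.le
  have gg1 := hgmono _ _ (hz m) hm1
  have gg2 := hgmono _ _ hpos hm2.le
  have c1 := hf2 m
  obtain ⟨d1, -⟩ := hgrid m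
  obtain ⟨-, d4⟩ := hgrid (m + 1)
  have hB0 : 0 ≤ B := tsum_nonneg fun n => by positivity
  have hfm : 0 ≤ f m := hk.nonneg _ _ one_pos (hz m)
  have hC : weightConst = 2 * (1 + B) := rfl
  change k s t ≤ weightConst * g s t ∧ g s t ≤ weightConst * k s t
  rw [← hts, hghom _ hpos, hkhom _ hpos, hC]
  constructor
  · have : k 1 (t / s) ≤ 2 * (1 + B) * g 1 (t / s) := by nlinarith
    nlinarith
  · have : g 1 (t / s) ≤ 2 * (1 + B) * k 1 (t / s) := by nlinarith
    nlinarith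

/-- Representation of homogeneous subquotients of `C ⊕ R` as intersections. -/
theorem exists_interCRK : ∃ c : ℝ → ℝ → ℝ, ∀ (E : Type*) [AddCommGroup E] [Module ℂ E]
    (N : MatrixNorms E) (κ M : ℝ), IsHQSWith κ M N → ¬ FiniteDimensional ℂ E →
      ∃ (lam gam : ℝ) (uc ur : ℝ → ℝ), 0 ≤ lam ∧ lam ≤ 1 ∧ 0 ≤ gam ∧ gam ≤ 1 ∧
        IsWeightPair volume uc ur ∧ (∀ s, 0 < uc s) ∧ (∀ s, 0 < ur s) ∧
        CompletelyIsoWith (c κ M) N (interCRK lam gam volume uc ur) := by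
  refine ⟨fun κ M => √(weightConst * reprConst κ M * 8), fun E _ _ N κ M h hE => ?_⟩
  obtain ⟨T, k, hk, h11, hmin, hconc, hrep⟩ := h.exists_represents hE
  obtain ⟨lam, gam, uc, ur, hl0, hl1, hg0, hg1, hpair, hc, hr, hkg⟩ :=
    exists_weights hk h11 hmin hconc
  exact ⟨lam, gam, uc, ur, hl0, hl1, hg0, hg1, hpair, hc, hr,
    hrep.completelyIsoWith (hpair.represents_interCRK hl0 hg0)
      (zero_le_two.trans two_le_weightConst) (fun s t hs ht => (hkg s t hs ht).1)
      fun s t hs ht => (hkg s t hs ht).2⟩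

/-! ### Calculus of equivalence up to constants -/

section EquivOn

variable {X : Type*} {p : X → Prop} {f g h : X → ℝ}

lemma EquivOn.symm (H : EquivOn p f g) : EquivOn p g f := by
  obtain ⟨A, hA, H⟩ := H
  refine ⟨A, hA, fun x hx => ⟨?_, ?_⟩⟩
  · rw [inv_mul_le_iff₀ hA]; exact (H x hx).2
  · have := (H x hx).1
    rwa [inv_mul_le_iff₀ hA] at this

lemma EquivOn.trans (H : EquivOn p f g) (H' : EquivOn p g h) : EquivOn p f h := by
  obtain ⟨A, hA, H⟩ := H
  obtain ⟨B, hB, H'⟩ := H'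
  refine ⟨A * B, mul_pos hA hB, fun x hx => ⟨?_, ?_⟩⟩
  · rw [mul_inv, mul_assoc]
    exact (mul_le_mul_of_nonneg_left (H' x hx).1 (inv_nonneg.2 hA.le)).trans (H x hx).1
  · rw [mul_assoc]
    exact (H x hx).2.trans (mul_le_mul_of_nonneg_left (H' x hx).2 hA.le)

lemma EquivOn.of_le {A B : ℝ} (hA : 0 < A) (hf : ∀ x, p x → 0 ≤ f x)
    (hg : ∀ x, p x → 0 ≤ g x)
    (h1 : ∀ x, p x → f x ≤ A * g x) (h2 : ∀ x, p x → g x ≤ B * f x) : EquivOn p f g := by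
  refine ⟨max A B, by positivity, fun x hx => ⟨?_, ?_⟩⟩
  · rw [inv_mul_le_iff₀ (by positivity)]
    exact (h2 x hx).trans (mul_le_mul_of_nonneg_right (le_max_right _ _) (hf x hx))
  · exact (h1 x hx).trans (mul_le_mul_of_nonneg_right (le_max_left _ _) (hg x hx))

lemma EquivOn.congr_right (H : EquivOn p f g) (hgh : ∀ x, p x → g x = h x) : EquivOn p f h := by
  obtain ⟨A, hA, H⟩ := H
  exact ⟨A, hA, fun x hx => hgh x hx ▸ H x hx⟩

lemma EquivOn.comp {Y : Type*} {q : Y → Prop} (H : EquivOn p f g) (φ : Y → X)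
    (hφ : ∀ y, q y → p (φ y)) : EquivOn q (fun y => f (φ y)) (fun y => g (φ y)) := by
  obtain ⟨A, hA, H⟩ := H
  exact ⟨A, hA, fun y hy => H _ (hφ y hy)⟩

end EquivOn

/-! ### The generalised inverse of a regular function -/

section Inverse

variable {g : ℝ → ℝ}

lemma IsRegularFun.exists_le (hg : IsRegularFun g) :
    ∃ c d α β : ℝ, 0 < c ∧ c ≤ 1 ∧ 0 < d ∧ 0 < α ∧ 0 < β ∧ β < 1 ∧
    ∀ s t : ℝ, 1 ≤ s → s ≤ t →
      c * (t / s) ^ α * g s ≤ g t ∧ g t ≤ d * (t / s) ^ β * g s := by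
  obtain ⟨h0, c, d, α, β, hc, hd, hα, hαβ, hβ, h⟩ := hg
  refine ⟨min c 1, d, α, β, by positivity, min_le_right _ _, hd, hα, hα.trans_le hαβ, hβ,
    fun s t hs hst => ⟨?_, ?_⟩⟩
  · have h1 := (h s t hs hst).1
    rw [le_div_iff₀ (h0 s hs)] at h1
    refine le_trans ?_ h1
    have : 0 ≤ (t / s) ^ α := Real.rpow_nonneg (div_nonneg (by linarith) (by linarith)) _
    have := (h0 s hs).le
    gcongr
    exact min_le_left _ _
  · have h1 := (h s t hs hst).2
    rwa [div_le_iff₀ (h0 s hs)] at h1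

/-- Dilating the argument of a regular function by a suitable constant multiplies its values by at
least a given constant. -/
lemma IsRegularFun.exists_dilation (hg : IsRegularFun g) (B : ℝ) :
    ∃ L : ℝ, 1 ≤ L ∧ ∀ s, 1 ≤ s → B * g s ≤ g (L * s) := by
  have h0 := hg.1
  obtain ⟨c, d, α, β, hc, -, hd, hα, -, -, h⟩ := hg.exists_le
  have ht : Filter.Tendsto (fun L : ℝ => c * L ^ α) Filter.atTop Filter.atTop :=
    (tendsto_rpow_atTop hα).const_mul_atTop hc
  obtain ⟨L, hL, hL1⟩ := ((ht.eventually_ge_atTop B).and (Filter.eventually_ge_atTop 1)).exists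
  refine ⟨L, hL1, fun s hs => ?_⟩
  have h1 := (h s (L * s) hs (le_mul_of_one_le_left (by positivity) hL1)).1
  rw [mul_div_assoc, div_self (by positivity), mul_one] at h1
  exact (mul_le_mul_of_nonneg_right hL (h0 s hs).le).trans h1

lemma bddBelow_genInv (g : ℝ → ℝ) (t : ℝ) : BddBelow {s : ℝ | 1 ≤ s ∧ t ≤ g s} :=
  ⟨1, fun _ hs => hs.1⟩

lemma genInv_le {t s : ℝ} (hs : 1 ≤ s) (h : t ≤ g s) : genInv g t ≤ s :=
  csInf_le (bddBelow_genInv g t) ⟨hs, h⟩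

/-- The exponent α > 0 makes g unbounded, so the infimum defining `genInv` is a genuine one. -/
lemma IsRegularFun.nonempty_genInv (hg : IsRegularFun g) (t : ℝ) :
    {s : ℝ | 1 ≤ s ∧ t ≤ g s}.Nonempty := by
  obtain ⟨L, hL, h⟩ := hg.exists_dilation (t / g 1)
  refine ⟨L * 1, by simpa using hL, ?_⟩
  have := h 1 le_rfl
  rwa [div_mul_cancel₀ _ (hg.1 1 le_rfl).ne'] at this

lemma IsRegularFun.le_genInv (hg : IsRegularFun g) {t r : ℝ}
    (h : ∀ s, 1 ≤ s → t ≤ g s → r ≤ s) : r ≤ genInv g t :=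
  le_csInf (hg.nonempty_genInv t) fun s hs => h s hs.1 hs.2

lemma IsRegularFun.one_le_genInv (hg : IsRegularFun g) (t : ℝ) : 1 ≤ genInv g t :=
  hg.le_genInv fun _ hs _ => hs

lemma IsRegularFun.monotone_genInv (hg : IsRegularFun g) : Monotone (genInv g) :=
  fun _ _ htt => hg.le_genInv fun _ hs h => genInv_le hs (htt.trans h)

/-- If s is admissible for t, then L s is admissible for B t, by `exists_dilation`. -/
lemma IsRegularFun.exists_genInv_mul_le (hg : IsRegularFun g) (B : ℝ) (hB : 0 ≤ B) :
    ∃ L : ℝ, 1 ≤ L ∧ ∀ t, genInv g (B * t) ≤ L * genInv g t := by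
  obtain ⟨L, hL, h⟩ := hg.exists_dilation B
  refine ⟨L, hL, fun t => ?_⟩
  rw [← div_le_iff₀' (by positivity)]
  refine hg.le_genInv fun s hs hst => ?_
  rw [div_le_iff₀' (by positivity)]
  exact genInv_le (one_le_mul_of_one_le_of_one_le hL hs)
    ((mul_le_mul_of_nonneg_left hst hB).trans (h s hs))

/-- A power lower bound for the generalised inverse of a regular function. -/
lemma IsRegularFun.exists_rpow_le_genInv (hg : IsRegularFun g) : ∃ c d p : ℝ, 0 < c ∧ 0 < d ∧
    1 < p ∧ (∀ n, 1 ≤ n → g 1 ≤ c * g n) ∧ ∀ n t, 1 ≤ n → 0 < t → (c * g n ≤ t ∨ n = 1) →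
      n * (t / (d * g n)) ^ p ≤ genInv g t := by
  have h0 := hg.1
  obtain ⟨c, d, α, β, hc, hc1, hd, hα, hβ, hβ1, h⟩ := hg.exists_le
  refine ⟨c⁻¹, d, β⁻¹, inv_pos.2 hc, hd, (one_lt_inv₀ hβ).2 hβ1, fun n hn => ?_,
    fun n t hn ht hnt => hg.le_genInv fun s hs hts => ?_⟩
  · rw [le_inv_mul_iff₀ hc]
    refine le_trans ?_ (h 1 n le_rfl hn).1
    refine mul_le_mul_of_nonneg_right (le_mul_of_one_le_right hc.le ?_) (h0 1 le_rfl).le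
    exact Real.one_le_rpow (by simpa using hn) hα.le
  · have hgn := h0 n hn
    -- Regular functions need not be monotone; still, the lower power bound gives g s < c⁻¹ g n for
    -- s < n.
    have hns : n ≤ s := by
      rcases hnt with hnt | rfl
      · by_contra hlt
        push Not at hlt
        have h1 := (h s n hs hlt.le).1
        have h2 : 1 < (n / s) ^ α :=
          Real.one_lt_rpow ((one_lt_div (by positivity)).2 hlt) hα
        have h3 : c * g s < g n := by
          refine lt_of_lt_of_le ?_ h1
          rw [mul_assoc]
          exact mul_lt_mul_of_pos_left (lt_mul_of_one_lt_left (h0 s hs) h2) hc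
        have h4 : g s < c⁻¹ * g n := by rwa [lt_inv_mul_iff₀ hc]
        linarith
      · exact hs
    have h1 := hts.trans (h n s hn hns).2
    have h2 : t / (d * g n) ≤ (s / n) ^ β := by
      rw [div_le_iff₀ (by positivity)]
      linarith
    have h3 : (t / (d * g n)) ^ β⁻¹ ≤ s / n := by
      calc (t / (d * g n)) ^ β⁻¹ ≤ ((s / n) ^ β) ^ β⁻¹ :=
            Real.rpow_le_rpow (by positivity) h2 (by positivity)
        _ = s / n := Real.rpow_rpow_inv (by positivity) hβ.ne'
    rwa [le_div_iff₀' (by positivity)] at h3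

end Inverse

/-! ### Weights on a half line and their truncated integrals -/

section Profile

/-- Nonincreasing functions on the line which are integrable on the half line and `1` on the
negative half line. -/
structure IsProfile (v : ℝ → ℝ) : Prop where
  nonneg : ∀ s, 0 ≤ v s
  one : ∀ s, s < 0 → v s = 1
  antitone : Antitone v
  integrable : IntegrableOn v (Set.Ioi 0)

/-- The function `1 + ∫_0^∞ min (n v, 1)`. -/
def truncMean (v : ℝ → ℝ) (n : ℝ) : ℝ := 1 + ∫ s in Set.Ioi (0 : ℝ), min (n * v s) 1

variable {v : ℝ → ℝ}

lemma IsProfile.le_one (h : IsProfile v) (s : ℝ) : v s ≤ 1 := by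
  have h1 : v s ≤ v (min s 0 - 1) := h.antitone (by linarith [min_le_left s 0])
  rwa [h.one (min s 0 - 1) (by linarith [min_le_right s 0])] at h1

lemma IsProfile.integrable_min (h : IsProfile v) {n : ℝ} (hn : 0 ≤ n) :
    IntegrableOn (fun s => min (n * v s) 1) (Set.Ioi 0) := by
  refine Integrable.mono' (h.integrable.const_mul n) ?_ (ae_of_all _ fun s => ?_)
  · exact ((h.antitone.measurable.const_mul n).min measurable_const).aestronglyMeasurable
  · rw [Real.norm_of_nonneg (le_min (mul_nonneg hn (h.nonneg s)) zero_le_one)]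
    exact min_le_left _ _

lemma IsProfile.truncMean_mono (h : IsProfile v) {m n : ℝ} (hm : 0 ≤ m) (hmn : m ≤ n) :
    truncMean v m ≤ truncMean v n := by
  refine add_le_add le_rfl (setIntegral_mono (h.integrable_min hm)
    (h.integrable_min (hm.trans hmn)) fun s => ?_)
  exact min_le_min (mul_le_mul_of_nonneg_right hmn (h.nonneg s)) le_rfl

lemma IsProfile.one_le_truncMean (h : IsProfile v) {n : ℝ} (hn : 0 ≤ n) : 1 ≤ truncMean v n :=
  le_add_of_nonneg_right
    (integral_nonneg fun s => le_min (mul_nonneg hn (h.nonneg s)) zero_le_one)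

lemma IsProfile.truncMean_mul_le (h : IsProfile v) {L n : ℝ} (hL : 1 ≤ L) (hn : 0 ≤ n) :
    truncMean v (L * n) ≤ L * truncMean v n := by
  rw [truncMean, truncMean, mul_add, mul_one, ← integral_const_mul]
  refine add_le_add hL (setIntegral_mono (h.integrable_min (by positivity))
    ((h.integrable_min hn).const_mul L) fun s => ?_)
  rw [mul_min_of_nonneg _ _ (by positivity : (0 : ℝ) ≤ L), mul_one, mul_assoc]
  exact min_le_min le_rfl hL

/-- A lower bound by the level set where `n v ≥ m`. -/
lemma IsProfile.le_truncMean (h : IsProfile v) {m n T : ℝ} (hn : 0 ≤ n)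
    (hm1 : m ≤ 1) (hT : 0 ≤ T) (hv : ∀ s, 0 < s → s ≤ T → m ≤ n * v s) :
    1 + m * T ≤ truncMean v n := by
  refine add_le_add le_rfl ?_
  have h1 : ∫ s in Set.Ioc (0 : ℝ) T, m = m * T := by
    simp [hT, mul_comm]
  rw [← h1]
  calc ∫ s in Set.Ioc (0 : ℝ) T, m ≤ ∫ s in Set.Ioc (0 : ℝ) T, min (n * v s) 1 :=
        setIntegral_mono_on (by simp)
          ((h.integrable_min hn).mono_set Set.Ioc_subset_Ioi_self) measurableSet_Ioc
          fun s hs => le_min (hv s hs.1 hs.2) hm1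
    _ ≤ _ := setIntegral_mono_set (h.integrable_min hn)
        (ae_of_all _ fun s => le_min (mul_nonneg hn (h.nonneg s)) zero_le_one)
        (Filter.Eventually.of_forall Set.Ioc_subset_Ioi_self)

/-- An upper bound by the tail integral. -/
lemma IsProfile.truncMean_le (h : IsProfile v) {n T : ℝ} (hn : 0 ≤ n) (hT : 0 ≤ T) :
    truncMean v n ≤ 1 + T + n * ∫ s in Set.Ioi T, v s := by
  have hi := h.integrable_min hn
  have hsub : Set.Ioi T ⊆ Set.Ioi 0 := Set.Ioi_subset_Ioi hT
  rw [truncMean, add_assoc, ← Set.Ioc_union_Ioi_eq_Ioi hT,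
    setIntegral_union (Set.Ioc_disjoint_Ioi le_rfl) measurableSet_Ioi
      (hi.mono_set Set.Ioc_subset_Ioi_self) (hi.mono_set hsub), ← integral_const_mul]
  refine add_le_add le_rfl (add_le_add ?_ ?_)
  · have h1 : ∫ s in Set.Ioc (0 : ℝ) T, (1 : ℝ) = T := by simp [hT]
    refine le_trans ?_ h1.le
    exact setIntegral_mono (hi.mono_set Set.Ioc_subset_Ioi_self) (by simp) fun s => min_le_right _ _
  · exact setIntegral_mono (hi.mono_set hsub) ((h.integrable.mono_set hsub).const_mul n)
      fun s => min_le_left _ _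

/-- If `n v ≤ 1` beyond `T`, the tail integral of `v` is controlled. -/
lemma IsProfile.tail_le (h : IsProfile v) {n T : ℝ} (hn : 0 < n) (hT : 0 ≤ T)
    (hv : n * v T ≤ 1) : ∫ s in Set.Ioi T, v s ≤ n⁻¹ * truncMean v n := by
  have hi := h.integrable_min hn.le
  have hsub : Set.Ioi T ⊆ Set.Ioi 0 := Set.Ioi_subset_Ioi hT
  rw [le_inv_mul_iff₀ hn, ← integral_const_mul]
  calc ∫ s in Set.Ioi T, n * v s = ∫ s in Set.Ioi T, min (n * v s) 1 :=
        setIntegral_congr_fun measurableSet_Ioi fun s hs =>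
          (min_eq_left ((mul_le_mul_of_nonneg_left (h.antitone (le_of_lt hs)) hn.le).trans hv)).symm
    _ ≤ ∫ s in Set.Ioi 0, min (n * v s) 1 := setIntegral_mono_set hi
        (ae_of_all _ fun s => le_min (mul_nonneg hn.le (h.nonneg s)) zero_le_one)
        (Filter.Eventually.of_forall hsub)
    _ ≤ _ := le_add_of_nonneg_left zero_le_one

variable {g : ℝ → ℝ}

/-- If `v ∼ 1 / g⁻¹`, then `1 + ∫ min (n v, 1) ∼ g n`. -/
theorem IsProfile.truncMean_equiv (h : IsProfile v) (hg : IsRegularFun g)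
    (hv : EquivOn (fun t : ℝ => 1 ≤ t) v (fun t => 1 / genInv g t)) :
    EquivOn (fun n : ℝ => 1 ≤ n) (truncMean v) g := by
  obtain ⟨A, hA, hv⟩ := hv
  obtain ⟨c, d, p, hc, hd, hp, hcg, hG⟩ := hg.exists_rpow_le_genInv
  have h0 := hg.1
  have hg1 := h0 1 le_rfl
  refine EquivOn.of_le (A := 2 * (c / g 1) + c + A * d ^ p * (c ^ (1 - p) / (p - 1)))
    (B := (min A⁻¹ 1)⁻¹) ?_ (fun n hn => zero_le_one.trans
      (h.one_le_truncMean (by linarith))) (fun n hn => (h0 n hn).le) (fun n hn => ?_)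
    fun n hn => ?_
  · have : 0 < p - 1 := by linarith
    positivity
  · have hgn := h0 n hn
    have hn0 : 0 < n := by linarith
    have hp1 : 0 < p - 1 := by linarith
    -- Beyond T both the hypothesis on v (t ≥ 1) and the power bound for `genInv` (t ≥ c g n) apply.
    set T := max 1 (c * g n) with hT
    have hT0 : 0 < T := by positivity
    have hsub : Set.Ioi T ⊆ Set.Ioi 0 := Set.Ioi_subset_Ioi hT0.le
    have hlt : -p < -1 := by linarith
    -- The tail is at most a constant times n⁻¹ (g n)^p T^(1−p); as p > 1 and T ≥ c g n, the powers
    -- of g n combine to g n.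
    have key : n * ∫ s in Set.Ioi T, v s ≤ A * d ^ p * (c ^ (1 - p) / (p - 1)) * g n := by
      have h1 : ∀ t ∈ Set.Ioi T, v t ≤ A * (n⁻¹ * (d * g n) ^ p * t ^ (-p)) := by
        intro t ht
        have htT : T ≤ t := le_of_lt ht
        have ht1 : 1 ≤ t := (le_max_left _ _).trans htT
        have ht0 : 0 < t := by linarith
        have h2 := hG n t hn ht0 (Or.inl ((le_max_right _ _).trans htT))
        refine (hv t ht1).2.trans (mul_le_mul_of_nonneg_left ?_ hA.le)
        have h3 : 0 < n * (t / (d * g n)) ^ p := by positivity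
        refine (one_div_le_one_div_of_le h3 h2).trans (le_of_eq ?_)
        rw [Real.div_rpow ht0.le (by positivity), Real.rpow_neg ht0.le]
        have : 0 < t ^ p := by positivity
        have : 0 < (d * g n) ^ p := by positivity
        field_simp
      have hint := integrableOn_Ioi_rpow_of_lt hlt hT0
      have h2 : ∫ s in Set.Ioi T, v s
          ≤ A * (n⁻¹ * (d * g n) ^ p * (T ^ (1 - p) / (p - 1))) := by
        refine (setIntegral_mono_on (h.integrable.mono_set hsub)
          ((hint.const_mul _).const_mul A) measurableSet_Ioi h1).trans (le_of_eq ?_)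
        rw [integral_const_mul, integral_const_mul, integral_Ioi_rpow_of_lt hlt hT0]
        rw [show -p + 1 = -(p - 1) by ring, show 1 - p = -(p - 1) by ring, neg_div_neg_eq]
      have h3 : T ^ (1 - p) ≤ (c * g n) ^ (1 - p) :=
        Real.rpow_le_rpow_of_nonpos (by positivity) (le_max_right _ _) (by linarith)
      calc n * ∫ s in Set.Ioi T, v s
          ≤ n * (A * (n⁻¹ * (d * g n) ^ p * ((c * g n) ^ (1 - p) / (p - 1)))) := by
            refine mul_le_mul_of_nonneg_left (h2.trans ?_) hn0.le
            gcongr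
        _ = A * ((d * g n) ^ p * ((c * g n) ^ (1 - p) / (p - 1))) := by
            field_simp
        _ = A * d ^ p * (c ^ (1 - p) / (p - 1)) * ((g n) ^ p * (g n) ^ (1 - p)) := by
            rw [Real.mul_rpow hd.le hgn.le, Real.mul_rpow hc.le hgn.le]; ring
        _ = _ := by
            rw [← Real.rpow_add hgn]; simp
    have h4 : (1 : ℝ) ≤ c / g 1 * g n := by
      rw [div_mul_eq_mul_div, le_div_iff₀ hg1, one_mul]; exact hcg n hn
    have h5 : T ≤ 1 + c * g n := max_le (le_add_of_nonneg_right (by positivity)) (by linarith)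
    have h6 := h.truncMean_le hn0.le hT0.le
    nlinarith
  · have hgn := h0 n hn
    have hn0 : 0 < n := by linarith
    have hm : 0 < min A⁻¹ 1 := by positivity
    have hm1 : min A⁻¹ 1 ≤ 1 := min_le_right _ _
    rw [le_inv_mul_iff₀ hm]
    rcases le_total (g n) 1 with hg1 | hg1
    · exact (mul_le_one₀ hm1 hgn.le hg1).trans (h.one_le_truncMean hn0.le)
    · refine le_trans ?_ (h.le_truncMean (m := min A⁻¹ 1) hn0.le hm1 hgn.le fun s hs hsg => ?_)
      · linarith
      -- The equivalence is only assumed from 1 on; smaller s are handled by monotonicity of v.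
      · have h1 : v (max s 1) ≤ v s := h.antitone (le_max_left _ _)
        have h2 := (hv (max s 1) (le_max_right _ _)).1
        have h3 : genInv g (max s 1) ≤ n := genInv_le hn (max_le hsg hg1)
        have h4 := hg.one_le_genInv (max s 1)
        have h5 : 1 / n ≤ 1 / genInv g (max s 1) := one_div_le_one_div_of_le (by linarith) h3
        refine (min_le_left _ _).trans ?_
        have h6 : A⁻¹ * (1 / n) ≤ v s :=
          (mul_le_mul_of_nonneg_left h5 (by positivity)).trans (h2.trans h1)
        calc A⁻¹ = n * (A⁻¹ * (1 / n)) := by field_simp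
          _ ≤ n * v s := mul_le_mul_of_nonneg_left h6 hn0.le

/-- If `1 + ∫ min (n v, 1) ∼ g n`, then `v ∼ 1 / g⁻¹`. -/
theorem IsProfile.equiv_of_truncMean (h : IsProfile v) (hg : IsRegularFun g)
    (hv : EquivOn (fun n : ℝ => 1 ≤ n) (truncMean v) g) :
    EquivOn (fun t : ℝ => 1 ≤ t) v (fun t => 1 / genInv g t) := by
  obtain ⟨A, hA, hv⟩ := hv
  have h0 := hg.1
  have hGpos : ∀ t, 0 < genInv g t := fun t => zero_lt_one.trans_le (hg.one_le_genInv t)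
  obtain ⟨C, hC, hCg⟩ := hg.exists_dilation A
  obtain ⟨c, d, α, β, hc, -, hd, hα, hβ, hβ1, hcd⟩ := hg.exists_le
  -- L is fixed so that g(L s) is too large for the upper bound (A + 2) A g s on the truncated mean;
  -- then x is taken so large that x^(1−β), with β < 1, makes the tail term negligible.
  obtain ⟨L, hL, hLg⟩ := hg.exists_dilation (A * ((A + 2) * A))
  have hL0 : 0 < L := by linarith
  have ht : Filter.Tendsto (fun x : ℝ => x ^ (1 - β)) Filter.atTop Filter.atTop :=
    tendsto_rpow_atTop (by linarith)
  obtain ⟨x, hx, hx1⟩ := ((ht.eventually_gt_atTop (L * (A * d * A))).and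
    (Filter.eventually_ge_atTop 1)).exists
  have hx0 : 0 < x := by linarith
  -- If v t were below 1/(x s), the integral beyond t would be controlled by the truncated mean at x
  -- s. Then `truncMean v (L * s)` ≤ 1 + t + L s · tail would stay below (A + 2) A g s, against the
  -- choice of L.
  have low : ∀ t s, 0 ≤ t → 1 ≤ s → t ≤ g s → 1 / (x * s) ≤ v t := by
    intro t s ht0 hs hts
    by_contra hlt
    push Not at hlt
    have hgs := h0 s hs
    have hs0 : 0 < s := by linarith
    have hxs : 1 ≤ x * s := one_le_mul_of_one_le_of_one_le hx1 hs
    have h1 : x * s * v t ≤ 1 := by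
      rw [lt_div_iff₀ (by positivity)] at hlt; linarith
    have hI := h.tail_le (by positivity : 0 < x * s) ht0 h1
    have h2 := h.truncMean_le (n := L * s) (by positivity) ht0
    have h3 : truncMean v (x * s) ≤ A * d * x ^ β * g s := by
      refine (hv _ hxs).2.trans ?_
      have := (hcd s (x * s) hs (le_mul_of_one_le_left hs0.le hx1)).2
      rw [mul_div_assoc, div_self hs0.ne', mul_one] at this
      calc A * g (x * s) ≤ A * (d * x ^ β * g s) := mul_le_mul_of_nonneg_left this hA.le
        _ = _ := by ring
    have h4 : L * s * ∫ r in Set.Ioi t, v r ≤ L * (A * d * A) * x ^ (-(1 - β)) * (A⁻¹ * g s) := by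
      calc L * s * ∫ r in Set.Ioi t, v r
          ≤ L * s * ((x * s)⁻¹ * (A * d * x ^ β * g s)) := by
            refine mul_le_mul_of_nonneg_left (hI.trans ?_) (by positivity)
            exact mul_le_mul_of_nonneg_left h3 (by positivity)
        _ = L * (A * d * A) * (x ^ β * x⁻¹) * (A⁻¹ * g s) := by field_simp
        _ = _ := by
            rw [← Real.rpow_neg_one x, ← Real.rpow_add hx0]; ring_nf
    have hxb : 0 < x ^ (1 - β) := by positivity
    have h5 : L * (A * d * A) * x ^ (-(1 - β)) ≤ 1 := by
      rw [Real.rpow_neg hx0.le, ← div_eq_mul_inv, div_le_one hxb]; exact hx.le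
    have hgA : A⁻¹ * g s ≤ truncMean v s := (hv s hs).1
    have hpos : 0 < A⁻¹ * g s := by positivity
    have h6 : g (L * s) ≤ A * truncMean v (L * s) := by
      rw [← inv_mul_le_iff₀ hA]
      exact (hv _ (one_le_mul_of_one_le_of_one_le hL hs)).1
    have h7 := hLg s hs
    have h8 := h.one_le_truncMean hs0.le
    have h9 : truncMean v (L * s) < (A + 2) * (A * g s) := by
      have e1 : L * (A * d * A) * x ^ (-(1 - β)) * (A⁻¹ * g s) ≤ A⁻¹ * g s :=
        mul_le_of_le_one_left hpos.le h5
      have e2 : truncMean v s ≤ A * g s := (hv s hs).2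
      have e3 : g s ≤ A * truncMean v s := by rw [← inv_mul_le_iff₀ hA]; exact hgA
      have e4 : A * truncMean v s ≤ A * (A * g s) := mul_le_mul_of_nonneg_left e2 hA.le
      have e5 : L * s * ∫ r in Set.Ioi t, v r < 1 * (A⁻¹ * g s) := by
        refine h4.trans_lt (mul_lt_mul_of_pos_right ?_ hpos)
        rw [Real.rpow_neg hx0.le, ← div_eq_mul_inv, div_lt_one hxb]; exact hx
      nlinarith
    have h10 : A * ((A + 2) * A) * g s < A * ((A + 2) * (A * g s)) := by
      refine lt_of_le_of_lt (h7.trans h6) (mul_lt_mul_of_pos_left h9 hA)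
    linarith
  refine EquivOn.of_le (A := C) (B := x) (by positivity) (fun t _ => h.nonneg t)
    (fun t _ => one_div_nonneg.2 (hGpos t).le) (fun t ht => ?_) fun t ht => ?_
  · rw [mul_one_div, le_div_iff₀ (hGpos t)]
    rcases (h.nonneg t).eq_or_lt with h1 | h1
    · rw [← h1, zero_mul]; positivity
    -- At n = 1 / v t the truncated integrand equals 1 on (0, t], which bounds t by A g n.
    · have hn : 1 ≤ 1 / v t := (one_le_div h1).2 (h.le_one t)
      have h2 := h.le_truncMean (n := 1 / v t) (m := 1) (T := t) (by positivity) le_rfl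
        (by linarith) fun s _ hst => by
          rw [one_div_mul_eq_div, one_le_div h1]; exact h.antitone hst
      have h3 : t ≤ A * g (1 / v t) := by linarith [(hv _ hn).2]
      have h4 := genInv_le (one_le_mul_of_one_le_of_one_le hC hn) (h3.trans (hCg _ hn))
      calc v t * genInv g t ≤ v t * (C * (1 / v t)) := mul_le_mul_of_nonneg_left h4 h1.le
        _ = C := by field_simp
  · rw [div_le_iff₀ (hGpos t)]
    have hv0 : 0 < v t := by
      obtain ⟨s, hs, hts⟩ := hg.nonempty_genInv t
      have := low t s (by linarith) hs hts
      exact lt_of_lt_of_le (by positivity) this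
    have h1 : 1 / (x * v t) ≤ genInv g t := hg.le_genInv fun s hs hts => by
      have h2 := low t s (by linarith) hs hts
      have hs0 : 0 < s := by linarith
      rw [div_le_iff₀ (by positivity)] at h2 ⊢
      linarith
    rw [div_le_iff₀ (by positivity)] at h1
    linarith

end Profile

/-! ### Interpolation of sequences -/

section Extension

lemma plExt_natCast (Φ : ℕ → ℝ) (n : ℕ) : plExt Φ n = Φ n := by
  simp [plExt]

lemma plExt_mem_Icc {Φ : ℕ → ℝ} {s a b : ℝ} (hs : 0 ≤ s) (h0 : Φ ⌊s⌋₊ ∈ Set.Icc a b)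
    (h1 : Φ (⌊s⌋₊ + 1) ∈ Set.Icc a b) : plExt Φ s ∈ Set.Icc a b := by
  have h2 := Nat.floor_le hs
  have h3 := (Nat.lt_floor_add_one s).le
  exact (convex_Icc a b) h0 h1 (show 0 ≤ 1 - (s - ⌊s⌋₊) by linarith)
    (show 0 ≤ s - ⌊s⌋₊ by linarith) (sub_add_cancel _ _)

/-- A function on `[1, ∞)` which is monotone and at most doubles with its argument is equivalent to
the interpolation of any equivalent sequence. -/
lemma plExt_equiv {Φ : ℕ → ℝ} {h : ℝ → ℝ} (hh : ∀ s t, 1 ≤ s → s ≤ t → h s ≤ h t)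
    (hd : ∀ s, 1 ≤ s → h (2 * s) ≤ 2 * h s)
    (H : EquivOn (fun n : ℕ => 1 ≤ n) Φ (fun n => h n)) :
    EquivOn (fun s : ℝ => 1 ≤ s) (plExt Φ) h := by
  obtain ⟨A, hA, H⟩ := H
  refine ⟨2 * A, by positivity, fun s hs => ?_⟩
  have hm : 1 ≤ ⌊s⌋₊ := (Nat.one_le_floor_iff s).2 hs
  have hm' : (1 : ℝ) ≤ ⌊s⌋₊ := by exact_mod_cast hm
  have h2 := Nat.floor_le (zero_le_one.trans hs)
  have h3 := (Nat.lt_floor_add_one s).le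
  have h4 := hh _ _ hm' h2
  have h5 := hh _ _ hs h3
  have h6 := hd _ hm'
  have h7 := hh (⌊s⌋₊ + 1) (2 * ⌊s⌋₊) (by linarith) (by linarith)
  have h8 := hh _ _ hs (by linarith : s ≤ 2 * ⌊s⌋₊)
  have hAi : 0 < A⁻¹ := inv_pos.2 hA
  refine plExt_mem_Icc (zero_le_one.trans hs) ⟨(?_ : _ ≤ _), (?_ : _ ≤ _)⟩
    ⟨(?_ : _ ≤ _), (?_ : _ ≤ _)⟩
  · refine le_trans ?_ (H _ hm).1
    rw [mul_inv]; nlinarith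
  · refine (H _ hm).2.trans ?_
    nlinarith
  · refine le_trans ?_ (H _ (by omega)).1
    push_cast
    rw [mul_inv]; nlinarith
  · refine (H _ (by omega)).2.trans ?_
    push_cast
    nlinarith

/-- The interpolation of a regular sequence is a regular function. -/
lemma IsRegularSeq.isRegularFun_plExt {Φ : ℕ → ℝ} (h : IsRegularSeq Φ) (h0 : ∀ n, 0 ≤ Φ n) :
    IsRegularFun (plExt Φ) := by
  obtain ⟨c, d, α, β, hc, hd, hα, hαβ, hβ, h⟩ := h
  have hpos : ∀ n : ℕ, 1 ≤ n → 0 < Φ n := fun n hn => by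
    -- If Φ n = 0, then Φ n / Φ n = 0 by the convention on division, which violates the lower bound
    -- c > 0 at k = n.
    refine (h0 n).lt_of_ne fun e => ?_
    have h1 := (h n n hn le_rfl).1
    rw [← e, div_zero, div_self (by positivity), Real.one_rpow, mul_one] at h1
    linarith
  set a := min 1 c with ha
  set b := max 1 (d * 2 ^ β) with hb
  have ha0 : 0 < a := by positivity
  have hb0 : 0 < b := by positivity
  -- Neighbouring values are comparable because (m + 1)/m lies in [1, 2], so the interpolation is
  -- comparable to its value at the floor.
  have key : ∀ s : ℝ, 1 ≤ s → a * Φ ⌊s⌋₊ ≤ plExt Φ s ∧ plExt Φ s ≤ b * Φ ⌊s⌋₊ := by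
    intro s hs
    have hm : 1 ≤ ⌊s⌋₊ := (Nat.one_le_floor_iff s).2 hs
    have hm' : (1 : ℝ) ≤ ⌊s⌋₊ := by exact_mod_cast hm
    have hp := hpos _ hm
    obtain ⟨h1, h2⟩ := h ⌊s⌋₊ (⌊s⌋₊ + 1) hm (by omega)
    have hr1 : (1 : ℝ) ≤ ((⌊s⌋₊ + 1 : ℕ) : ℝ) / ⌊s⌋₊ := by
      rw [one_le_div (by positivity)]; push_cast; linarith
    have hr2 : ((⌊s⌋₊ + 1 : ℕ) : ℝ) / ⌊s⌋₊ ≤ 2 := by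
      rw [div_le_iff₀ (by positivity)]; push_cast; linarith
    rw [le_div_iff₀ hp] at h1
    rw [div_le_iff₀ hp] at h2
    refine plExt_mem_Icc (by linarith) ⟨(?_ : _ ≤ _), (?_ : _ ≤ _)⟩ ⟨(?_ : _ ≤ _), (?_ : _ ≤ _)⟩
    · exact mul_le_of_le_one_left hp.le (min_le_left _ _)
    · exact le_mul_of_one_le_left hp.le (le_max_left _ _)
    · refine le_trans (mul_le_mul_of_nonneg_right ?_ hp.le) h1
      exact (min_le_right _ _).trans (le_mul_of_one_le_right hc.le (Real.one_le_rpow hr1 hα.le))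
    · refine h2.trans (mul_le_mul_of_nonneg_right ?_ hp.le)
      refine le_trans ?_ (le_max_right _ _)
      exact mul_le_mul_of_nonneg_left (Real.rpow_le_rpow (by linarith) hr2 (by linarith)) hd.le
  have hp : ∀ s : ℝ, 1 ≤ s → 0 < Φ ⌊s⌋₊ := fun s hs => hpos _ ((Nat.one_le_floor_iff s).2 hs)
  have hpl : ∀ s : ℝ, 1 ≤ s → 0 < plExt Φ s := fun s hs =>
    (mul_pos ha0 (hp s hs)).trans_le (key s hs).1
  refine ⟨hpl, a / b * c * (1 / 2) ^ α, b / a * d * 2 ^ β, α, β, by positivity, by positivity,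
    hα, hαβ, hβ, fun s t hs hst => ?_⟩
  have ht : 1 ≤ t := hs.trans hst
  have hs0 : 0 < s := by linarith
  have ht0 : 0 < t := by linarith
  have hm : 1 ≤ ⌊s⌋₊ := (Nat.one_le_floor_iff s).2 hs
  have hm' : (1 : ℝ) ≤ ⌊s⌋₊ := by exact_mod_cast hm
  have hn' : (1 : ℝ) ≤ ⌊t⌋₊ := by exact_mod_cast (Nat.one_le_floor_iff t).2 ht
  have f1 := Nat.floor_le hs0.le
  have f2 := (Nat.lt_floor_add_one s).le
  have f3 := Nat.floor_le ht0.le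
  have f4 := (Nat.lt_floor_add_one t).le
  obtain ⟨h1, h2⟩ := h ⌊s⌋₊ ⌊t⌋₊ hm (Nat.floor_mono hst)
  have hps := hp s hs
  have hpt := hp t ht
  have hts : 0 < t / s := by positivity
  have hα1 : (1 / 2 : ℝ) ^ α * (t / s) ^ α ≤ ((⌊t⌋₊ : ℝ) / ⌊s⌋₊) ^ α := by
    rw [← Real.mul_rpow (by norm_num) hts.le]
    refine Real.rpow_le_rpow (by positivity) ?_ hα.le
    calc 1 / 2 * (t / s) = (t / 2) / s := by ring
      _ ≤ (⌊t⌋₊ : ℝ) / s := by gcongr; linarith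
      _ ≤ (⌊t⌋₊ : ℝ) / ⌊s⌋₊ := by gcongr
  have hβ1 : ((⌊t⌋₊ : ℝ) / ⌊s⌋₊) ^ β ≤ 2 ^ β * (t / s) ^ β := by
    rw [← Real.mul_rpow (by norm_num) hts.le]
    refine Real.rpow_le_rpow (by positivity) ?_ (by linarith)
    calc (⌊t⌋₊ : ℝ) / ⌊s⌋₊ ≤ t / (s / 2) := by gcongr; linarith
      _ = 2 * (t / s) := by field_simp
  constructor
  · calc a / b * c * (1 / 2) ^ α * (t / s) ^ α = a / b * (c * ((1 / 2) ^ α * (t / s) ^ α)) := by ring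
      _ ≤ a / b * (Φ ⌊t⌋₊ / Φ ⌊s⌋₊) := by
          refine mul_le_mul_of_nonneg_left (le_trans ?_ h1) (by positivity)
          exact mul_le_mul_of_nonneg_left hα1 hc.le
      _ = (a * Φ ⌊t⌋₊) / (b * Φ ⌊s⌋₊) := div_mul_div_comm _ _ _ _
      _ ≤ plExt Φ t / plExt Φ s :=
          div_le_div₀ (hpl t ht).le (key t ht).1 (hpl s hs) (key s hs).2
  · calc plExt Φ t / plExt Φ s ≤ (b * Φ ⌊t⌋₊) / (a * Φ ⌊s⌋₊) :=
          div_le_div₀ (by positivity) (key t ht).2 (by positivity) (key s hs).1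
      _ = b / a * (Φ ⌊t⌋₊ / Φ ⌊s⌋₊) := (div_mul_div_comm _ _ _ _).symm
      _ ≤ b / a * (d * (2 ^ β * (t / s) ^ β)) := by
          refine mul_le_mul_of_nonneg_left (h2.trans ?_) (by positivity)
          exact mul_le_mul_of_nonneg_left hβ1 hd.le
      _ = _ := by ring

lemma fundC_nonneg {E : Type*} [AddCommGroup E] [Module ℂ E] (N : MatrixNorms E)
    (J : Ell2 ≃ₗ[ℂ] E) (n : ℕ) : 0 ≤ fundC N J n := sq_nonneg _

lemma fundR_nonneg {E : Type*} [AddCommGroup E] [Module ℂ E] (N : MatrixNorms E)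
    (J : Ell2 ≃ₗ[ℂ] E) (n : ℕ) : 0 ≤ fundR N J n := sq_nonneg _

end Extension

/-! ### Normalized pairs of weights -/

section Normalized

variable {wc wr : ℝ → ℝ}

/-- The reflection of the line exchanges the two weights. -/
lemma IsNormalized.reflect (h : IsNormalized wc wr) :
    IsNormalized (fun s => wr (-s)) (fun s => wc (-s)) where
  nonneg_c s := h.nonneg_r _
  nonneg_r s := h.nonneg_c _
  one_c s hs := h.one_r _ (by linarith)
  one_r s hs := h.one_c _ (by linarith)
  monotone_c := fun s t hst => h.antitone_r (by linarith)
  antitone_r := fun s t hst => h.monotone_c (by linarith)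
  left_cont_c s := (h.right_cont_r (-s)).comp continuous_neg.continuousWithinAt
    (by intro t ht; simpa using ht)
  right_cont_r s := (h.left_cont_c (-s)).comp continuous_neg.continuousWithinAt
    (by intro t ht; simpa using ht)
  integrable_c := by
    have := IntegrableOn.comp_neg_Iic (c := 0) (f := wr) (by simpa using h.integrable_r)
    simpa using this
  integrable_r := by
    have := IntegrableOn.comp_neg_Ici (c := 0) (f := wc) (by simpa using h.integrable_c)
    simpa using this
  integral_c := by
    rw [integral_comp_neg_Iic, neg_zero, ← integral_Ici_eq_integral_Ioi]; exact h.integral_r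
  integral_r := by
    rw [integral_Ici_eq_integral_Ioi, integral_comp_neg_Ioi, neg_zero]; exact h.integral_c

lemma IsNormalized.isProfile_r (h : IsNormalized wc wr) : IsProfile wr :=
  ⟨h.nonneg_r, h.one_r, h.antitone_r, h.integrable_r.mono_set Set.Ioi_subset_Ici_self⟩

lemma IsNormalized.isProfile_c (h : IsNormalized wc wr) : IsProfile (fun s => wc (-s)) :=
  h.reflect.isProfile_r

lemma IsNormalized.isWeightPair (h : IsNormalized wc wr) : IsWeightPair volume wc wr where
  measurable_c := h.monotone_c.measurable
  measurable_r := h.antitone_r.measurable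
  nonneg_c := h.nonneg_c
  nonneg_r := h.nonneg_r
  integrable_min := by
    have hm : AEStronglyMeasurable (fun s => min (wc s) (wr s)) volume :=
      (h.monotone_c.measurable.min h.antitone_r.measurable).aestronglyMeasurable
    rw [← integrableOn_univ, ← Set.Iic_union_Ici (a := (0 : ℝ))]
    refine IntegrableOn.union ?_ ?_
    · refine Integrable.mono' h.integrable_c hm.restrict (ae_of_all _ fun s => ?_)
      rw [Real.norm_of_nonneg (le_min (h.nonneg_c s) (h.nonneg_r s))]; exact min_le_left _ _
    · refine Integrable.mono' h.integrable_r hm.restrict (ae_of_all _ fun s => ?_)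
      rw [Real.norm_of_nonneg (le_min (h.nonneg_c s) (h.nonneg_r s))]; exact min_le_right _ _

/-- On the negative half line w_c ≤ 1 ≤ n = n w_r, so the minimum is w_c and contributes the
normalised integral 1; on the positive half line w_c = 1. -/
lemma IsNormalized.kWeight_one_right (h : IsNormalized wc wr) {n : ℝ} (hn : 1 ≤ n) :
    kWeight volume wc wr 1 n = truncMean wr n := by
  have hi := h.isWeightPair.integrable_min_mul zero_le_one (by linarith : 0 ≤ n)
  rw [kWeight, ← intervalIntegral.integral_Iic_add_Ioi (b := 0) hi.integrableOn hi.integrableOn,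
    truncMean]
  congr 1
  · refine Eq.trans ?_ h.integral_c
    rw [integral_Iic_eq_integral_Iio, integral_Iic_eq_integral_Iio]
    refine setIntegral_congr_fun measurableSet_Iio fun s hs => ?_
    have h1 := h.isProfile_c.le_one (-s)
    simp only [neg_neg] at h1
    simp only [h.one_r s hs, one_mul, mul_one]
    exact min_eq_left (h1.trans hn)
  · refine setIntegral_congr_fun measurableSet_Ioi fun s hs => ?_
    simp only [h.one_c s hs, one_mul]
    exact min_comm _ _

lemma IsNormalized.kWeight_one_left (h : IsNormalized wc wr) {n : ℝ} (hn : 1 ≤ n) :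
    kWeight volume wc wr n 1 = truncMean (fun s => wc (-s)) n := by
  rw [← h.reflect.kWeight_one_right hn, kWeight, kWeight, ← integral_neg_eq_self]
  exact integral_congr_ae (ae_of_all _ fun s => min_comm _ _)

lemma IsNormalized.kWeight_pos (h : IsNormalized wc wr) : 0 < kWeight volume wc wr 1 1 := by
  rw [h.kWeight_one_right le_rfl]
  exact zero_lt_one.trans_le (h.isProfile_r.one_le_truncMean zero_le_one)

/-- Every regular function is, up to equivalence, the inverse of the reciprocal of a normalised
strictly positive profile. -/
lemma IsRegularFun.exists_profile {g : ℝ → ℝ} (hg : IsRegularFun g) : ∃ v : ℝ → ℝ,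
    IsProfile v ∧ (∀ s, 0 < v s) ∧ (∀ s, ContinuousWithinAt v (Set.Ici s) s) ∧
      ∫ s in Set.Ioi 0, v s = 1 ∧ EquivOn (fun t : ℝ => 1 ≤ t) v (fun t => 1 / genInv g t) := by
  -- The right continuous version of `genInv g`; it lies between genInv g t and genInv g u for every
  -- u > t.
  set f := hg.monotone_genInv.stieltjesFunction with hf
  have hfG : ∀ t, genInv g t ≤ f t := fun t => by
    rw [hf, Monotone.stieltjesFunction_eq]; exact hg.monotone_genInv.le_rightLim le_rfl
  have hfG' : ∀ t u, t < u → f t ≤ genInv g u := fun t u htu => by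
    rw [hf, Monotone.stieltjesFunction_eq]; exact hg.monotone_genInv.rightLim_le htu
  have hG0 : ∀ t, 0 < genInv g t := fun t => zero_lt_one.trans_le (hg.one_le_genInv t)
  have hf1 : ∀ t, 1 ≤ f t := fun t => (hg.one_le_genInv t).trans (hfG t)
  have hf0 : ∀ t, 0 < f t := fun t => zero_lt_one.trans_le (hf1 t)
  have hanti : Antitone fun t => (f t)⁻¹ := fun s t hst => inv_anti₀ (hf0 s) (f.mono hst)
  have hint : IntegrableOn (fun t => (f t)⁻¹) (Set.Ici 1) := by
    obtain ⟨c, d, p, hc, hd, hp, -, hG⟩ := hg.exists_rpow_le_genInv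
    have hg1 := hg.1 1 le_rfl
    rw [integrableOn_Ici_iff_integrableOn_Ioi]
    refine Integrable.mono' ((integrableOn_Ioi_rpow_of_lt (by linarith : -p < -1)
      one_pos).const_mul ((d * g 1) ^ p)) hanti.measurable.aestronglyMeasurable ?_
    refine (ae_restrict_iff' measurableSet_Ioi).2 (ae_of_all _ fun t ht => ?_)
    have ht0 : 0 < t := zero_lt_one.trans ht
    rw [Real.norm_of_nonneg (inv_nonneg.2 (hf0 t).le)]
    have h1 := (hG 1 t le_rfl ht0 (Or.inr rfl)).trans (hfG t)
    rw [one_mul] at h1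
    refine (inv_anti₀ (by positivity) h1).trans (le_of_eq ?_)
    rw [Real.div_rpow ht0.le (by positivity), Real.rpow_neg ht0.le, inv_div, div_eq_mul_inv]
  set I := ∫ t in Set.Ici 1, (f t)⁻¹ with hI
  have hI0 : 0 ≤ I := integral_nonneg fun t => inv_nonneg.2 (hf0 t).le
  -- With ε ≤ 1/2 and ε I ≤ 1/2, the value 1 − ε I on [0, 1) stays above the values ε / f that
  -- follow, and the integral is (1 − ε I) + ε I = 1.
  set ε := (2 * (1 + I))⁻¹ with hε
  have hε0 : 0 < ε := by positivity
  have hε2 : ε ≤ 1 / 2 := by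
    rw [hε, ← one_div]; exact one_div_le_one_div_of_le two_pos (by linarith)
  have hεI : ε * I ≤ 1 / 2 := by
    rw [hε, inv_mul_le_iff₀ (by positivity)]; linarith
  let v : ℝ → ℝ := fun t => if t < 0 then 1 else if t < 1 then 1 - ε * I else ε * (f t)⁻¹
  have v0 : ∀ t, t < 0 → v t = 1 := fun t ht => if_pos ht
  have v1 : ∀ t, 0 ≤ t → t < 1 → v t = 1 - ε * I := fun t ht ht' => by
    simp only [v, if_neg (not_lt.2 ht), if_pos ht']
  have v2 : ∀ t, 1 ≤ t → v t = ε * (f t)⁻¹ := fun t ht => by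
    simp only [v, if_neg (not_lt.2 ht), if_neg (not_lt.2 (zero_le_one.trans ht))]
  have hle : ∀ t, ε * (f t)⁻¹ ≤ 1 / 2 := fun t =>
    (mul_le_of_le_one_right hε0.le (inv_le_one_of_one_le₀ (hf1 t))).trans hε2
  have hpos : ∀ s, 0 < v s := fun s => by
    rcases lt_or_ge s 0 with h | h
    · rw [v0 s h]; exact one_pos
    rcases lt_or_ge s 1 with h' | h'
    · rw [v1 s h h']; linarith
    · rw [v2 s h']; have := hf0 s; positivity
  have hvanti : Antitone v := by
    intro s t hst
    rcases lt_or_ge s 0 with hs | hs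
    · rw [v0 s hs]
      rcases lt_or_ge t 0 with h | h
      · rw [v0 t h]
      rcases lt_or_ge t 1 with h' | h'
      · rw [v1 t h h']; linarith [mul_nonneg hε0.le hI0]
      · rw [v2 t h']; linarith [hle t]
    rcases lt_or_ge s 1 with hs' | hs'
    · rw [v1 s hs hs']
      rcases lt_or_ge t 1 with h' | h'
      · rw [v1 t (hs.trans hst) h']
      · rw [v2 t h']; linarith [hle t]
    · rw [v2 s hs', v2 t (hs'.trans hst)]
      exact mul_le_mul_of_nonneg_left (hanti hst) hε0.le
  have e1 : Set.EqOn v (fun _ => 1 - ε * I) (Set.Ioo 0 1) := fun t ht => v1 t ht.1.le ht.2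
  have e2 : Set.EqOn v (fun t => ε * (f t)⁻¹) (Set.Ici 1) := fun t ht => v2 t ht
  have i1 : IntegrableOn v (Set.Ioo 0 1) :=
    (integrableOn_congr_fun e1 measurableSet_Ioo).2 (by simp)
  have i2 : IntegrableOn v (Set.Ici 1) :=
    (integrableOn_congr_fun e2 measurableSet_Ici).2 (hint.const_mul ε)
  have hu : Set.Ioo (0 : ℝ) 1 ∪ Set.Ici 1 = Set.Ioi 0 := Set.Ioo_union_Ici_eq_Ioi one_pos
  refine ⟨v, ⟨fun s => (hpos s).le, v0, hvanti, hu ▸ i1.union i2⟩, hpos, fun s => ?_, ?_, ?_⟩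
  · rcases lt_or_ge s 0 with h | h
    · refine (continuousAt_const (y := (1 : ℝ)).congr ?_).continuousWithinAt
      filter_upwards [Iio_mem_nhds h] with t ht using (v0 t ht).symm
    rcases lt_or_ge s 1 with h' | h'
    · refine (continuousWithinAt_const (b := 1 - ε * I)).congr_of_eventuallyEq ?_ (v1 s h h')
      filter_upwards [self_mem_nhdsWithin, mem_nhdsWithin_of_mem_nhds (Iio_mem_nhds h')] with t ht ht'
        using v1 t (h.trans ht) ht'
    · refine ContinuousWithinAt.congr (f := fun t => ε * (f t)⁻¹) ?_
        (fun t ht => v2 t (h'.trans ht)) (v2 s h')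
      exact continuousWithinAt_const.mul ((f.right_continuous s).inv₀ (hf0 s).ne')
  · rw [← hu, setIntegral_union ?_ measurableSet_Ici i1 i2, setIntegral_congr_fun measurableSet_Ioo e1,
      setIntegral_congr_fun measurableSet_Ici e2, integral_const_mul, ← hI]
    · simp
    · exact Set.disjoint_left.2 fun t ht ht' => not_lt.2 ht' ht.2
  · obtain ⟨L, hL, hG2⟩ := hg.exists_genInv_mul_le 2 zero_le_two
    refine EquivOn.of_le (A := 1) (B := ε⁻¹ * L) one_pos (fun t _ => (hpos t).le)
      (fun t _ => one_div_nonneg.2 (hG0 t).le) (fun t ht => ?_) fun t ht => ?_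
    · rw [v2 t ht, one_div]
      have := inv_anti₀ (hG0 t) (hfG t)
      exact mul_le_mul (hε2.trans (by norm_num)) this (inv_nonneg.2 (hf0 t).le) zero_le_one
    · have h1 : f t ≤ L * genInv g t := (hfG' t (2 * t) (by linarith)).trans (hG2 t)
      have h2 := hf0 t
      have h3 := hG0 t
      rw [v2 t ht, mul_mul_mul_comm, mul_comm, div_le_iff₀ h3]
      field_simp
      linarith

lemma IsProfile.isNormalized {v v' : ℝ → ℝ} (h : IsProfile v) (h' : IsProfile v')
    (hc : ∀ s, ContinuousWithinAt v (Set.Ici s) s) (hc' : ∀ s, ContinuousWithinAt v' (Set.Ici s) s)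
    (hi : ∫ s in Set.Ioi 0, v s = 1) (hi' : ∫ s in Set.Ioi 0, v' s = 1) :
    IsNormalized (fun s => v (-s)) v' where
  nonneg_c s := h.nonneg _
  nonneg_r s := h'.nonneg _
  one_c s hs := h.one _ (by linarith)
  one_r s hs := h'.one _ hs
  monotone_c := fun s t hst => h.antitone (by linarith)
  antitone_r := h'.antitone
  left_cont_c s := (hc (-s)).comp continuous_neg.continuousWithinAt
    (by intro t ht; simpa using ht)
  right_cont_r s := hc' s
  integrable_c := by
    have := IntegrableOn.comp_neg_Iic (c := 0) (f := v)
      (by rw [neg_zero]; exact Iff.mpr integrableOn_Ici_iff_integrableOn_Ioi h.integrable)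
    simpa using this
  integrable_r := by rw [integrableOn_Ici_iff_integrableOn_Ioi]; exact h'.integrable
  integral_c := by rw [integral_comp_neg_Iic, neg_zero]; exact hi
  integral_r := by rw [integral_Ici_eq_integral_Ioi]; exact hi'

end Normalized

/-! ### Comparison of spaces by their fundamental functions -/

section Comparison

variable {k k' : ℝ → ℝ → ℝ}

/-- Homogeneity reduces to the quotient of the variables, taken at least 1; replacing it by its
integer part costs the factor 2. -/
lemma IsKFun.le_of_le_nat (hk : IsKFun k) (hk' : IsKFun k') {A : ℝ} (hA : 0 ≤ A)
    (h1 : ∀ n : ℕ, 1 ≤ n → k n 1 ≤ A * k' n 1) (h2 : ∀ n : ℕ, 1 ≤ n → k 1 n ≤ A * k' 1 n)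
    {s t : ℝ} (hs : 0 < s) (ht : 0 < t) : k s t ≤ 2 * A * k' s t := by
  have aux : ∀ {k k' : ℝ → ℝ → ℝ}, IsKFun k → IsKFun k' →
      (∀ n : ℕ, 1 ≤ n → k n 1 ≤ A * k' n 1) → ∀ {s t : ℝ}, 0 < t → t ≤ s →
        k s t ≤ 2 * A * k' s t := by
    intro k k' hk hk' h1 s t ht hts
    have hs : 0 < s := ht.trans_le hts
    have hx : 1 ≤ s / t := (one_le_div ht).2 hts
    have hx0 : 0 < s / t := by positivity
    set m := ⌊s / t⌋₊ with hm
    have hm1 : 1 ≤ m := (Nat.one_le_floor_iff _).2 hx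
    have hm' : (1 : ℝ) ≤ m := by exact_mod_cast hm1
    have f1 : (m : ℝ) ≤ s / t := Nat.floor_le (by positivity)
    have f2 : s / t ≤ m + 1 := (Nat.lt_floor_add_one _).le
    have e1 : k (s / t) 1 ≤ 2 * k m 1 := by
      rw [← hk.homog 2 m 1 two_pos (by linarith) one_pos]
      exact hk.mono _ _ _ _ hx0 one_pos (by linarith) (by norm_num)
    have e2 : k' m 1 ≤ k' (s / t) 1 := hk'.mono _ _ _ _ (by linarith) one_pos f1 le_rfl
    have e3 : k s t = t * k (s / t) 1 := by
      rw [← hk.homog t _ _ ht hx0 one_pos, mul_div_cancel₀ _ ht.ne', mul_one]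
    have e4 : k' s t = t * k' (s / t) 1 := by
      rw [← hk'.homog t _ _ ht hx0 one_pos, mul_div_cancel₀ _ ht.ne', mul_one]
    rw [e3, e4]
    calc t * k (s / t) 1 ≤ t * (2 * (A * k' (s / t) 1)) := by
          refine mul_le_mul_of_nonneg_left (e1.trans ?_) ht.le
          exact mul_le_mul_of_nonneg_left ((h1 m hm1).trans
            (mul_le_mul_of_nonneg_left e2 hA)) zero_le_two
      _ = _ := by ring
  rcases le_total t s with h | h
  · exact aux hk hk' h1 ht h
  · exact aux hk.op hk'.op h2 hs h

/-- Two spaces whose fundamental functions are equivalent are completely isomorphic. -/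
lemma Represents.completelyIso_of_equivOn {E E' : Type*} [AddCommGroup E] [Module ℂ E]
    [AddCommGroup E'] [Module ℂ E'] {N : MatrixNorms E} {N' : MatrixNorms E'} {T : E ≃ₗ[ℂ] Ell2}
    {T' : E' ≃ₗ[ℂ] Ell2} {C C' : ℝ} (h : Represents N T k C) (h' : Represents N' T' k' C')
    (hk : IsKFun k) (hk' : IsKFun k')
    (h1 : EquivOn (fun n : ℕ => 1 ≤ n) (fun n => k n 1) (fun n => k' n 1))
    (h2 : EquivOn (fun n : ℕ => 1 ≤ n) (fun n => k 1 n) (fun n => k' 1 n)) :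
    CompletelyIso N N' := by
  have hr : ∀ {n : ℕ}, 1 ≤ n → (0 : ℝ) < n := fun hn => by exact_mod_cast hn
  have key : ∀ {k k' : ℝ → ℝ → ℝ}, IsKFun k → IsKFun k' →
      EquivOn (fun n : ℕ => 1 ≤ n) (fun n => k n 1) (fun n => k' n 1) →
      EquivOn (fun n : ℕ => 1 ≤ n) (fun n => k 1 n) (fun n => k' 1 n) →
      ∃ A : ℝ, 0 ≤ A ∧ ∀ s t, 0 < s → 0 < t → k s t ≤ A * k' s t := by
    rintro k k' hk hk' ⟨A, hA, h1⟩ ⟨B, hB, h2⟩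
    refine ⟨2 * max A B, by positivity, fun s t hs ht => hk.le_of_le_nat hk' (by positivity)
      (fun n hn => (h1 n hn).2.trans ?_) (fun n hn => (h2 n hn).2.trans ?_) hs ht⟩
    · exact mul_le_mul_of_nonneg_right (le_max_left _ _) (hk'.nonneg _ _ (hr hn) one_pos)
    · exact mul_le_mul_of_nonneg_right (le_max_right _ _) (hk'.nonneg _ _ one_pos (hr hn))
  obtain ⟨A, hA, hA'⟩ := key hk hk' h1 h2
  obtain ⟨B, hB, hB'⟩ := key hk' hk h1.symm h2.symm
  refine ⟨_, h.completelyIsoWith h' (A := max A B) (by positivity) (fun s t hs ht => ?_)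
    fun s t hs ht => ?_⟩
  · exact (hA' s t hs ht).trans (mul_le_mul_of_nonneg_right (le_max_left _ _)
      (hk'.nonneg _ _ hs ht))
  · exact (hB' s t hs ht).trans (mul_le_mul_of_nonneg_right (le_max_right _ _)
      (hk.nonneg _ _ hs ht))

end Comparison

/-! ### Closed relations give subquotients of C ⊕ R completely isometrically -/

section Isometry

variable {G G' : Type*} [NormedAddCommGroup G] [InnerProductSpace ℂ G] [NormedAddCommGroup G']
  [InnerProductSpace ℂ G']

lemma columnNorms_map_isometry (ι : G →ₗᵢ[ℂ] G') {n : ℕ} (a : Matrix (Fin n) (Fin n) G) :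
    columnNorms G' n (a.map ι) = columnNorms G n a := by
  simp only [columnNorms, Matrix.map_apply, LinearIsometry.inner_map_map]

lemma rowNorms_map_isometry (ι : G →ₗᵢ[ℂ] G') {n : ℕ} (a : Matrix (Fin n) (Fin n) G) :
    rowNorms G' n (a.map ι) = rowNorms G n a := by
  simp only [rowNorms, Matrix.map_apply, LinearIsometry.inner_map_map]

end Isometry

section Rel

variable {H₁ H₂ X : Type*} [NormedAddCommGroup H₁] [InnerProductSpace ℂ H₁] [CompleteSpace H₁]
  [TopologicalSpace.SeparableSpace H₁] [NormedAddCommGroup H₂] [InnerProductSpace ℂ H₂]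
  [CompleteSpace H₂] [TopologicalSpace.SeparableSpace H₂] [NormedAddCommGroup X] [NormedSpace ℂ X]
  [CompleteSpace X] {L : Submodule ℂ ((H₁ × H₂) × X)}

/-- The quotient norms defined by a closed relation between Hilbert spaces turn `X` into a quotient
of a subspace of `C ⊕ R`. -/
theorem isQSWith_one_relNorm (hL : ∀ x, ∃ p, (p, x) ∈ L)
    (hc : IsClosed (L : Set ((H₁ × H₂) × X))) {A : ℝ}
    (hA : ∀ a b x, ((a, b), x) ∈ L → ‖x‖ ≤ A * max ‖a‖ ‖b‖) : IsQSWith 1 (relNorm L) := by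
  obtain ⟨ι₁⟩ := exists_isometry_ell2 (G := H₁)
  obtain ⟨ι₂⟩ := exists_isometry_ell2 (G := H₂)
  -- The embedded lifts form V and the lifts of 0 form S. As `hA` controls x by (a, b), forgetting x
  -- is a closed embedding of the complete space L.
  let Ψ : L →ₗ[ℂ] Ell2 × Ell2 :=
    (ι₁.toLinearMap.prodMap ι₂.toLinearMap).comp ((LinearMap.fst ℂ (H₁ × H₂) X).comp L.subtype)
  have hΨ : ∀ l : L, Ψ l = (ι₁ l.1.1.1, ι₂ l.1.1.2) := fun l => rfl
  have hnorm : ∀ l : L, ‖l‖ ≤ max 1 A * ‖Ψ l‖ := by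
    rintro ⟨⟨⟨a, b⟩, x⟩, hl⟩
    have e : ‖Ψ ⟨((a, b), x), hl⟩‖ = max ‖a‖ ‖b‖ := by
      rw [hΨ, Prod.norm_def]; simp only [LinearIsometry.norm_map]
    have h0 : 0 ≤ max ‖a‖ ‖b‖ := le_max_of_le_left (norm_nonneg a)
    rw [e]
    change max (max ‖a‖ ‖b‖) ‖x‖ ≤ _
    refine max_le (le_mul_of_one_le_left h0 (le_max_left _ _)) ((hA a b x hl).trans ?_)
    exact mul_le_mul_of_nonneg_right (le_max_right _ _) h0
  have hanti : AntilipschitzWith (max 1 A).toNNReal Ψ :=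
    AddMonoidHomClass.antilipschitz_of_bound Ψ fun l => by
      rw [Real.coe_toNNReal _ (by positivity)]; exact hnorm l
  have hcont : UniformContinuous Ψ := by
    refine (AddMonoidHomClass.lipschitz_of_bound Ψ 1 fun l => ?_).uniformContinuous
    obtain ⟨⟨⟨a, b⟩, x⟩, hl⟩ := l
    have e : ‖Ψ ⟨((a, b), x), hl⟩‖ = max ‖a‖ ‖b‖ := by
      rw [hΨ, Prod.norm_def]; simp only [LinearIsometry.norm_map]
    rw [e, one_mul]
    exact le_max_left _ ‖x‖
  have : CompleteSpace L := hc.completeSpace_coe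
  have hemb := hanti.isClosedEmbedding hcont
  let L0 : Submodule ℂ L := LinearMap.ker ((LinearMap.snd ℂ (H₁ × H₂) X).comp L.subtype)
  have hL0 : IsClosed (L0 : Set L) := by
    have : (L0 : Set L) = (fun l : L => l.1.2) ⁻¹' {0} := rfl
    rw [this]
    exact isClosed_singleton.preimage (by fun_prop)
  let V : Submodule ℂ (Ell2 × Ell2) := LinearMap.range Ψ
  let S : Submodule ℂ (Ell2 × Ell2) := L0.map Ψ
  have hSV : S ≤ V := LinearMap.map_le_range
  let e : L ≃ₗ[ℂ] V := LinearEquiv.ofInjective Ψ hanti.injective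
  have he : ∀ l : L, ((e l : V) : Ell2 × Ell2) = Ψ l := fun l => rfl
  let q : V →ₗ[ℂ] X :=
    ((LinearMap.snd ℂ (H₁ × H₂) X).comp L.subtype).comp e.symm.toLinearMap
  have hq : ∀ l : L, q (e l) = l.1.2 := fun l => by
    change (e.symm (e l)).1.2 = _
    rw [e.symm_apply_apply]
  have hqs : Function.Surjective q := fun x => by
    obtain ⟨p, hp⟩ := hL x
    exact ⟨e ⟨(p, x), hp⟩, hq _⟩
  have hker : LinearMap.ker q = S.submoduleOf V := by
    ext v
    obtain ⟨l, rfl⟩ := e.surjective v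
    rw [LinearMap.mem_ker, hq]
    change _ ↔ Ψ l ∈ S
    constructor
    · exact fun h => ⟨l, h, rfl⟩
    · rintro ⟨l', hl', h⟩
      have : l' = l := hanti.injective h
      rw [← this]; exact hl'
  let T : (V ⧸ S.submoduleOf V) ≃ₗ[ℂ] X :=
    (Submodule.quotEquivOfEq _ _ hker.symm).trans (q.quotKerEquivOfSurjective hqs)
  have hT : ∀ v : V, T (Submodule.Quotient.mk v) = q v := fun v => rfl
  refine ⟨V, S, hemb.isClosed_range, ?_, hSV, T.symm, fun n x => ?_⟩
  · exact hemb.isClosedMap _ hL0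
  have hset : subquotientNorms CsumR V S n (x.map T.symm) = relNorm L n x := by
    unfold subquotientNorms relNorm
    congr 1
    ext t
    constructor
    · rintro ⟨y, hy, rfl⟩
      have hy' : ∀ i j, (e.symm (y i j)).1.2 = x i j := fun i j => by
        have h1 := congrFun (congrFun hy i) j
        simp only [Matrix.map_apply] at h1
        rw [LinearEquiv.eq_symm_apply, hT] at h1
        exact h1
      refine ⟨fun i j => (e.symm (y i j)).1.1.1, fun i j => (e.symm (y i j)).1.1.2,
        fun i j => ?_, ?_⟩
      · rw [← hy' i j]; exact (e.symm (y i j)).2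
      · have h2 : ∀ i j, ((y i j : V) : Ell2 × Ell2) = Ψ (e.symm (y i j)) := fun i j => by
          rw [← he, e.apply_symm_apply]
        refine congrArg₂ max ?_ ?_
        · refine Eq.trans ?_
            (columnNorms_map_isometry ι₁ (Matrix.of fun i j => (e.symm (y i j)).1.1.1))
          refine congrArg (columnNorms Ell2 n) ?_
          ext1 i j
          exact congrArg Prod.fst (h2 i j)
        · refine Eq.trans ?_
            (rowNorms_map_isometry ι₂ (Matrix.of fun i j => (e.symm (y i j)).1.1.2))
          refine congrArg (rowNorms Ell2 n) ?_
          ext1 i j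
          exact congrArg Prod.snd (h2 i j)
    · rintro ⟨a, b, hab, rfl⟩
      refine ⟨fun i j => e ⟨((a i j, b i j), x i j), hab i j⟩, ?_, ?_⟩
      · ext1 i j
        exact (LinearEquiv.eq_symm_apply T).2 (hq _)
      · unfold CsumR C R
        rw [← columnNorms_map_isometry ι₁, ← rowNorms_map_isometry ι₂]
        rfl
  rw [hset, one_mul]
  exact ⟨le_rfl, le_rfl⟩

end Rel

section Weighted

variable {Ω : Type*} [MeasurableSpace Ω] {ν : Measure Ω} {uc ur : Ω → ℝ}

/-- Strict positivity of u makes ν absolutely continuous with respect to u ν; where u vanishes, a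
class in the weighted L₂ space carries no information. -/
lemma ae_of_ae_weighted {u : Ω → ℝ} (hu : Measurable u) (h0 : ∀ ω, 0 < u ω) {p : Ω → Prop}
    (h : ∀ᵐ ω ∂(weighted ν u), p ω) : ∀ᵐ ω ∂ν, p ω :=
  (withDensity_absolutelyContinuous' hu.ennreal_ofReal.aemeasurable
    (ae_of_all _ fun ω => (ENNReal.ofReal_pos.2 (h0 ω)).ne')).ae_le h

lemma mem_kRel_iff (hc : Measurable uc) (hr : Measurable ur) (hc0 : ∀ ω, 0 < uc ω)
    (hr0 : ∀ ω, 0 < ur ω) {a : Lp Ell2 2 (weighted ν uc)} {b : Lp Ell2 2 (weighted ν ur)}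
    {x : Ell2} : ((a, b), x) ∈ kRel ν uc ur ↔ ∀ᵐ ω ∂ν, a ω + b ω = x := by
  constructor
  · rintro ⟨f, g, hf, hg, h1, h2, h⟩
    obtain rfl : hf.toLp f = a := h1
    obtain rfl : hg.toLp g = b := h2
    filter_upwards [h, ae_of_ae_weighted hc hc0 hf.coeFn_toLp,
      ae_of_ae_weighted hr hr0 hg.coeFn_toLp] with ω e1 e2 e3
    rw [e2, e3, e1]
  · intro h
    exact ⟨a, b, Lp.memLp a, Lp.memLp b, Lp.toLp_coeFn a _, Lp.toLp_coeFn b _, h⟩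

/-- Convergence in L₂ gives almost everywhere convergence along a subsequence, extracted first for a
and then again for b, so the equation a + b = x survives. -/
lemma isClosed_kRel (hc : Measurable uc) (hr : Measurable ur) (hc0 : ∀ ω, 0 < uc ω)
    (hr0 : ∀ ω, 0 < ur ω) : IsClosed (SetLike.coe (kRel ν uc ur)) := by
  refine isSeqClosed_iff_isClosed.1 fun p p₀ hp hlim => ?_
  obtain ⟨⟨a, b⟩, x⟩ := p₀
  have h1 : Filter.Tendsto (fun k => (p k).1.1) Filter.atTop (nhds a) :=
    ((continuous_fst.comp continuous_fst).tendsto ((a, b), x)).comp hlim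
  have h2 : Filter.Tendsto (fun k => (p k).1.2) Filter.atTop (nhds b) :=
    ((continuous_snd.comp continuous_fst).tendsto ((a, b), x)).comp hlim
  have h3 : Filter.Tendsto (fun k => (p k).2) Filter.atTop (nhds x) :=
    (continuous_snd.tendsto ((a, b), x)).comp hlim
  obtain ⟨φ, hφ, hφa⟩ := (tendstoInMeasure_of_tendsto_Lp h1).exists_seq_tendsto_ae
  obtain ⟨ψ, hψ, hψb⟩ := (tendstoInMeasure_of_tendsto_Lp
    (h2.comp hφ.tendsto_atTop)).exists_seq_tendsto_ae
  refine (mem_kRel_iff hc hr hc0 hr0).2 ?_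
  have hmem : ∀ᵐ ω ∂ν, ∀ k, (p k).1.1 ω + (p k).1.2 ω = (p k).2 :=
    ae_all_iff.2 fun k => (mem_kRel_iff hc hr hc0 hr0).1 (hp k)
  filter_upwards [hmem, ae_of_ae_weighted hc hc0 hφa, ae_of_ae_weighted hr hr0 hψb]
    with ω e1 e2 e3
  have e4 := (e2.comp hψ.tendsto_atTop).add e3
  refine tendsto_nhds_unique e4 ?_
  refine Filter.Tendsto.congr (fun k => (e1 (φ (ψ k))).symm) ?_
  exact h3.comp (hφ.tendsto_atTop.comp hψ.tendsto_atTop)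

theorem IsWeightPair.isQSWith_one_K [MeasurableSpace.CountablyGenerated Ω] [SFinite ν]
    (h : IsWeightPair ν uc ur) (hpos : 0 < kWeight ν uc ur 1 1) (hc0 : ∀ ω, 0 < uc ω)
    (hr0 : ∀ ω, 0 < ur ω) : IsQSWith 1 (K ν uc ur) := by
  obtain ⟨A, hA, hA'⟩ := h.exists_norm1_K_le hpos
  have : SFinite (weighted ν uc) := by unfold weighted; infer_instance
  have : SFinite (weighted ν ur) := by unfold weighted; infer_instance
  have : Fact ((2 : ENNReal) ≠ ⊤) := ⟨ENNReal.ofNat_ne_top⟩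
  rw [K_eq_relNorm] at *
  refine isQSWith_one_relNorm (A := A) h.kRel_surj
    (isClosed_kRel h.measurable_c h.measurable_r hc0 hr0) fun a b x hab => ?_
  exact (hA' x).2.trans (mul_le_mul_of_nonneg_left (relNorm_one_sq_le a b x hab) hA.le)

end Weighted

/-! ### Regular fundamental functions -/

section

variable {E : Type*} [AddCommGroup E] [Module ℂ E] {N : MatrixNorms E} {J : Ell2 ≃ₗ[ℂ] E}
  {T : E ≃ₗ[ℂ] Ell2} {wc wr : ℝ → ℝ} {C : ℝ}

lemma CompletelyIso.represents {E' : Type*} [AddCommGroup E'] [Module ℂ E'] {N' : MatrixNorms E'}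
    (hiso : CompletelyIso N N') (hN : ∀ n x, 0 ≤ N n x) {T' : E' ≃ₗ[ℂ] Ell2} {k : ℝ → ℝ → ℝ}
    {C' : ℝ} (h' : Represents N' T' k C') : ∃ T C, Represents N T k C := by
  obtain ⟨K, S, hS⟩ := hiso
  have h : CompletelyIsoWith (max K 1) N N' := ⟨S, fun n x =>
    ⟨(hS n x).1.trans (mul_le_mul_of_nonneg_right (le_max_left _ _) (hN n x)),
      (hS n x).2.trans (mul_le_mul_of_nonneg_right (le_max_left _ _) (h'.nonneg n _))⟩⟩
  obtain ⟨T, hT⟩ := h.represents hN (by positivity) h'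
  exact ⟨T, _, hT⟩

lemma not_finiteDimensional_of_equiv (J : Ell2 ≃ₗ[ℂ] E) : ¬ FiniteDimensional ℂ E := by
  intro h
  have : FiniteDimensional ℂ Ell2 := J.symm.finiteDimensional
  exact not_finite_iff_infinite.2 inferInstance (orthonormal_stdVec.linearIndependent.finite)

/-- A regular sequence does not grow linearly. -/
lemma IsRegularSeq.nonpos_of_le {Φ f : ℕ → ℝ} (h : IsRegularSeq Φ)
    (hf : EquivOn (fun n : ℕ => 1 ≤ n) Φ f) {c : ℝ} (hc : ∀ n : ℕ, 1 ≤ n → c * n ≤ f n) :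
    c ≤ 0 := by
  by_contra hc0
  push Not at hc0
  obtain ⟨A, hA, hA'⟩ := hf.symm
  obtain ⟨_, d, α, β, -, hd, -, -, hβ, hr⟩ := h
  have h1 : 0 < Φ 1 := by
    have e1 := (hA' 1 le_rfl).2
    have e2 := hc 1 le_rfl
    rw [Nat.cast_one, mul_one] at e2
    exact pos_of_mul_pos_right (hc0.trans_le (e2.trans e1)) hA.le
  have ht : Filter.Tendsto (fun n : ℕ => c * (n : ℝ) ^ (1 - β)) Filter.atTop Filter.atTop :=
    ((tendsto_rpow_atTop (by linarith)).comp tendsto_natCast_atTop_atTop).const_mul_atTop hc0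
  obtain ⟨n, hn, hn1⟩ := ((ht.eventually_gt_atTop (A * (d * Φ 1))).and
    (Filter.eventually_ge_atTop 1)).exists
  have hn0 : (0 : ℝ) < n := by exact_mod_cast hn1
  have e1 := (hr 1 n le_rfl hn1).2
  rw [div_le_iff₀ h1, Nat.cast_one, div_one] at e1
  have e2 : c * n ≤ A * (d * (n : ℝ) ^ β * Φ 1) :=
    ((hc n hn1).trans (hA' n hn1).2).trans (mul_le_mul_of_nonneg_left e1 hA.le)
  have hnb : 0 < (n : ℝ) ^ β := by positivity
  have e3 := mul_lt_mul_of_pos_right hn hnb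
  rw [mul_assoc c, ← Real.rpow_add hn0, sub_add_cancel, Real.rpow_one] at e3
  linarith

/-- Positivity at (1, 1) comes from the coefficients, since the integral of the minimum may vanish
for arbitrary weights. -/
lemma IsWeightPair.isKFun_inter {Ω : Type*} [MeasurableSpace Ω] {ν : Measure Ω} {uc ur : Ω → ℝ}
    (h : IsWeightPair ν uc ur) {lam gam : ℝ} (hpos : 0 < lam ^ 2 + gam ^ 2) :
    IsKFun (fun s t => lam ^ 2 * s + gam ^ 2 * t + kWeight ν uc ur s t) where
  nonneg s t hs ht := by
    have := h.kWeight_nonneg hs.le ht.le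
    positivity
  homog c s t hc hs ht := by
    rw [kWeight_homog hc.le]; ring
  mono s t s' t' hs ht hss htt := by
    have := h.kWeight_mono hs.le ht.le hss htt
    gcongr
  pos := by
    have := h.kWeight_nonneg zero_le_one zero_le_one
    linarith

/-- An intersection with regular fundamental functions involves neither `C` nor `R`. -/
theorem eq_zero_of_completelyIso_interCRK (hN : ∀ n x, 0 ≤ N n x) (hJ : IsHilbertIso N J)
    (hC : IsRegularSeq (fundC N J)) (hR : IsRegularSeq (fundR N J)) {Ω : Type*} [MeasurableSpace Ω]
    {ν : Measure Ω} {uc ur : Ω → ℝ} (hu : IsWeightPair ν uc ur) {lam gam : ℝ} (hl : 0 ≤ lam)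
    (hg : 0 ≤ gam) (hiso : CompletelyIso N (interCRK lam gam ν uc ur)) : lam = 0 ∧ gam = 0 := by
  obtain ⟨T, C, hT⟩ := hiso.represents hN (hu.represents_interCRK hl hg)
  by_contra hne
  have hpos : 0 < lam ^ 2 + gam ^ 2 := by
    refine lt_of_le_of_ne (by positivity) fun h0 => hne ⟨?_, ?_⟩
    · exact pow_eq_zero_iff two_ne_zero |>.1 (by nlinarith [sq_nonneg lam, sq_nonneg gam])
    · exact pow_eq_zero_iff two_ne_zero |>.1 (by nlinarith [sq_nonneg lam, sq_nonneg gam])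
  have hk := hu.isKFun_inter hpos
  -- The column fundamental function would grow at least like lam² n; the row function is treated in
  -- the same way with gam.
  have h1 : lam ^ 2 ≤ 0 := hC.nonpos_of_le (hT.fundC_equiv hk hJ) fun n hn => by
    have := hu.kWeight_nonneg (Nat.cast_nonneg n : (0 : ℝ) ≤ n) zero_le_one
    have := sq_nonneg gam
    linarith
  have h2 : gam ^ 2 ≤ 0 := hR.nonpos_of_le (hT.fundR_equiv hk hJ) fun n hn => by
    have := hu.kWeight_nonneg zero_le_one (Nat.cast_nonneg n : (0 : ℝ) ≤ n)
    have := sq_nonneg lam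
    linarith
  linarith

lemma IsNormalized.fundC_equiv (hw : IsNormalized wc wr)
    (h : Represents N T (kWeight volume wc wr) C) (hJ : IsHilbertIso N J) :
    EquivOn (fun n : ℕ => 1 ≤ n) (fundC N J) (fun n => truncMean (fun s => wc (-s)) n) := by
  refine (h.fundC_equiv (hw.isWeightPair.isKFun hw.kWeight_pos) hJ).congr_right fun n hn => ?_
  exact hw.kWeight_one_left (by exact_mod_cast hn)

lemma IsNormalized.fundR_equiv (hw : IsNormalized wc wr)
    (h : Represents N T (kWeight volume wc wr) C) (hJ : IsHilbertIso N J) :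
    EquivOn (fun n : ℕ => 1 ≤ n) (fundR N J) (fun n => truncMean wr n) := by
  refine (h.fundR_equiv (hw.isWeightPair.isKFun hw.kWeight_pos) hJ).congr_right fun n hn => ?_
  exact hw.kWeight_one_right (by exact_mod_cast hn)

/-- The truncated mean increases and at most doubles with its argument, so an equivalence at the
integers extends to the interpolation. -/
lemma IsProfile.equiv_genInv_plExt {v : ℝ → ℝ} (hv : IsProfile v) {Φ : ℕ → ℝ} (h : IsRegularSeq Φ)
    (h0 : ∀ n, 0 ≤ Φ n) (H : EquivOn (fun n : ℕ => 1 ≤ n) Φ (fun n => truncMean v n)) :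
    EquivOn (fun t : ℝ => 1 ≤ t) v (fun t => 1 / genInv (plExt Φ) t) :=
  hv.equiv_of_truncMean (h.isRegularFun_plExt h0)
    (plExt_equiv (fun _ _ hs hst => hv.truncMean_mono (by linarith) hst)
      (fun _ hs => hv.truncMean_mul_le one_le_two (by linarith)) H).symm

/-- The weights of a normalised pair are determined by the fundamental functions. -/
theorem IsNormalized.equiv_genInv (hw : IsNormalized wc wr) (hN : ∀ n x, 0 ≤ N n x)
    (hJ : IsHilbertIso N J) (hC : IsRegularSeq (fundC N J)) (hR : IsRegularSeq (fundR N J))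
    (hiso : CompletelyIso N (K volume wc wr)) :
    EquivOn (fun t : ℝ => 1 ≤ t) (fun t => wc (-t)) (fun t => 1 / genInv (plExt (fundC N J)) t) ∧
      EquivOn (fun t : ℝ => 1 ≤ t) wr (fun t => 1 / genInv (plExt (fundR N J)) t) := by
  obtain ⟨T, C, hT⟩ := hiso.represents hN hw.isWeightPair.represents_K
  exact ⟨hw.isProfile_c.equiv_genInv_plExt hC (fundC_nonneg N J) (hw.fundC_equiv hT hJ),
    hw.isProfile_r.equiv_genInv_plExt hR (fundR_nonneg N J) (hw.fundR_equiv hT hJ)⟩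

/-- A space in `HQS (C ⊕ R)` is determined by its fundamental functions. -/
theorem IsHQS.completelyIso_K (h : IsHQS N) (hJ : IsHilbertIso N J) (hw : IsNormalized wc wr)
    (hC : EquivOn (fun n : ℕ => 1 ≤ n) (fundC N J) (fun n => truncMean (fun s => wc (-s)) n))
    (hR : EquivOn (fun n : ℕ => 1 ≤ n) (fundR N J) (fun n => truncMean wr n)) :
    CompletelyIso N (K volume wc wr) := by
  obtain ⟨κ, M, h⟩ := h
  obtain ⟨T, k, hk, -, -, -, hT⟩ := h.exists_represents (not_finiteDimensional_of_equiv J)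
  refine hT.completelyIso_of_equivOn hw.isWeightPair.represents_K hk
    (hw.isWeightPair.isKFun hw.kWeight_pos) ?_ ?_
  · refine ((hT.fundC_equiv hk hJ).symm.trans hC).congr_right fun n hn => ?_
    exact (hw.kWeight_one_left (by exact_mod_cast hn)).symm
  · refine ((hT.fundR_equiv hk hJ).symm.trans hR).congr_right fun n hn => ?_
    exact (hw.kWeight_one_right (by exact_mod_cast hn)).symm

end

/-- Every pair of regular functions is realised by a normalised pair of weights. -/
theorem exists_isNormalized {gc gr : ℝ → ℝ} (hgc : IsRegularFun gc) (hgr : IsRegularFun gr) :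
    ∃ wc wr : ℝ → ℝ, IsNormalized wc wr ∧ (∀ s, 0 < wc s) ∧ (∀ s, 0 < wr s) ∧
      EquivOn (fun t : ℝ => 1 ≤ t) (fun t => wc (-t)) (fun t => 1 / genInv gc t) ∧
      EquivOn (fun t : ℝ => 1 ≤ t) (fun t => wr t) (fun t => 1 / genInv gr t) ∧
      EquivOn (fun n : ℕ => 1 ≤ n) (fun n => truncMean (fun s => wc (-s)) n) (fun n => gc n) ∧
      EquivOn (fun n : ℕ => 1 ≤ n) (fun n => truncMean wr n) (fun n => gr n) := by
  obtain ⟨v, hv, hv0, hvc, hvi, hve⟩ := hgc.exists_profile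
  obtain ⟨w, hw, hw0, hwc, hwi, hwe⟩ := hgr.exists_profile
  refine ⟨_, w, hv.isNormalized hw hvc hwc hvi hwi, fun s => hv0 _, hw0, ?_, hwe, ?_, ?_⟩
  · simpa only [neg_neg] using hve
  · simpa only [neg_neg] using
      (hv.truncMean_equiv hgc hve).comp (fun n : ℕ => (n : ℝ)) fun n hn => by exact_mod_cast hn
  · exact (hw.truncMean_equiv hgr hwe).comp (fun n : ℕ => (n : ℝ)) fun n hn => by exact_mod_cast hn

end OpSpace

end

theorem theorem0p1 :
    -- Representation, with a constant depending only on `κ` and `M`.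
    (∃ c : ℝ → ℝ → ℝ, ∀ (E : Type*) [AddCommGroup E] [Module ℂ E] (N : OpSpace.MatrixNorms E)
      (κ M : ℝ), OpSpace.IsHQSWith κ M N → ¬ FiniteDimensional ℂ E →
        ∃ (lam gam : ℝ) (uc ur : ℝ → ℝ), 0 ≤ lam ∧ lam ≤ 1 ∧ 0 ≤ gam ∧ gam ≤ 1 ∧
          OpSpace.IsWeightPair MeasureTheory.volume uc ur ∧ (∀ s, 0 < uc s) ∧ (∀ s, 0 < ur s) ∧
          OpSpace.CompletelyIsoWith (c κ M) N
            (OpSpace.interCRK lam gam MeasureTheory.volume uc ur)) ∧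
    -- The regular case, for any choice of the orthonormal basis `J e_k`.
    (∀ (E : Type*) [AddCommGroup E] [Module ℂ E] (N : OpSpace.MatrixNorms E)
      (J : OpSpace.Ell2 ≃ₗ[ℂ] E), OpSpace.IsHQS N → OpSpace.IsHilbertIso N J →
      OpSpace.IsRegularSeq (OpSpace.fundC N J) → OpSpace.IsRegularSeq (OpSpace.fundR N J) →
        (∀ (lam gam : ℝ) (uc ur : ℝ → ℝ), 0 ≤ lam → 0 ≤ gam →
          OpSpace.IsWeightPair MeasureTheory.volume uc ur →
          OpSpace.CompletelyIso N (OpSpace.interCRK lam gam MeasureTheory.volume uc ur) →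
            lam = 0 ∧ gam = 0) ∧
        (∃ wc wr : ℝ → ℝ, OpSpace.IsNormalized wc wr ∧
          OpSpace.CompletelyIso N (OpSpace.K MeasureTheory.volume wc wr)) ∧
        (∀ wc wr : ℝ → ℝ, OpSpace.IsNormalized wc wr →
          OpSpace.CompletelyIso N (OpSpace.K MeasureTheory.volume wc wr) →
            OpSpace.EquivOn (fun t : ℝ => 1 ≤ t) (fun t => wc (-t))
              (fun t => 1 / OpSpace.genInv (OpSpace.plExt (OpSpace.fundC N J)) t) ∧
            OpSpace.EquivOn (fun t : ℝ => 1 ≤ t) (fun t => wr t)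
              (fun t => 1 / OpSpace.genInv (OpSpace.plExt (OpSpace.fundR N J)) t))) ∧
    -- Every pair of regular functions is realised by exactly one space.
    (∀ gc gr : ℝ → ℝ, OpSpace.IsRegularFun gc → OpSpace.IsRegularFun gr →
      ∃ wc wr : ℝ → ℝ, OpSpace.IsNormalized wc wr ∧
        OpSpace.EquivOn (fun t : ℝ => 1 ≤ t) (fun t => wc (-t))
          (fun t => 1 / OpSpace.genInv gc t) ∧
        OpSpace.EquivOn (fun t : ℝ => 1 ≤ t) (fun t => wr t)
          (fun t => 1 / OpSpace.genInv gr t) ∧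
        (∃ κ : ℝ, OpSpace.IsHQSWith κ 1 (OpSpace.K MeasureTheory.volume wc wr)) ∧
        (∃ J : OpSpace.Ell2 ≃ₗ[ℂ] OpSpace.Ell2,
          OpSpace.IsHilbertIso (OpSpace.K MeasureTheory.volume wc wr) J ∧
          OpSpace.EquivOn (fun n : ℕ => 1 ≤ n)
            (OpSpace.fundC (OpSpace.K MeasureTheory.volume wc wr) J) (fun n => gc n) ∧
          OpSpace.EquivOn (fun n : ℕ => 1 ≤ n)
            (OpSpace.fundR (OpSpace.K MeasureTheory.volume wc wr) J) (fun n => gr n)) ∧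
        (∀ (E : Type*) [AddCommGroup E] [Module ℂ E] (N : OpSpace.MatrixNorms E)
          (J : OpSpace.Ell2 ≃ₗ[ℂ] E), OpSpace.IsHQS N → OpSpace.IsHilbertIso N J →
          OpSpace.EquivOn (fun n : ℕ => 1 ≤ n) (OpSpace.fundC N J) (fun n => gc n) →
          OpSpace.EquivOn (fun n : ℕ => 1 ≤ n) (OpSpace.fundR N J) (fun n => gr n) →
            OpSpace.CompletelyIso N (OpSpace.K MeasureTheory.volume wc wr))) := by
  refine ⟨OpSpace.exists_interCRK, ?_, ?_⟩
  · intro E _ _ N J hN hJ hC hR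
    have hN0 : ∀ n x, 0 ≤ N n x := by
      obtain ⟨κ, M, h⟩ := hN
      exact h.isOperatorSpace.nonneg
    refine ⟨fun lam gam uc ur hl hg hu hiso =>
      OpSpace.eq_zero_of_completelyIso_interCRK hN0 hJ hC hR hu hl hg hiso, ?_,
      fun wc wr hw hiso => hw.equiv_genInv hN0 hJ hC hR hiso⟩
    -- The interpolated fundamental functions are regular, so they can be prescribed; agreement at
    -- the integers then identifies the space.
    obtain ⟨wc, wr, hw, -, -, -, -, h1, h2⟩ := OpSpace.exists_isNormalized
      (hC.isRegularFun_plExt (OpSpace.fundC_nonneg N J))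
      (hR.isRegularFun_plExt (OpSpace.fundR_nonneg N J))
    simp only [OpSpace.plExt_natCast] at h1 h2
    exact ⟨wc, wr, hw, hN.completelyIso_K hJ hw h1.symm h2.symm⟩
  · intro gc gr hgc hgr
    -- The strict positivity of these weights makes the defining relation closed, which yields the
    -- constant M = 1.
    obtain ⟨wc, wr, hw, hc0, hr0, ec, er, h1, h2⟩ := OpSpace.exists_isNormalized hgc hgr
    have hu := hw.isWeightPair
    have hpos := hw.kWeight_pos
    have hJ := hu.isHilbertIso_refl hpos
    obtain ⟨κ, hκ⟩ := hu.isHomogeneous_K hpos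
    exact ⟨wc, wr, hw, ec, er,
      ⟨κ, hu.isOperatorSpace_K hpos, hκ, hu.isQSWith_one_K hpos hc0 hr0⟩,
      ⟨LinearEquiv.refl ℂ OpSpace.Ell2, hJ, (hw.fundC_equiv hu.represents_K hJ).trans h1,
        (hw.fundR_equiv hu.represents_K hJ).trans h2⟩,
      fun E _ _ N J hN hNJ hC hR => hN.completelyIso_K hNJ hw (hC.trans h1.symm) (hR.trans h2.symm)⟩
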